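/- **Setting.** Let $2\le M\le N$. An instance consists of a bipartite graph $\mathcal G(\mathcal U\cup\mathcal S,\mathcal E)$ with users $\mathcal U=\{u_1,\dots,u_M\}$ and subchannels $\mathcal S=\{s_1,\dots,s_N\}$, and integers $1\le K_m\le\widetilde K_m$ with $\sum_m\widetilde K_m=N$. An $f$-matching is a set of edges with at most $K_m$ edges at each $u_m$ and at most one edge at each $s_n$. A matching ($f$-matching) $\mathcal M$ has *approximation factor* $\varepsilon$ if $|\mathcal M|\ge(1-\varepsilon)|\mathcal M^{\rm m}|$ for every maximum matching ($f$-matching) $\mathcal M^{\rm m}$. Logarithms are natural. **Algorithm PVER²HK with parameter $\eta>0$.** 1. Put $l^*=2\log^\eta N+1$. Replace each $u_m$ by $K_m$ copies with the same neighbours, distribute the copies evenly into $\min_m K_m$ groups (copy $j$ goes to group $j \bmod \min_m K_m$), and randomly rotate the sequence of groups and the sequence of vertices inside each group. This gives a bipartite graph $\widetilde{\mathcal G}$ between the list $\widetilde{\mathcal U}$ of all copies and $\mathcal S$. Start with $\widetilde{\mathcal M}=\emptyset$. 2. Repeat the following phase. Orient the edges of $\widetilde{\mathcal G}$ outside $\widetilde{\mathcal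 M}$ from $\widetilde{\mathcal U}$ to $\mathcal S$ and those of $\widetilde{\mathcal M}$ from $\mathcal S$ to $\widetilde{\mathcal U}$. Run breadth-first search from all free vertices of $\widetilde{\mathcal U}$ until a free vertex of $\mathcal S$ is first hit, in layer $l$. If this does not happen for any $l<l^*$, stop. Otherwise choose a (any) maximal set of vertex-disjoint paths of length $l$ in the layer graph from free vertices of $\widetilde{\mathcal U}$ to free vertices of $\mathcal S$, and replace $\widetilde{\mathcal M}$ by its symmetric difference with the edges of these paths. 3. Map $\widetilde{\mathcal M}$ to an edge set $\mathcal M_f$ of $\mathcal G$ by identifying the copies of each user. Let $k_m$ be the number of edges of $\mathcal M_f$ at $u_m$; $u_m$ receives the $k_m$ subchannels matched to it, and $\widetilde K_m-k_m$ of the remaining subchannels, which are distributed among the users in a random order. **Machine model.** A randomized synchronous priority-CRCW PRAM runs one fixed program for all inputs, with $N^{c}$ processors and words in $\{0,\dots,N^c-1\}$ for a constant $c$, unit-cost word arithmetic, and a table of $N^c$ independent uniformly distributed random words. The input is the instance together with the values of the random draws of steps 1 and 3 (the rotations, and the order of the remaining subchannels); the output is $\mathcal M_f$ and the allocation. **Theorem.**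 There is a constant $\eta_0>0$ such that for every constant $\eta\ge\eta_0$ there is a constant $C$ with the following properties. (a) For all $2\le M\le N$, all instances, all values of the random draws and all choices in step 2, $\widetilde{\mathcal M}$ is a matching of $\widetilde{\mathcal G}$ and $\mathcal M_f$ is an $f$-matching of $\mathcal G$ when the algorithm stops, both with approximation factor $\log^{-\eta}N$; and the numbers $l$ of layers, summed over all augmenting phases, amount to at most $C\log^{2\eta}N$. (b) The algorithm can be carried out on such a PRAM (with a constant $c$ that may depend on $\eta$, but not on the input) in parallel time $O(\log^{2\eta}N)$: there is a program such that, for all $2\le M\le N$, all instances and all values of the random draws, it halts within $C\log^{2\eta}N$ parallel steps with probability at least $1-1/N$ over its random words, and whenever it halts, its output is one that PVER²HK can produce with these draws. -/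

import Mathlib

namespace PVER2HK

/-! ### Matchings and `f`-matchings of bipartite graphs

A bipartite graph with classes `P` and `S` is given by its adjacency relation `A : P → S → Prop`;
an edge is a pair `(x, s)`. -/

section Bipartite

variable {P S : Type}

/-- A set of pairwise disjoint edges. -/
def IsMatching (A : P → S → Prop) (X : Set (P × S)) : Prop :=
  (∀ e ∈ X, A e.1 e.2) ∧ ∀ e ∈ X, ∀ e' ∈ X, e.1 = e'.1 ∨ e.2 = e'.2 → e = e'

/-- A set of edges with at most `f x` edges at `x : P` and at most one edge at each `s : S`. -/
def IsFMatching (A : P → S → Prop) (f : P → ℕ) (X : Set (P × S)) : Prop :=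
  (∀ e ∈ X, A e.1 e.2) ∧ (∀ x, {s | (x, s) ∈ X}.ncard ≤ f x) ∧ ∀ s, {x | (x, s) ∈ X}.ncard ≤ 1

/-- `X` has the maximum number of edges among the edge sets with the property `Q`. -/
def IsMaximum (Q : Set (P × S) → Prop) (X : Set (P × S)) : Prop :=
  Q X ∧ ∀ Y, Q Y → Y.ncard ≤ X.ncard

/-- `X` has the property `Q` and approximates the maximum edge sets with the property `Q` with
approximation factor `ε`, that is, `|X| ≥ (1 - ε) |X_max|`. -/
def Approximates (Q : Set (P × S) → Prop) (ε : ℝ) (X : Set (P × S)) : Prop :=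
  Q X ∧ ∀ Y, IsMaximum Q Y → (1 - ε) * (Y.ncard : ℝ) ≤ (X.ncard : ℝ)

/-! ### The phases of the Hopcroft-Karp loop -/

/-- The vertex `x : P` is unsaturated by `X`. -/
def FreeLeft (X : Set (P × S)) (x : P) : Prop := ∀ s, (x, s) ∉ X

/-- The vertex `s : S` is unsaturated by `X`. -/
def FreeRight (X : Set (P × S)) (s : S) : Prop := ∀ x, (x, s) ∉ X

/-- The digraph of a graph and a matching: directed paths are the alternating paths, so the edges
outside of the matching lead from `P` to `S` and those of the matching lead from `S` to `P`. -/
def Arc (A : P → S → Prop) (X : Set (P × S)) : P ⊕ S → P ⊕ S → Prop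
  | .inl x, .inr s => A x s ∧ (x, s) ∉ X
  | .inr s, .inl x => (x, s) ∈ X
  | _, _ => False

/-- The vertices that breadth-first search from the free vertices of `P` reaches in at most `k`
steps. -/
def reach (A : P → S → Prop) (X : Set (P × S)) : ℕ → Set (P ⊕ S)
  | 0 => {v | ∃ x, FreeLeft X x ∧ v = .inl x}
  | k + 1 => reach A X k ∪ {v | ∃ u ∈ reach A X k, Arc A X u v}

/-- Layer `k` of the breadth-first search: the vertices at distance exactly `k`. -/
def layer (A : P → S → Prop) (X : Set (P × S)) : ℕ → Set (P ⊕ S)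
  | 0 => reach A X 0
  | k + 1 => reach A X (k + 1) \ reach A X k

/-- The search first hits a free vertex of `S` in layer `l`. -/
def FirstHit (A : P → S → Prop) (X : Set (P × S)) (l : ℕ) : Prop :=
  (∃ s, FreeRight X s ∧ .inr s ∈ reach A X l) ∧
    ∀ j < l, ∀ s, FreeRight X s → .inr s ∉ reach A X j

/-- A path of length `l` in the layer graph, from a free vertex of `P` to a free vertex of `S`. -/
def IsLayerPath (A : P → S → Prop) (X : Set (P × S)) (l : ℕ) (p : Fin (l + 1) → P ⊕ S) : Prop :=
  (∀ i : Fin (l + 1), p i ∈ layer A X (i : ℕ)) ∧ (∀ i : Fin l, Arc A X (p i.castSucc) (p i.succ)) ∧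
    ∃ s, FreeRight X s ∧ p (Fin.last l) = .inr s

/-- A maximal set of vertex-disjoint paths of length `l` in the layer graph. -/
def IsMaximalDisjointPaths (A : P → S → Prop) (X : Set (P × S)) (l : ℕ)
    (D : Set (Fin (l + 1) → P ⊕ S)) : Prop :=
  (∀ p ∈ D, IsLayerPath A X l p) ∧
  (∀ p ∈ D, ∀ q ∈ D, p ≠ q → ∀ i j, p i ≠ q j) ∧
  ∀ p, IsLayerPath A X l p → ∃ q ∈ D, ∃ i j, p i = q j

/-- The (undirected) edges of the paths in `D`. -/
def pathEdges {l : ℕ} (D : Set (Fin (l + 1) → P ⊕ S)) : Set (P × S) :=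
  {e | ∃ p ∈ D, ∃ i : Fin l,
    (p i.castSucc = .inl e.1 ∧ p i.succ = .inr e.2) ∨
    (p i.castSucc = .inr e.2 ∧ p i.succ = .inl e.1)}

/-- One phase, with `l` layers after the initial one: build the layer graph, choose a maximal set
of vertex-disjoint paths of length `l < lmax`, and augment the matching along all of them. -/
def Phase (A : P → S → Prop) (lmax : ℝ) (l : ℕ) (X X' : Set (P × S)) : Prop :=
  FirstHit A X l ∧ (l : ℝ) < lmax ∧
    ∃ D, IsMaximalDisjointPaths A X l D ∧ X' = symmDiff X (pathEdges D)

/-- The loop stops: `l = ∞`, no free vertex of `S` is found in fewer than `lmax` layers. -/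
def Stopped (A : P → S → Prop) (lmax : ℝ) (X : Set (P × S)) : Prop :=
  ∀ l, FirstHit A X l → lmax ≤ (l : ℝ)

/-- `Loop A lmax X t`: some sequence of phases leads from the empty matching to `X`, and sweeps
through `t` layers in total. -/
inductive Loop (A : P → S → Prop) (lmax : ℝ) : Set (P × S) → ℕ → Prop
  | start : Loop A lmax ∅ 0
  | phase {X X' : Set (P × S)} {t l : ℕ} :
      Loop A lmax X t → Phase A lmax l X X' → Loop A lmax X' (t + l)

end Bipartite

/-! ### The algorithm -/

/-- The allocation problem: `M` users, `N` subchannels, the graph of non-outage pairs, the number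
`Kt m` of subchannels that user `m` has to receive, and the number `K m` of non-outage subchannels
that are requested for it. -/
structure Inst (M N : ℕ) where
  adj : Fin M → Fin N → Bool
  K : Fin M → ℕ
  Kt : Fin M → ℕ
  one_le : ∀ m, 1 ≤ K m
  le_Kt : ∀ m, K m ≤ Kt m
  sum_Kt : ∑ m, Kt m = N

namespace Inst

variable {M N : ℕ} (I : Inst M N)

/-- Adjacency in the bipartite graph of users and subchannels. -/
def Adj (m : Fin M) (s : Fin N) : Prop := I.adj m s = true

/-- The smallest of the numbers `K m`. -/
noncomputable def Kmin : ℕ := ⨅ m, I.K m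

/-- The expanded user vertices: `K m` copies of each user `m`. -/
abbrev Copy : Type := Σ m : Fin M, Fin (I.K m)

/-- All copies, user by user. -/
def copies : List I.Copy :=
  (List.finRange M).flatMap fun m => (List.finRange (I.K m)).map fun j => ⟨m, j⟩

/-- The copies are divided into `Kmin` groups, over which those of each user are spread evenly. -/
noncomputable def group (i : Fin I.Kmin) : List I.Copy :=
  I.copies.filter fun v => (v.2 : ℕ) % I.Kmin = i

/-- The values of the random draws of the algorithm: the rotation of the family of groups, the
rotation inside each group, and the order in which the remaining subchannels are given out. -/
structure Draw where
  family : Fin I.Kmin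
  inner : (i : Fin I.Kmin) → Fin (I.group i).length
  order : Equiv.Perm (Fin N)

variable (d : I.Draw)

/-- The copies, in the order after the rotations. -/
noncomputable def rotated : List I.Copy :=
  ((List.finRange I.Kmin).rotate d.family).flatMap fun i => (I.group i).rotate (d.inner i)

/-- The user of which the copy at position `x` of the rotated order is a copy. -/
noncomputable def user (x : Fin (I.rotated d).length) : Fin M := ((I.rotated d).get x).1

/-- The expanded and rotated bipartite graph. -/
def ExpandedAdj (x : Fin (I.rotated d).length) (s : Fin N) : Prop := I.Adj (I.user d x) s

/-- The edge set in the original graph that a matching of the expanded graph is mapped to. -/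
def contract (X : Set (Fin (I.rotated d).length × Fin N)) : Set (Fin M × Fin N) :=
  (fun e => (I.user d e.1, e.2)) '' X

/-- The final allocation: `owner s` is the user that receives the subchannel `s`. Matched
subchannels go to the users they are matched to; the others are taken in the order `d.order`, and
fill up the users one after the other, so that each user `m` ends up with `Kt m` subchannels. -/
def IsAllocation (F : Set (Fin M × Fin N)) (owner : Fin N → Fin M) : Prop :=
  (∀ e ∈ F, owner e.2 = e.1) ∧ (∀ m, {s | owner s = m}.ncard = I.Kt m) ∧
    ∀ s s', FreeRight F s → FreeRight F s' → d.order s < d.order s' → owner s ≤ owner s'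

/-- `I.Run d η X t F owner`: with the random draws `d` and the parameter `η`, the algorithm can
compute the matching `X` of the expanded graph (after sweeping through `t` layers in all its
phases), the `f`-matching `F` of the original graph and the allocation `owner`. -/
def Run (η : ℝ) (X : Set (Fin (I.rotated d).length × Fin N)) (t : ℕ)
    (F : Set (Fin M × Fin N)) (owner : Fin N → Fin M) : Prop :=
  Loop (I.ExpandedAdj d) (2 * Real.log N ^ η + 1) X t ∧
  Stopped (I.ExpandedAdj d) (2 * Real.log N ^ η + 1) X ∧
  F = I.contract d X ∧ I.IsAllocation d F owner

end Inst

/-! ### Parallel random access machines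

A synchronous priority CRCW machine with `W` processors, whose shared memory and arithmetic work
with words in `{0, …, W - 1}`, and which has a table of `W` random words. -/

/-- Expressions, evaluated by each processor on its own. -/
inductive Expr where
  | const (k : ℕ)
  | pid
  | load (a : Expr)
  | rand (a : Expr)
  | add (a b : Expr)
  | sub (a b : Expr)
  | mul (a b : Expr)
  | div (a b : Expr)
  | mod (a b : Expr)
  | lt (a b : Expr)
  | eq (a b : Expr)

namespace Expr

/-- The number of elementary operations that the evaluation takes. -/
def cost : Expr → ℕ
  | const _ | pid => 1
  | load a | rand a => a.cost + 1
  | add a b | sub a b | mul a b | div a b | mod a b | lt a b | eq a b => a.cost + b.cost + 1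

/-- The value for processor `p`, with word bound `W`, random words `ω` and memory `mem`. -/
def eval (W : ℕ) (ω mem : ℕ → ℕ) (p : ℕ) : Expr → ℕ
  | const k => k % W
  | pid => p
  | load a => mem (a.eval W ω mem p)
  | rand a => ω (a.eval W ω mem p)
  | add a b => (a.eval W ω mem p + b.eval W ω mem p) % W
  | sub a b => a.eval W ω mem p - b.eval W ω mem p
  | mul a b => (a.eval W ω mem p * b.eval W ω mem p) % W
  | div a b => a.eval W ω mem p / b.eval W ω mem p
  | mod a b => a.eval W ω mem p % b.eval W ω mem p
  | lt a b => if a.eval W ω mem p < b.eval W ω mem p then 1 else 0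
  | eq a b => if a.eval W ω mem p = b.eval W ω mem p then 1 else 0

end Expr

/-- Programs. In `par g a v`, all processors at once evaluate `g`, `a` and `v`, and those for which
`g` is not zero write the value of `v` to the cell `a`. The conditions of `cond` and `loop` are
evaluated by processor `0`. -/
inductive Prog where
  | par (g a v : Expr)
  | seq (p q : Prog)
  | cond (b : Expr) (p q : Prog)
  | loop (b : Expr) (p : Prog)

open Classical in
/-- The memory after the step `par g a v`; among the processors that write to the same cell, the
one with the smallest number succeeds. -/
noncomputable def parWrite (W : ℕ) (ω mem : ℕ → ℕ) (g a v : Expr) (c : ℕ) : ℕ :=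
  if h : ∃ p, p < W ∧ g.eval W ω mem p ≠ 0 ∧ a.eval W ω mem p = c then
    v.eval W ω mem (Nat.find h)
  else mem c

/-- `Exec W ω P mem mem' t`: the program `P`, started with memory `mem`, halts with memory `mem'`
after parallel time `t`. -/
inductive Exec (W : ℕ) (ω : ℕ → ℕ) : Prog → (ℕ → ℕ) → (ℕ → ℕ) → ℕ → Prop
  | par (g a v : Expr) (mem : ℕ → ℕ) :
      Exec W ω (.par g a v) mem (parWrite W ω mem g a v) (g.cost + a.cost + v.cost + 1)
  | seq {p q : Prog} {mem mem₁ mem₂ : ℕ → ℕ} {t₁ t₂ : ℕ} :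
      Exec W ω p mem mem₁ t₁ → Exec W ω q mem₁ mem₂ t₂ →
        Exec W ω (.seq p q) mem mem₂ (t₁ + t₂)
  | cond_true {b : Expr} {p q : Prog} {mem mem' : ℕ → ℕ} {t : ℕ} :
      b.eval W ω mem 0 ≠ 0 → Exec W ω p mem mem' t →
        Exec W ω (.cond b p q) mem mem' (b.cost + t + 1)
  | cond_false {b : Expr} {p q : Prog} {mem mem' : ℕ → ℕ} {t : ℕ} :
      b.eval W ω mem 0 = 0 → Exec W ω q mem mem' t →
        Exec W ω (.cond b p q) mem mem' (b.cost + t + 1)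
  | loop_false {b : Expr} {p : Prog} {mem : ℕ → ℕ} :
      b.eval W ω mem 0 = 0 → Exec W ω (.loop b p) mem mem (b.cost + 1)
  | loop_true {b : Expr} {p : Prog} {mem mem₁ mem₂ : ℕ → ℕ} {t₁ t₂ : ℕ} :
      b.eval W ω mem 0 ≠ 0 → Exec W ω p mem mem₁ t₁ → Exec W ω (.loop b p) mem₁ mem₂ t₂ →
        Exec W ω (.loop b p) mem mem₂ (b.cost + t₁ + t₂ + 1)

/-- A table of `W` words, as a function on all addresses. -/
def table {W : ℕ} (ω : Fin W → Fin W) (a : ℕ) : ℕ :=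
  if h : a < W then ω ⟨a, h⟩ else 0

namespace Inst

variable {M N : ℕ} (I : Inst M N) (d : I.Draw)

/-- The initial memory: `N`, `M`, the numbers `K m` and `Kt m`, the adjacency matrix row by row, and
the values of the random draws of the algorithm; all other cells hold zero. -/
noncomputable def input (a : ℕ) : ℕ :=
  ([N, M] ++ List.ofFn I.K ++ List.ofFn I.Kt ++
    ((List.finRange M).flatMap fun m => (List.finRange N).map fun s => (I.adj m s).toNat) ++
    List.ofFn (fun s => (d.order s : ℕ)) ++ [(d.family : ℕ)] ++
    List.ofFn (fun i => (d.inner i : ℕ))).getD a 0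

/-- The final memory holds `F` in cells `0, …, N - 1` (the number of the matched user plus one, or
zero for an unmatched subchannel) and `owner` in cells `N, …, 2 N - 1`. -/
def IsOutput (mem : ℕ → ℕ) (F : Set (Fin M × Fin N)) (owner : Fin N → Fin M) : Prop :=
  ∀ s : Fin N,
    ((∃ m, (m, s) ∈ F ∧ mem s = m + 1) ∨ (FreeRight F s ∧ mem s = 0)) ∧ mem (N + s) = owner s

end Inst

/-- The program `P`, on a machine with `N ^ c` processors, words and random words, carries out the
algorithm with parameter `η` on `N` subchannels: whenever it halts, the output is one that the
algorithm can produce. -/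
def Implements (P : Prog) (c : ℕ) (η : ℝ) : Prop :=
  ∀ (M N : ℕ), 2 ≤ M → ∀ (I : Inst M N) (d : I.Draw) (ω : Fin (N ^ c) → Fin (N ^ c))
    (mem : ℕ → ℕ) (t : ℕ), Exec (N ^ c) (table ω) P (I.input d) mem t →
      ∃ X t' F owner, I.Run d η X t' F owner ∧ Inst.IsOutput mem F owner

/-- On every input, the program `P` halts within time `T N` with probability at least `1 - 1 / N`
over the table of independent uniformly distributed random words. -/
def RunsWithin (P : Prog) (c : ℕ) (T : ℕ → ℝ) : Prop :=
  ∀ (M N : ℕ), 2 ≤ M → ∀ (I : Inst M N) (d : I.Draw),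
    (1 - 1 / (N : ℝ)) * (Nat.card (Fin (N ^ c) → Fin (N ^ c)) : ℝ) ≤
      (Nat.card {ω : Fin (N ^ c) → Fin (N ^ c) //
        ∃ mem t, Exec (N ^ c) (table ω) P (I.input d) mem t ∧ (t : ℝ) ≤ T N} : ℝ)

end PVER2HK

/-! Part (a) is the Hopcroft-Karp analysis. Augmenting along a maximal set of disjoint shortest
paths makes the next free subchannel strictly farther away (`lt_firstHit_augment`). The phase
lengths are therefore strictly increasing naturals below 2 log^η N + 1, and their sum is at most the
square of the last one (`Loop.invariant`). If no augmenting path is shorter than 2L + 1, then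
comparing consecutive search layers through vertex covers shows that each odd layer gains at least
|Y| - |X| vertices of `S`, all of them matched, so L (|Y| - |X|) is at most |X| if |Y| ≥ |X|
(`Stopped.approximation`). `f`-matchings of the graph and matchings of the expanded graph correspond
with equal sizes (`ncard_contract`, `exists_lift`), which transfers the bound.

Part (b) uses the freedom of choice in step 2. From the empty matching the first layer graph
contains every edge, so any maximal matching is an admissible set of paths (`IsMatching.loop`); if
that matching is maximum, the loop then stops at once (`stopped_of_closed`). It suffices to compute
a maximum matching in time O(log² N), by the method of Mulmuley, Vazirani and Vazirani. Random
weights in which edges dominate have a unique heaviest permutation with probability at least 1 - 1/N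
(`isolation`). The leading term of the determinant of 1 + (X^w) over GF(2) reveals this permutation:
deleting an entry kills the leading coefficient exactly if the permutation uses the entry
(`coeff_leadingMinor_entry`). The coefficients are obtained without division, since the determinant
solves a linear system on the states of certain walks (`exists_walk_system`), which repeated
squaring of the step matrix evaluates (`iterated_square_step`).

The selected edges are then tested for conflicts and augmenting paths, and the program idles forever
if the test fails. So every halting run is correct for all random words (`implements_main`), and
isolation is needed only for halting in time (`not_defective`, `runsWithin_main`). Summation inside
squaring nests two loops of O(log N) rounds; hence log² N, and η₀ = 1 suffices. -/

namespace PVER2HK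

/-! ### Augmentation along layer paths and the growth of the phase lengths. -/

section HopcroftKarp

variable {P S : Type} {A : P → S → Prop} {X : Set (P × S)}

theorem reach_mono : Monotone (reach A X) :=
  monotone_nat_of_le_succ fun _ _ h => Or.inl h

theorem reach_step {k : ℕ} {u v : P ⊕ S} (hu : u ∈ reach A X k) (h : Arc A X u v) :
    v ∈ reach A X (k + 1) := Or.inr ⟨u, hu, h⟩

theorem layer_subset_reach : ∀ k, layer A X k ⊆ reach A X k
  | 0 => fun _ h => h
  | _ + 1 => fun _ h => h.1

theorem notMem_reach_of_mem_layer {i j : ℕ} (hij : i < j) {v : P ⊕ S} (h : v ∈ layer A X j) :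
    v ∉ reach A X i := by
  obtain ⟨j, rfl⟩ : ∃ k, j = k + 1 := ⟨j - 1, by omega⟩
  exact fun h' => h.2 (reach_mono (by omega) h')

theorem layer_injective {i j : ℕ} {v : P ⊕ S} (hi : v ∈ layer A X i) (hj : v ∈ layer A X j) :
    i = j := by
  rcases lt_trichotomy i j with h | h | h
  · exact absurd (layer_subset_reach i hi) (notMem_reach_of_mem_layer h hj)
  · exact h
  · exact absurd (layer_subset_reach j hj) (notMem_reach_of_mem_layer h hi)

/-- The predecessor of a vertex that is new in layer k + 1 must be new in layer k, since otherwise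
the vertex would have been reached earlier. -/
theorem exists_path_of_mem_layer : ∀ (k : ℕ) {v : P ⊕ S}, v ∈ layer A X k →
    ∃ p : ℕ → P ⊕ S, p k = v ∧ (∀ i ≤ k, p i ∈ layer A X i) ∧
      ∀ i < k, Arc A X (p i) (p (i + 1))
  | 0, v, h => ⟨fun _ => v, rfl, fun i hi => by obtain rfl := Nat.le_zero.1 hi; exact h,
      fun i hi => absurd hi (Nat.not_lt_zero i)⟩
  | k + 1, v, h => by
    have hk := h
    obtain ⟨h1 | ⟨u, hu, huv⟩, h2⟩ := h
    · exact absurd h1 h2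
    have hul : u ∈ layer A X k := by
      cases k with
      | zero => exact hu
      | succ k => exact ⟨hu, fun h' => h2 (reach_step h' huv)⟩
    obtain ⟨p, rfl, hp1, hp2⟩ := exists_path_of_mem_layer k hul
    refine ⟨fun i => if i ≤ k then p i else v, by simp, fun i hi => ?_, fun i hi => ?_⟩
    · dsimp only
      split_ifs with h
      · exact hp1 i h
      · obtain rfl : i = k + 1 := by omega
        exact hk
    · rcases Nat.lt_succ_iff_lt_or_eq.1 hi with h | rfl
      · simpa [h.le, Nat.succ_le_iff.2 h] using hp2 i h
      · simpa using huv

/-- `u → v` is an arc of one of the paths in `D`. -/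
def PathArc {l : ℕ} (D : Set (Fin (l + 1) → P ⊕ S)) (u v : P ⊕ S) : Prop :=
  ∃ p ∈ D, ∃ i : Fin l, p i.castSucc = u ∧ p i.succ = v

variable {l : ℕ} {D : Set (Fin (l + 1) → P ⊕ S)}

theorem mem_pathEdges {e : P × S} : e ∈ pathEdges D ↔
    PathArc D (.inl e.1) (.inr e.2) ∨ PathArc D (.inr e.2) (.inl e.1) := by
  constructor
  · rintro ⟨p, hp, i, h | h⟩
    exacts [.inl ⟨p, hp, i, h⟩, .inr ⟨p, hp, i, h⟩]
  · rintro (⟨p, hp, i, h⟩ | ⟨p, hp, i, h⟩)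
    exacts [⟨p, hp, i, .inl h⟩, ⟨p, hp, i, .inr h⟩]

namespace IsMaximalDisjointPaths

variable (hD : IsMaximalDisjointPaths A X l D)

include hD

/-- Disjointness identifies the paths, and the layer of the common vertex determines the position on
the path. Hence the arcs of `D` have unique successors and predecessors. -/
theorem index_unique {p q : Fin (l + 1) → P ⊕ S} (hp : p ∈ D) (hq : q ∈ D) {i j : Fin (l + 1)}
    (h : p i = q j) : p = q ∧ i = j := by
  have hpq : p = q := by
    by_contra hne
    exact hD.2.1 p hp q hq hne i j h
  subst hpq
  exact ⟨rfl, Fin.ext (layer_injective ((hD.1 p hp).1 i) (h ▸ (hD.1 p hp).1 j))⟩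

theorem arc {u v : P ⊕ S} (h : PathArc D u v) : Arc A X u v := by
  obtain ⟨p, hp, i, rfl, rfl⟩ := h
  exact (hD.1 p hp).2.1 i

theorem layers {u v : P ⊕ S} (h : PathArc D u v) : ∃ i < l, u ∈ layer A X i ∧
    v ∈ layer A X (i + 1) := by
  obtain ⟨p, hp, i, rfl, rfl⟩ := h
  exact ⟨i, i.2, (hD.1 p hp).1 i.castSucc, (hD.1 p hp).1 i.succ⟩

theorem succ_unique {u v v' : P ⊕ S} (h : PathArc D u v) (h' : PathArc D u v') : v = v' := by
  obtain ⟨p, hp, i, hu, rfl⟩ := h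
  obtain ⟨q, hq, j, hu', rfl⟩ := h'
  obtain ⟨rfl, hij⟩ := hD.index_unique hp hq (hu.trans hu'.symm)
  rw [Fin.castSucc_injective _ hij]

theorem pred_unique {u u' v : P ⊕ S} (h : PathArc D u v) (h' : PathArc D u' v) : u = u' := by
  obtain ⟨p, hp, i, rfl, hv⟩ := h
  obtain ⟨q, hq, j, rfl, hv'⟩ := h'
  obtain ⟨rfl, hij⟩ := hD.index_unique hp hq (hv.trans hv'.symm)
  rw [Fin.succ_injective _ hij]

theorem start_or_pred {p : Fin (l + 1) → P ⊕ S} (hp : p ∈ D) (i : Fin (l + 1)) :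
    (∃ x, FreeLeft X x ∧ p i = .inl x) ∨ ∃ u, PathArc D u (p i) := by
  induction i using Fin.cases with
  | zero => exact Or.inl ((hD.1 p hp).1 0)
  | succ i => exact Or.inr ⟨_, p, hp, i, rfl, rfl⟩

theorem end_or_succ {p : Fin (l + 1) → P ⊕ S} (hp : p ∈ D) (i : Fin (l + 1)) :
    (∃ s, FreeRight X s ∧ p i = .inr s) ∨ ∃ v, PathArc D (p i) v := by
  induction i using Fin.lastCases with
  | last => exact Or.inl (hD.1 p hp).2.2
  | cast i => exact Or.inr ⟨_, p, hp, i, rfl, rfl⟩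

theorem start_or_pred_of_arc {u v : P ⊕ S} (h : PathArc D u v) :
    (∃ x, FreeLeft X x ∧ u = .inl x) ∨ ∃ w, PathArc D w u := by
  obtain ⟨p, hp, i, rfl, rfl⟩ := h
  exact hD.start_or_pred hp _

theorem end_or_succ_of_arc {u v : P ⊕ S} (h : PathArc D u v) :
    (∃ s, FreeRight X s ∧ v = .inr s) ∨ ∃ w, PathArc D v w := by
  obtain ⟨p, hp, i, rfl, rfl⟩ := h
  exact hD.end_or_succ hp _

/-- Path arcs from `P` to `S` are exactly the edges gained, and those from `S` to `P` are exactly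
the edges lost. -/
theorem mem_augment {x : P} {s : S} : (x, s) ∈ symmDiff X (pathEdges D) ↔
    PathArc D (.inl x) (.inr s) ∨ ((x, s) ∈ X ∧ ¬ PathArc D (.inr s) (.inl x)) := by
  rw [Set.mem_symmDiff, mem_pathEdges]
  have h1 : PathArc D (.inl x) (.inr s) → (x, s) ∉ X := fun h => (hD.arc h).2
  have h2 : PathArc D (.inr s) (.inl x) → (x, s) ∈ X := fun h => hD.arc h
  tauto

theorem arc_augment {u v : P ⊕ S} (h : Arc A (symmDiff X (pathEdges D)) u v) :
    Arc A X u v ∨ PathArc D v u := by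
  rcases u with x | s <;> rcases v with x' | s'
  · exact h.elim
  · obtain ⟨h1, h2⟩ := h
    rw [hD.mem_augment] at h2
    by_cases hX : (x, s') ∈ X
    · exact .inr (by tauto)
    · exact .inl ⟨h1, hX⟩
  · have h' : (x', s) ∈ symmDiff X (pathEdges D) := h
    rw [hD.mem_augment] at h'
    exact h'.elim .inr fun h => .inl h.1
  · exact h.elim

/-- A path that gives a vertex a new edge also takes away its old one: an inner vertex is passed
through along its matching edge, and the end vertices were free. -/
theorem isMatching_augment (hX : IsMatching A X) :
    IsMatching A (symmDiff X (pathEdges D)) := by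
  have key1 : ∀ x s s', PathArc D (.inl x) (.inr s) → (x, s') ∈ X →
      PathArc D (.inr s') (.inl x) := by
    intro x s s' h h'
    rcases hD.start_or_pred_of_arc h with ⟨x', hx', hxx⟩ | ⟨w, hw⟩
    · cases hxx
      exact absurd h' (hx' s')
    · rcases w with x' | s''
      · exact (hD.arc hw).elim
      · have h3 : (x, s'') ∈ X := hD.arc hw
        cases hX.2 _ h' _ h3 (Or.inl rfl)
        exact hw
  have key2 : ∀ x x' s, PathArc D (.inl x) (.inr s) → (x', s) ∈ X →
      PathArc D (.inr s) (.inl x') := by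
    intro x x' s h h'
    rcases hD.end_or_succ_of_arc h with ⟨s', hs', hss⟩ | ⟨w, hw⟩
    · cases hss
      exact absurd h' (hs' x')
    · rcases w with x'' | s''
      · have h3 : (x'', s) ∈ X := hD.arc hw
        cases hX.2 _ h' _ h3 (Or.inr rfl)
        exact hw
      · exact (hD.arc hw).elim
  constructor
  · rintro ⟨x, s⟩ h
    rcases hD.mem_augment.1 h with h | h
    · exact (hD.arc h).1
    · exact hX.1 _ h.1
  · rintro ⟨x, s⟩ h ⟨x', s'⟩ h' hor
    rw [hD.mem_augment] at h h'
    rcases hor with hx | hs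
    · obtain rfl : x = x' := hx
      rcases h with h | h <;> rcases h' with h' | h'
      · rw [Sum.inr_injective (hD.succ_unique h h')]
      · exact absurd (key1 _ _ _ h h'.1) h'.2
      · exact absurd (key1 _ _ _ h' h.1) h.2
      · exact hX.2 _ h.1 _ h'.1 (.inl rfl)
    · obtain rfl : s = s' := hs
      rcases h with h | h <;> rcases h' with h' | h'
      · rw [Sum.inl_injective (hD.pred_unique h h')]
      · exact absurd (key2 _ _ _ h h'.1) h'.2
      · exact absurd (key2 _ _ _ h' h.1) h.2
      · exact hX.2 _ h.1 _ h'.1 (.inr rfl)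

/-- A path that removes the edge at `x` ends in `S`, so it leaves `x` again along a new edge.
Saturated vertices stay saturated. -/
theorem freeLeft_of_augment {x : P} (h : FreeLeft (symmDiff X (pathEdges D)) x) :
    FreeLeft X x := by
  intro s hs
  by_cases hb : PathArc D (.inr s) (.inl x)
  · rcases hD.end_or_succ_of_arc hb with ⟨s', _, hss⟩ | ⟨w, hw⟩
    · cases hss
    · rcases w with x' | s'
      · exact (hD.arc hw).elim
      · exact h s' (hD.mem_augment.2 (.inl hw))
  · exact h s (hD.mem_augment.2 (.inr ⟨hs, hb⟩))

theorem freeRight_of_augment {s : S} (h : FreeRight (symmDiff X (pathEdges D)) s) :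
    FreeRight X s := by
  intro x hs
  by_cases hb : PathArc D (.inr s) (.inl x)
  · rcases hD.start_or_pred_of_arc hb with ⟨s', _, hss⟩ | ⟨w, hw⟩
    · cases hss
    · rcases w with x' | s'
      · exact h x' (hD.mem_augment.2 (.inl hw))
      · exact (hD.arc hw).elim
  · exact h x (hD.mem_augment.2 (.inr ⟨hs, hb⟩))

/-- The arcs created by augmentation are reversed path arcs and lead one layer back, so no arc of
the new digraph advances by more than one old layer. -/
theorem reach_step_augment {k : ℕ} {u v : P ⊕ S} (hu : u ∈ reach A X k)
    (h : Arc A (symmDiff X (pathEdges D)) u v) : v ∈ reach A X (k + 1) := by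
  rcases hD.arc_augment h with h | h
  · exact reach_step hu h
  · obtain ⟨i, _, hv, hu'⟩ := hD.layers h
    have : i ≤ k := by
      by_contra hlt
      exact notMem_reach_of_mem_layer (by omega) hu' hu
    exact reach_mono (by omega) (layer_subset_reach i hv)

theorem reach_augment_subset : ∀ k, reach A (symmDiff X (pathEdges D)) k ⊆ reach A X k
  | 0 => by
    rintro v ⟨x, hx, rfl⟩
    exact ⟨x, hD.freeLeft_of_augment hx, rfl⟩
  | k + 1 => by
    rintro v (h | ⟨u, hu, huv⟩)
    · exact Or.inl (reach_augment_subset k h)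
    · exact hD.reach_step_augment (reach_augment_subset k hu) huv

/-- The length of the shortest augmenting paths increases in each phase. -/
theorem lt_firstHit_augment (hX : IsMatching A X) (hl : FirstHit A X l) {l' : ℕ}
    (hl' : FirstHit A (symmDiff X (pathEdges D)) l') : l < l' := by
  have hX' := hD.isMatching_augment hX
  obtain ⟨⟨s, hs, hsr⟩, hmin⟩ := hl'
  have hsX := hD.freeRight_of_augment hs
  by_contra hlt
  have hle : l ≤ l' := by
    by_contra h
    exact hl.2 l' (by omega) s hsX (hD.reach_augment_subset _ hsr)
  -- Distances do not shrink, so only equality remains to be excluded. A shortest path `p` of the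
  -- new digraph will turn out to be a path of the old layer graph.
  obtain rfl : l = l' := by omega
  have hlay : .inr s ∈ layer A (symmDiff X (pathEdges D)) l := by
    cases l with
    | zero => exact hsr
    | succ l => exact ⟨hsr, hmin l (by omega) s hs⟩
  obtain ⟨p, hpl, hp1, hp2⟩ := exists_path_of_mem_layer l hlay
  have hstep : ∀ i k, i + k ≤ l → ∀ j, p i ∈ reach A X j → p (i + k) ∈ reach A X (j + k) := by
    intro i k
    induction k with
    | zero => intro _ j h; exact h
    | succ k ih =>
      intro hik j h
      exact hD.reach_step_augment (ih (by omega) j h) (hp2 _ (by omega))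
  -- If `p i` were in an earlier old layer, the rest of `p` would lead to the free vertex `s` in
  -- fewer than `l` old steps.
  have hp3 : ∀ i ≤ l, p i ∈ layer A X i := by
    intro i hi
    have h0 : p i ∈ reach A X i := hD.reach_augment_subset _ (layer_subset_reach _ (hp1 i hi))
    cases i with
    | zero => exact h0
    | succ i =>
      refine ⟨h0, fun h => hl.2 (l - 1) (by omega) s hsX ?_⟩
      have := hstep (i + 1) (l - (i + 1)) (by omega) i h
      rw [show i + 1 + (l - (i + 1)) = l by omega, hpl] at this
      exact reach_mono (by omega) this
  have hp4 : ∀ i < l, Arc A X (p i) (p (i + 1)) := by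
    intro i hi
    rcases hD.arc_augment (hp2 i hi) with h | h
    · exact h
    · obtain ⟨j, _, h1, h2⟩ := hD.layers h
      have e1 := layer_injective h1 (hp3 (i + 1) hi)
      have e2 := layer_injective h2 (hp3 i hi.le)
      omega
  have hpath : IsLayerPath A X l fun i => p i :=
    ⟨fun i => hp3 i (by omega), fun i => hp4 i i.2, s, hsX, hpl⟩
  -- By maximality `p` meets a path `q` of `D`. At the common vertex the new matching edge is an
  -- edge of `q`. Traversing it as a matching edge, as `p` would have to, contradicts the layers; at
  -- the ends of `p` it contradicts freeness.
  obtain ⟨q, hq, i, j, hij⟩ := hD.2.2 _ hpath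
  have hi := i.2
  have hv : p i ∈ layer A X i := hp3 i (by omega)
  rcases hpv : p i with x | t
  · rw [hpv] at hij hv
    have hout : ∃ s', PathArc D (.inl x) (.inr s') := by
      rcases hD.end_or_succ hq j with ⟨s', _, h⟩ | ⟨w, hw⟩
      · rw [← hij] at h; cases h
      · rw [← hij] at hw
        rcases w with x' | s'
        · exact (hD.arc hw).elim
        · exact ⟨s', hw⟩
    obtain ⟨s', hs'⟩ := hout
    have hxs : (x, s') ∈ symmDiff X (pathEdges D) := hD.mem_augment.2 (.inl hs')
    rcases Nat.eq_zero_or_pos (i : ℕ) with h0 | h0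
    · have := hp1 i (by omega)
      rw [hpv, h0] at this
      obtain ⟨x', hx', he⟩ := this
      cases he
      exact hx' s' hxs
    · have harc := hp2 (i - 1) (by omega)
      rw [show (i : ℕ) - 1 + 1 = i by omega, hpv] at harc
      have hlay := hp3 (i - 1) (by omega)
      rcases hw : p (i - 1) with x' | t
      · rw [hw] at harc; exact harc.elim
      · rw [hw] at harc hlay
        cases hX'.2 _ hxs _ harc (.inl rfl)
        obtain ⟨k, _, h1, h2⟩ := hD.layers hs'
        have e1 := layer_injective h1 hv
        have e2 := layer_injective h2 hlay
        omega
  · rw [hpv] at hij hv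
    have hin : ∃ x', PathArc D (.inl x') (.inr t) := by
      rcases hD.start_or_pred hq j with ⟨s', _, h⟩ | ⟨w, hw⟩
      · rw [← hij] at h; cases h
      · rw [← hij] at hw
        rcases w with x' | s'
        · exact ⟨x', hw⟩
        · exact (hD.arc hw).elim
    obtain ⟨x', hx'⟩ := hin
    have hxs : (x', t) ∈ symmDiff X (pathEdges D) := hD.mem_augment.2 (.inl hx')
    rcases Nat.lt_or_ge (i : ℕ) l with h0 | h0
    · have harc := hp2 i h0
      rw [hpv] at harc
      have hlay := hp3 (i + 1) (by omega)
      rcases hw : p (i + 1) with x'' | t'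
      · rw [hw] at harc hlay
        cases hX'.2 _ hxs _ harc (.inr rfl)
        obtain ⟨k, _, h1, h2⟩ := hD.layers hx'
        have e1 := layer_injective h1 hlay
        have e2 := layer_injective h2 hv
        omega
      · rw [hw] at harc; exact harc.elim
    · have hil : (i : ℕ) = l := by omega
      rw [hil, hpl] at hpv
      cases hpv
      exact hs x' hxs

end IsMaximalDisjointPaths

/-- The invariant of the loop: the next phase is longer than the previous ones, and their total
length is at most the square of the last one. -/
theorem Loop.invariant {lmax : ℝ} {t : ℕ} (h : Loop A lmax X t) : IsMatching A X ∧
    ∃ b : ℕ, t ≤ b ^ 2 ∧ (b = 0 ∨ (b : ℝ) < lmax) ∧ ∀ l, FirstHit A X l → b < l := by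
  induction h with
  | start =>
    refine ⟨⟨by simp, by simp⟩, 0, by simp, .inl rfl, fun l hl => Nat.pos_of_ne_zero ?_⟩
    rintro rfl
    obtain ⟨⟨s, _, x, _, h⟩, _⟩ := hl
    cases h
  | @phase X X' t l _ hph ih =>
    obtain ⟨hX, b, hb, -, hbl⟩ := ih
    obtain ⟨hl, hlm, D, hD, rfl⟩ := hph
    refine ⟨hD.isMatching_augment hX, l, ?_, .inr hlm, fun l' hl' =>
      hD.lt_firstHit_augment hX hl hl'⟩
    -- From b + 1 ≤ l it follows that b² + l ≤ (l - 1)² + l ≤ l².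
    have := hbl l hl
    nlinarith

end HopcroftKarp

end PVER2HK

namespace PVER2HK

/-! ### Quality of a matching without short augmenting paths. -/

section Approximation

variable {P S : Type} {A : P → S → Prop} {X Y : Set (P × S)}

theorem Stopped.notMem_reach {lmax : ℝ} (h : Stopped A lmax X) {j : ℕ} (hj : (j : ℝ) < lmax)
    {s : S} (hs : FreeRight X s) : .inr s ∉ reach A X j := by
  classical
  intro hr
  have hex : ∃ j, ∃ s, FreeRight X s ∧ .inr s ∈ reach A X j := ⟨j, s, hs, hr⟩
  have h1 := h (Nat.find hex) ⟨Nat.find_spec hex, fun i hi t ht hti =>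
    Nat.find_min hex hi ⟨t, ht, hti⟩⟩
  have h2 : Nat.find hex ≤ j := Nat.find_min' hex ⟨s, hs, hr⟩
  have : (Nat.find hex : ℝ) ≤ j := by exact_mod_cast h2
  linarith

theorem inl_mem_reach : ∀ {j : ℕ} {x : P}, Sum.inl x ∈ reach A X j →
    FreeLeft X x ∨ ∃ s i, j = i + 1 ∧ (x, s) ∈ X ∧ .inr s ∈ reach A X i
  | 0, x, ⟨y, hy, h⟩ => by cases h; exact .inl hy
  | j + 1, x, .inl h => by
    rcases inl_mem_reach h with h | ⟨s, i, rfl, hs, hr⟩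
    · exact .inl h
    · exact .inr ⟨s, i + 1, rfl, hs, reach_mono (by omega) hr⟩
  | j + 1, x, .inr ⟨.inl y, _, h⟩ => h.elim
  | j + 1, x, .inr ⟨.inr s, hs, h⟩ => .inr ⟨s, j, rfl, h, hs⟩

variable [Finite P] [Finite S]

omit [Finite S] in
theorem IsMatching.ncard_add_free (hX : IsMatching A X) :
    X.ncard + {x | Sum.inl x ∈ reach A X (2 * 0)}.ncard = Nat.card P := by
  have h1 : X.ncard = (Prod.fst '' X).ncard :=
    (Set.InjOn.ncard_image fun e he e' he' h => hX.2 e he e' he' (.inl h)).symm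
  have h2 : {x | Sum.inl x ∈ reach A X (2 * 0)} = (Prod.fst '' X)ᶜ := by
    ext x
    constructor
    · rintro ⟨y, hy, h⟩
      cases h
      rintro ⟨⟨y, s⟩, hs, rfl⟩
      exact hy s hs
    · intro h
      exact ⟨x, fun s hs => h ⟨_, hs, rfl⟩, rfl⟩
  rw [h1, h2, Set.ncard_add_ncard_compl]

/-- Vertices of `S` reached within 2i + 1 steps and vertices of `P` not reached within 2i steps
together cover every edge of the graph: a reached `x` passes on to its neighbours, and its own
partner was reached before it. A matching is no larger than a vertex cover. -/
theorem IsMatching.ncard_le_layers (hX : IsMatching A X) (hY : IsMatching A Y) (i : ℕ) :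
    Y.ncard ≤ {s | Sum.inr s ∈ reach A X (2 * i + 1)}.ncard +
      {x | Sum.inl x ∈ reach A X (2 * i)}ᶜ.ncard := by
  have hsub : Y ⊆ {e ∈ Y | Sum.inr e.2 ∈ reach A X (2 * i + 1)} ∪
      {e ∈ Y | Sum.inl e.1 ∉ reach A X (2 * i)} := by
    rintro ⟨x, s⟩ he
    by_cases hx : Sum.inl x ∈ reach A X (2 * i)
    · refine .inl ⟨he, ?_⟩
      by_cases hs : (x, s) ∈ X
      · rcases inl_mem_reach hx with hf | ⟨s', j, hj, hs', hr⟩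
        · exact absurd hs (hf s)
        · cases hX.2 _ hs _ hs' (.inl rfl)
          exact reach_mono (by omega) hr
      · exact reach_step hx ⟨hY.1 _ he, hs⟩
    · exact .inr ⟨he, hx⟩
  refine (Set.ncard_le_ncard hsub).trans ((Set.ncard_union_le _ _).trans (add_le_add ?_ ?_))
  · exact Set.ncard_le_ncard_of_injOn Prod.snd (fun e he => he.2)
      fun e he e' he' h => hY.2 e he.1 e' he'.1 (.inr h)
  · exact Set.ncard_le_ncard_of_injOn Prod.fst (fun e he => he.2)
      fun e he e' he' h => hY.2 e he.1 e' he'.1 (.inl h)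

theorem ncard_layer_le {i : ℕ}
    (hr : ∀ s, FreeRight X s → .inr s ∉ reach A X (2 * i + 1)) :
    {s | Sum.inr s ∈ reach A X (2 * i + 1)}.ncard ≤ X.ncard := by
  have hsub : {s | Sum.inr s ∈ reach A X (2 * i + 1)} ⊆ Prod.snd '' X := by
    intro s hs
    by_contra hn
    exact hr s (fun x hx => hn ⟨_, hx, rfl⟩) hs
  exact (Set.ncard_le_ncard hsub).trans (Set.ncard_image_le X.toFinite)

omit [Finite S] in
-- Every reached vertex of `S` is matched. The partners are distinct, are reached one step later,
-- and are disjoint from the free vertices of `P`.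
theorem IsMatching.ncard_layer_add (hX : IsMatching A X) {i : ℕ}
    (hr : ∀ s, FreeRight X s → .inr s ∉ reach A X (2 * i + 1)) :
    {x | Sum.inl x ∈ reach A X (2 * 0)}.ncard + {s | Sum.inr s ∈ reach A X (2 * i + 1)}.ncard ≤
      {x | Sum.inl x ∈ reach A X (2 * (i + 1))}.ncard := by
  have hdisj : Disjoint {x | Sum.inl x ∈ reach A X (2 * 0)}
      {x | ∃ s, (x, s) ∈ X ∧ Sum.inr s ∈ reach A X (2 * i + 1)} := by
    rw [Set.disjoint_left]
    rintro x ⟨y, hy, h⟩ ⟨s, hs, _⟩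
    cases h
    exact hy s hs
  have hle : {s | Sum.inr s ∈ reach A X (2 * i + 1)}.ncard ≤
      {x | ∃ s, (x, s) ∈ X ∧ Sum.inr s ∈ reach A X (2 * i + 1)}.ncard := by
    have hmate : ∀ s : {s | Sum.inr s ∈ reach A X (2 * i + 1)}, ∃ x, (x, (s : S)) ∈ X := by
      rintro ⟨s, hs⟩
      by_contra hn
      exact hr s (fun x hx => hn ⟨x, hx⟩) hs
    choose f hf using hmate
    rw [← Nat.card_coe_set_eq, ← Nat.card_coe_set_eq]
    refine Nat.card_le_card_of_injective
      (fun s => (⟨f s, s, hf s, s.2⟩ : {x | ∃ s, (x, s) ∈ X ∧ Sum.inr s ∈ reach A X (2 * i + 1)}))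
      fun s s' h => Subtype.ext ?_
    have h1 := hf s
    have h2 := hf s'
    rw [show f s = f s' from congrArg Subtype.val h] at h1
    exact congrArg Prod.snd (hX.2 _ h1 _ h2 (.inl rfl))
  refine (Nat.add_le_add_left hle _).trans ?_
  rw [← Set.ncard_union_eq hdisj]
  refine Set.ncard_le_ncard ?_
  rintro x (hx | ⟨s, hs, hsr⟩)
  · exact reach_mono (by omega) hx
  · exact reach_step (k := 2 * i + 1) hsr hs

/-- If there are no augmenting paths of length less than `2 * L + 1`, then the matching is
optimal up to the factor `1 - 1 / L`. -/
theorem Stopped.approximation {L : ℝ} (hL : 0 < L) (hX : IsMatching A X) (hY : IsMatching A Y)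
    (h : Stopped A (2 * L + 1) X) : (1 - L⁻¹) * (Y.ncard : ℝ) ≤ X.ncard := by
  have hfree : ∀ i : ℕ, (i : ℝ) < L → ∀ s, FreeRight X s → .inr s ∉ reach A X (2 * i + 1) :=
    fun i hi s hs => h.notMem_reach (by push_cast; linarith) hs
  have hcompl : ∀ i, {x | Sum.inl x ∈ reach A X (2 * i)}.ncard +
      {x | Sum.inl x ∈ reach A X (2 * i)}ᶜ.ncard = Nat.card P :=
    fun i => Set.ncard_add_ncard_compl _
  have h0 := hX.ncard_add_free
  -- With R_i and L_i the reached parts of `S` and `P` at steps 2i + 1 and 2i, the cover bound gives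
  -- |R_i| ≥ |Y| - |P| + |L_i|. Together with |L_{i+1}| ≥ |P| - |X| + |R_i|, each round adds |Y| -
  -- |X|.
  have key : ∀ i : ℕ, (i : ℝ) < L →
      ((i : ℤ) + 1) * ((Y.ncard : ℤ) - X.ncard) ≤
        ({s | Sum.inr s ∈ reach A X (2 * i + 1)}.ncard : ℤ) := by
    intro i
    induction i with
    | zero =>
      intro _
      have h1 := hX.ncard_le_layers hY 0
      have h2 := hcompl 0
      rw [Nat.cast_zero, zero_add, one_mul]
      omega
    | succ i ih =>
      intro hi
      push_cast at hi ⊢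
      have h1 := hX.ncard_le_layers hY (i + 1)
      have h2 := hcompl (i + 1)
      have h3 := ih (by linarith)
      have h4 := hX.ncard_layer_add (hfree i (by linarith))
      have h5 : (Y.ncard : ℤ) - X.ncard + {s | Sum.inr s ∈ reach A X (2 * i + 1)}.ncard ≤
        {s | Sum.inr s ∈ reach A X (2 * (i + 1) + 1)}.ncard := by omega
      linarith
  -- The index k - 1 is the last one below `L`, and it yields k ≥ L rounds.
  set k := ⌈L⌉₊ with hk
  have hk0 : 0 < k := Nat.ceil_pos.2 hL
  have hkL : L ≤ k := Nat.le_ceil L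
  have hk1 : ((k - 1 : ℕ) : ℝ) < L := by
    have := Nat.ceil_lt_add_one hL.le
    rw [Nat.cast_sub hk0]
    push_cast
    linarith
  have h1 := key (k - 1) hk1
  have h2 := ncard_layer_le (hfree (k - 1) hk1)
  have h3 : (k : ℤ) * ((Y.ncard : ℤ) - X.ncard) ≤ X.ncard := by
    have e : ((k - 1 : ℕ) : ℤ) + 1 = k := by omega
    rw [e] at h1
    omega
  have h4 : (k : ℝ) * ((Y.ncard : ℝ) - X.ncard) ≤ X.ncard := by exact_mod_cast h3
  rcases le_total (Y.ncard : ℝ) X.ncard with hle | hle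
  · have : 0 ≤ L⁻¹ * (Y.ncard : ℝ) := by positivity
    nlinarith
  · have h5 : L * ((Y.ncard : ℝ) - X.ncard) ≤ Y.ncard := by nlinarith
    have h6 : (Y.ncard : ℝ) - X.ncard ≤ L⁻¹ * Y.ncard := by
      rw [inv_mul_eq_div, le_div_iff₀ hL]
      linarith
    linarith

end Approximation

/-! ### Copies of the users, and part (a) for the algorithm. -/

namespace Inst

variable {M N : ℕ} (I : Inst M N)

include I in
theorem le_size : M ≤ N := by
  calc M = ∑ _m : Fin M, 1 := by simp
    _ ≤ ∑ m, I.Kt m := Finset.sum_le_sum fun m _ => (I.one_le m).trans (I.le_Kt m)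
    _ = N := I.sum_Kt

theorem Kt_le (m : Fin M) : I.Kt m ≤ N := by
  exact (Finset.single_le_sum (fun _ _ => Nat.zero_le _) (Finset.mem_univ m)).trans_eq I.sum_Kt

theorem K_le (m : Fin M) : I.K m ≤ N := (I.le_Kt m).trans (I.Kt_le m)

theorem Kmin_pos (hM : 0 < M) : 0 < I.Kmin := by
  have : Nonempty (Fin M) := ⟨⟨0, hM⟩⟩
  exact le_ciInf (f := I.K) I.one_le

theorem Kmin_le (m : Fin M) : I.Kmin ≤ I.K m := ciInf_le (OrderBot.bddBelow _) m

theorem mem_copies (v : I.Copy) : v ∈ I.copies := by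
  obtain ⟨m, j⟩ := v
  simp [copies]

theorem nodup_copies : I.copies.Nodup := by
  rw [copies, List.nodup_flatMap]
  refine ⟨fun m _ => (List.nodup_finRange _).map fun a b h => by simpa using h, ?_⟩
  refine (List.nodup_finRange M).imp ?_
  intro a b hab v hv hv'
  simp only [List.mem_map, List.mem_finRange, true_and] at hv hv'
  obtain ⟨i, rfl⟩ := hv
  obtain ⟨j, hj⟩ := hv'
  exact hab (congrArg Sigma.fst hj).symm

variable (d : I.Draw)

theorem mem_rotated (v : I.Copy) : v ∈ I.rotated d := by
  have hpos : 0 < I.Kmin := I.Kmin_pos (Nat.zero_lt_of_lt v.1.2)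
  refine List.mem_flatMap.2 ⟨⟨(v.2 : ℕ) % I.Kmin, Nat.mod_lt _ hpos⟩, ?_, ?_⟩
  · simp
  · rw [List.mem_rotate]
    simp [group, I.mem_copies]

theorem nodup_rotated : (I.rotated d).Nodup := by
  rw [rotated, List.nodup_flatMap]
  refine ⟨fun i _ => List.nodup_rotate.2 (I.nodup_copies.filter _), ?_⟩
  refine (List.nodup_rotate.2 (List.nodup_finRange _)).imp ?_
  intro a b hab v hv hv'
  rw [List.mem_rotate] at hv hv'
  simp only [group, List.mem_filter, decide_eq_true_eq] at hv hv'
  exact hab (Fin.ext (hv.2.symm.trans hv'.2))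

/-- The positions of the rotated order correspond to the copies. -/
noncomputable def position : Fin (I.rotated d).length ≃ I.Copy := by
  classical
  exact (I.nodup_rotated d).getEquivOfForallMemList _ (I.mem_rotated d)

theorem user_eq (x : Fin (I.rotated d).length) : I.user d x = (I.position d x).1 := rfl

variable {I d}

theorem ncard_contract {X : Set (Fin (I.rotated d).length × Fin N)}
    (hX : IsMatching (I.ExpandedAdj d) X) : (I.contract d X).ncard = X.ncard :=
  Set.InjOn.ncard_image fun e he e' he' h => hX.2 e he e' he' (.inr (Prod.mk.inj h).2)

theorem mem_contract {X : Set (Fin (I.rotated d).length × Fin N)} {m : Fin M} {s : Fin N} :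
    (m, s) ∈ I.contract d X ↔ ∃ x, (x, s) ∈ X ∧ I.user d x = m := by
  constructor
  · rintro ⟨⟨x, s⟩, h, he⟩
    cases he
    exact ⟨x, h, rfl⟩
  · rintro ⟨x, h, rfl⟩
    exact ⟨_, h, rfl⟩

/-- Different subchannels of one user are matched to different copies, of which there are `K m`. -/
theorem isFMatching_contract {X : Set (Fin (I.rotated d).length × Fin N)}
    (hX : IsMatching (I.ExpandedAdj d) X) : IsFMatching I.Adj I.K (I.contract d X) := by
  refine ⟨?_, fun m => ?_, fun s => ?_⟩
  · rintro _ ⟨e, he, rfl⟩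
    exact hX.1 e he
  · have hex : ∀ s, ∃ j : Fin (I.K m), (m, s) ∈ I.contract d X →
        ((I.position d).symm ⟨m, j⟩, s) ∈ X := by
      intro s
      by_cases h : (m, s) ∈ I.contract d X
      · obtain ⟨x, hx, hm⟩ := mem_contract.1 h
        rw [user_eq] at hm
        subst hm
        exact ⟨(I.position d x).2, fun _ => by simpa using hx⟩
      · exact ⟨⟨0, I.one_le m⟩, fun h' => absurd h' h⟩
    choose f hf using hex
    have h1 := Set.ncard_le_ncard_of_injOn (s := {s | (m, s) ∈ I.contract d X}) (t := Set.univ)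
      f (fun _ _ => Set.mem_univ _) (by
        intro s hs s' hs' h
        have h1 := hf s hs
        have h2 := hf s' hs'
        rw [h] at h1
        exact congrArg Prod.snd (hX.2 _ h1 _ h2 (.inl rfl)))
    simpa [Set.ncard_univ] using h1
  · rw [Set.ncard_le_one]
    intro m hm m' hm'
    obtain ⟨x, hx, rfl⟩ := mem_contract.1 hm
    obtain ⟨x', hx', rfl⟩ := mem_contract.1 hm'
    cases hX.2 _ hx _ hx' (.inr rfl)
    rfl

/-- The at most `K m` edges at a user can be spread injectively over its copies. So a maximum
`f`-matching is no larger than some matching of the expanded graph, to which the layer bound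
applies. -/
theorem exists_lift {Y : Set (Fin M × Fin N)} (hY : IsFMatching I.Adj I.K Y) :
    ∃ X, IsMatching (I.ExpandedAdj d) X ∧ I.contract d X = Y := by
  have hemb : ∀ m, ∃ f : Fin N → Fin (I.K m), Set.InjOn f {s | (m, s) ∈ Y} := by
    intro m
    have : Nonempty (Fin (I.K m)) := ⟨⟨0, I.one_le m⟩⟩
    have hle : {s | (m, s) ∈ Y}.encard ≤ (Set.univ : Set (Fin (I.K m))).encard := by
      rw [← Set.Finite.cast_ncard_eq (Set.toFinite _), ← Set.Finite.cast_ncard_eq (Set.toFinite _)]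
      have h := hY.2.1 m
      simpa only [Set.ncard_univ, Nat.card_eq_fintype_card, Fintype.card_fin, Nat.cast_le] using h
    obtain ⟨f, -, hf⟩ := (Set.toFinite {s | (m, s) ∈ Y}).exists_injOn_of_encard_le hle
    exact ⟨f, hf⟩
  choose f hf using hemb
  refine ⟨{e | ((I.position d e.1).1, e.2) ∈ Y ∧
    f (I.position d e.1).1 e.2 = (I.position d e.1).2}, ⟨?_, ?_⟩, ?_⟩
  · rintro ⟨x, s⟩ ⟨h, _⟩
    exact hY.1 _ h
  · rintro ⟨x, s⟩ ⟨h, hx⟩ ⟨x', s'⟩ ⟨h', hx'⟩ (hor | hor)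
    · obtain rfl : x = x' := hor
      have := hf _ h h' (hx.trans hx'.symm)
      simpa using this
    · obtain rfl : s = s' := hor
      have hu := (Set.ncard_le_one (Set.toFinite _)).1 (hY.2.2 s) _ h _ h'
      suffices I.position d x = I.position d x' by
        rw [(I.position d).injective this]
      dsimp only at hx hx' hu
      generalize I.position d x = v at *
      generalize I.position d x' = w at *
      obtain ⟨m, j⟩ := v
      obtain ⟨m', j'⟩ := w
      obtain rfl : m = m' := hu
      dsimp only at hx hx'
      rw [← hx, ← hx']
  · ext ⟨m, s⟩
    rw [mem_contract]
    constructor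
    · rintro ⟨x, ⟨h, _⟩, rfl⟩
      exact h
    · intro h
      exact ⟨(I.position d).symm ⟨m, f m s⟩, by
        rw [Set.mem_ofPred_eq, Equiv.apply_symm_apply]
        exact ⟨h, rfl⟩, by simp [user_eq]⟩

/-- The matching and the `f`-matching of the algorithm are approximately optimal. -/
theorem Run.approximates (hM : 2 ≤ M) {η : ℝ} {X : Set (Fin (I.rotated d).length × Fin N)} {t : ℕ}
    {F : Set (Fin M × Fin N)} {owner : Fin N → Fin M} (h : I.Run d η X t F owner) :
    Approximates (IsMatching (I.ExpandedAdj d)) (Real.log N ^ (-η)) X ∧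
      Approximates (IsFMatching I.Adj I.K) (Real.log N ^ (-η)) F := by
  obtain ⟨hloop, hst, rfl, -⟩ := h
  have hN : (1 : ℝ) < N := by exact_mod_cast (show 1 < N from hM.trans I.le_size)
  have hlog := Real.log_pos hN
  have hX := hloop.invariant.1
  rw [Real.rpow_neg hlog.le]
  refine ⟨⟨hX, fun Y hY => hst.approximation (Real.rpow_pos_of_pos hlog η) hX hY.1⟩,
    isFMatching_contract hX, fun Y hY => ?_⟩
  obtain ⟨Y', hY', rfl⟩ := exists_lift (d := d) hY.1
  rw [ncard_contract hY', ncard_contract hX]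
  exact hst.approximation (Real.rpow_pos_of_pos hlog η) hX hY'

/-- The total number of layers is at most quadratic in the bound on the length of a phase. -/
theorem Run.layers_le (hM : 2 ≤ M) {η : ℝ} (hη : 0 ≤ η)
    {X : Set (Fin (I.rotated d).length × Fin N)} {t : ℕ}
    {F : Set (Fin M × Fin N)} {owner : Fin N → Fin M} (h : I.Run d η X t F owner) :
    (t : ℝ) ≤ (2 + (Real.log 2 ^ η)⁻¹) ^ 2 * Real.log N ^ (2 * η) := by
  obtain ⟨-, b, hb, hlt, -⟩ := h.1.invariant
  have hN : (2 : ℝ) ≤ N := by exact_mod_cast hM.trans I.le_size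
  have hlog2 : 0 < Real.log 2 := Real.log_pos (by norm_num)
  have hle : Real.log 2 ≤ Real.log N := Real.log_le_log (by norm_num) hN
  have hlog := hlog2.trans_le hle
  have hL2 := Real.rpow_pos_of_pos hlog2 η
  have hL : Real.log 2 ^ η ≤ Real.log N ^ η := Real.rpow_le_rpow hlog2.le hle hη
  have e : Real.log N ^ (2 * η) = (Real.log N ^ η) ^ 2 := by
    rw [mul_comm, Real.rpow_mul hlog.le]
    norm_cast
  rw [e, ← mul_pow]
  have hb' : (b : ℝ) ≤ (2 + (Real.log 2 ^ η)⁻¹) * Real.log N ^ η := by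
    -- Since N ≥ 2, the summand 1 in the bound on `l` is absorbed at the cost of the constant (log
    -- 2)^(-η).
    have h1 : 1 ≤ (Real.log 2 ^ η)⁻¹ * Real.log N ^ η := by
      rw [inv_mul_eq_div, le_div_iff₀ hL2, one_mul]
      exact hL
    rcases hlt with rfl | hlt
    · push_cast
      have := Real.rpow_pos_of_pos hlog η
      positivity
    · linarith
  calc (t : ℝ) ≤ (b : ℝ) ^ 2 := by exact_mod_cast hb
    _ ≤ _ := by gcongr

end Inst

/-! ### A maximum matching as the result of a single phase. -/

section OnePhase

variable {P S : Type} {A : P → S → Prop} {X : Set (P × S)}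

/-- A maximal matching can be found in the first phase. -/
theorem IsMatching.loop {lmax : ℝ} (hl : 1 < lmax) (hX : IsMatching A X)
    (hmax : ∀ x s, FreeLeft X x → FreeRight X s → ¬ A x s) : ∃ t, Loop A lmax X t := by
  rcases X.eq_empty_or_nonempty with rfl | ⟨e₀, he₀⟩
  · exact ⟨0, .start⟩
  have hfl : ∀ x, FreeLeft (∅ : Set (P × S)) x := fun x s h => h
  have hfr : ∀ s, FreeRight (∅ : Set (P × S)) s := fun x s h => h
  have hr0 : ∀ x, Sum.inl x ∈ reach A (∅ : Set (P × S)) 0 := fun x => ⟨x, hfl x, rfl⟩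
  have hr0' : ∀ s, Sum.inr s ∉ reach A (∅ : Set (P × S)) 0 := by
    rintro s ⟨x, _, h⟩
    cases h
  have hl1 : ∀ x s, A x s → Sum.inr s ∈ layer A (∅ : Set (P × S)) 1 := fun x s h =>
    ⟨reach_step (hr0 x) ⟨h, id⟩, hr0' s⟩
  have hpath : ∀ p : Fin 2 → P ⊕ S, IsLayerPath A ∅ 1 p →
      ∃ x s, A x s ∧ p 0 = .inl x ∧ p 1 = .inr s := by
    rintro p ⟨h1, h2, s, -, hs⟩
    obtain ⟨x, -, hx⟩ := h1 0
    have harc := h2 0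
    change Arc A ∅ (p 0) (p 1) at harc
    change p 1 = _ at hs
    rw [hx, hs] at harc
    exact ⟨x, s, harc.1, hx, hs⟩
  -- Each edge of `X` is a path of length 1 from the empty matching; maximality of `X` as a matching
  -- is maximality of this set of paths.
  let D : Set (Fin 2 → P ⊕ S) := {p | ∃ e ∈ X, p = ![.inl e.1, .inr e.2]}
  refine ⟨0 + 1, .phase .start ⟨⟨⟨e₀.2, hfr _, (hl1 _ _ (hX.1 _ he₀)).1⟩, fun j hj s _ => ?_⟩,
    by exact_mod_cast hl, D, ⟨?_, ?_, ?_⟩, ?_⟩⟩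
  · obtain rfl : j = 0 := by omega
    exact hr0' s
  · rintro p ⟨e, he, rfl⟩
    refine ⟨fun i => ?_, fun i => ?_, e.2, hfr _, rfl⟩
    · fin_cases i
      · exact hr0 e.1
      · exact hl1 _ _ (hX.1 _ he)
    · fin_cases i
      exact ⟨hX.1 _ he, id⟩
  · rintro p ⟨e, he, rfl⟩ q ⟨e', he', rfl⟩ hne i j
    intro h
    fin_cases i <;> fin_cases j <;> simp at h
    · exact hne (by rw [hX.2 _ he _ he' (.inl h)])
    · exact hne (by rw [hX.2 _ he _ he' (.inr h)])
  · intro p hp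
    obtain ⟨x, s, hA, h0, h1⟩ := hpath p hp
    by_contra hn
    push Not at hn
    refine hmax x s (fun s' hs' => ?_) (fun x' hx' => ?_) hA
    · exact hn _ ⟨_, hs', rfl⟩ 0 0 h0
    · exact hn _ ⟨_, hx', rfl⟩ 1 1 h1
  · ext ⟨x, s⟩
    simp only [Set.mem_symmDiff, Set.mem_empty_iff_false, false_and, not_false_eq_true, and_true,
      false_or]
    constructor
    · intro h
      exact ⟨_, ⟨_, h, rfl⟩, 0, .inl ⟨rfl, rfl⟩⟩
    · rintro ⟨p, ⟨e, he, rfl⟩, i, h⟩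
      fin_cases i
      simp at h
      obtain ⟨h1, h2⟩ := h
      rw [← h1, ← h2]
      exact he

/-- The loop stops if a set that is closed under alternating paths has no free vertex of `S`. -/
theorem stopped_of_closed {lmax : ℝ} (Z : Set P)
    (hfree : ∀ x, FreeLeft X x → x ∈ Z)
    (hstep : ∀ x ∈ Z, ∀ s, A x s → ∀ y, (y, s) ∈ X → y ∈ Z)
    (hend : ∀ x ∈ Z, ∀ s, A x s → ¬ FreeRight X s) : Stopped A lmax X := by
  intro l hl
  exfalso
  -- The search never leaves `Z` and the neighbours of `Z`.
  have key : ∀ k, (∀ x, Sum.inl x ∈ reach A X k → x ∈ Z) ∧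
      ∀ s, Sum.inr s ∈ reach A X k → ∃ x ∈ Z, A x s := by
    intro k
    induction k with
    | zero =>
      constructor
      · rintro x ⟨y, hy, h⟩
        cases h
        exact hfree x hy
      · rintro s ⟨y, hy, h⟩
        cases h
    | succ k ih =>
      constructor
      · rintro x (h | ⟨y | s, hu, harc⟩)
        · exact ih.1 x h
        · exact harc.elim
        · obtain ⟨z, hz, hzs⟩ := ih.2 s hu
          exact hstep z hz s hzs x harc
      · rintro s (h | ⟨y | s', hu, harc⟩)
        · exact ih.2 s h
        · exact ⟨y, ih.1 y hu, harc.1⟩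
        · exact harc.elim
  obtain ⟨⟨s, hs, hr⟩, -⟩ := hl
  obtain ⟨x, hx, hA⟩ := (key l).2 s hr
  exact hend x hx s hA hs

end OnePhase

end PVER2HK

/-! ### Determinants of 1 + a in characteristic two. -/

namespace PVER2HK

open Polynomial in
-- Bounds replace the degrees because the coefficient at the bound is allowed to vanish; this is
-- what happens at a deleted entry.
theorem coeff_prod_sum_of_natDegree_le {R ι : Type*} [CommRing R] (s : Finset ι) (f : ι → R[X])
    (d : ι → ℕ) (h : ∀ i ∈ s, (f i).natDegree ≤ d i) :
    (∏ i ∈ s, f i).natDegree ≤ ∑ i ∈ s, d i ∧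
      (∏ i ∈ s, f i).coeff (∑ i ∈ s, d i) = ∏ i ∈ s, (f i).coeff (d i) := by
  classical
  induction s using Finset.induction_on with
  | empty => simp
  | insert i s hi ih =>
    obtain ⟨h1, h2⟩ := ih fun j hj => h j (Finset.mem_insert_of_mem hj)
    have h3 := h i (Finset.mem_insert_self i s)
    rw [Finset.prod_insert hi, Finset.sum_insert hi, Finset.prod_insert hi]
    exact ⟨natDegree_mul_le_of_le h3 h1, by rw [coeff_mul_add_eq_of_natDegree_le h3 h1, h2]⟩

section Determinant

variable {R : Type*} [CommRing R]

/-- The leading principal minors of `1 + a`. -/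
def leadingMinor (a : ℕ → ℕ → R) (k : ℕ) : R :=
  (1 + Matrix.of fun i j : Fin k => a i j).det

/-- Row and column `k` border the minor of order `k`, so the new minor is the old one times a Schur
complement; the vector is x = B⁻¹c. In characteristic two the signs disappear, and Bx = c becomes
the fixed point equation x = ax + c, which walks can follow. -/
theorem exists_schur [CharP R 2] (a : ℕ → ℕ → R) (k : ℕ) (h : IsUnit (leadingMinor a k)) :
    ∃ x : ℕ → R, (∀ v < k, x v = ∑ v' ∈ Finset.range k, a v v' * x v' + a v k) ∧
      leadingMinor a (k + 1) =
        leadingMinor a k * (1 + a k k + ∑ v ∈ Finset.range k, a k v * x v) := by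
  set B : Matrix (Fin k) (Fin k) R := 1 + Matrix.of fun i j : Fin k => a i j with hB
  have hBu : IsUnit B := (Matrix.isUnit_iff_isUnit_det B).2 h
  let _ := hBu.invertible
  set c : Matrix (Fin k) (Fin 1) R := Matrix.of fun i _ => a i k with hc
  set y : Matrix (Fin k) (Fin 1) R := ⅟B * c with hy
  have hBy : B * y = c := by rw [hy, ← Matrix.mul_assoc, mul_invOf_self, Matrix.one_mul]
  refine ⟨fun v => if hv : v < k then y ⟨v, hv⟩ 0 else 0, fun v hv => ?_, ?_⟩
  · have h1 := congrFun (congrFun hBy ⟨v, hv⟩) 0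
    rw [hB, Matrix.add_mul, Matrix.one_mul, Matrix.add_apply, Matrix.mul_apply] at h1
    rw [Finset.sum_range]
    simp only [hv, dif_pos, Fin.is_lt, Fin.eta]
    have h2 : y ⟨v, hv⟩ 0 = c ⟨v, hv⟩ 0 - ∑ j, Matrix.of (fun i j : Fin k => a i j) ⟨v, hv⟩ j * y j 0 :=
      eq_sub_of_add_eq h1
    rw [h2, CharTwo.sub_eq_add, add_comm]
    rfl
  · have e : leadingMinor a (k + 1) = (Matrix.fromBlocks B c (Matrix.of fun _ j => a k j)
        (Matrix.of fun _ _ => 1 + a k k) : Matrix (Fin k ⊕ Fin 1) (Fin k ⊕ Fin 1) R).det := by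
      rw [leadingMinor, ← Matrix.det_submatrix_equiv_self (finSumFinEquiv (m := k) (n := 1))]
      congr 1
      ext i j
      rcases i with i | i <;> rcases j with j | j
      · simp [hB, Matrix.one_apply]
      · have : (Fin.castAdd 1 i) ≠ Fin.natAdd k j := by
          intro h; have := congrArg Fin.val h; simp at this; omega
        simp [hc, this]
      · have : (Fin.natAdd k i) ≠ Fin.castAdd 1 j := by
          intro h; have := congrArg Fin.val h; simp at this; omega
        simp [this]
      · obtain rfl := Subsingleton.elim i j
        simp
    rw [e, Matrix.det_fromBlocks₁₁, Matrix.mul_assoc, ← hy]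
    congr 1
    rw [Matrix.det_fin_one, Matrix.sub_apply, Matrix.mul_apply, Finset.sum_range,
      CharTwo.sub_eq_add]
    simp

end Determinant

open PowerSeries

/-- Solutions of the linear system of the walks whose weights add up to the determinant. -/
theorem exists_walk_system (a : ℕ → ℕ → (ZMod 2)⟦X⟧) (n : ℕ)
    (ha : ∀ i j, constantCoeff (a i j) = 0) :
    ∃ g : ℕ → ℕ → (ZMod 2)⟦X⟧, g n n = 1 ∧
      (∀ k < n, g k k = g (k + 1) (k + 1) + ∑ v ∈ Finset.range k, a k v * g k v +
        a k k * g (k + 1) (k + 1)) ∧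
      (∀ k < n, ∀ v < k, g k v = ∑ v' ∈ Finset.range k, a v v' * g k v' +
        a v k * g (k + 1) (k + 1)) ∧
      (∀ k v, ¬ (k = n ∧ v = n) → ¬ (k < n ∧ v ≤ k) → g k v = 0) ∧
      g 0 0 = leadingMinor a n := by
  have hunit : ∀ k, constantCoeff (leadingMinor a k) = 1 := by
    intro k
    have : (constantCoeff (R := ZMod 2)).mapMatrix (1 + Matrix.of fun i j : Fin k => a i j) = 1 := by
      ext i j
      simp [Matrix.map_apply, ha, Matrix.one_apply, apply_ite]
    rw [leadingMinor, RingHom.map_det, this, Matrix.det_one]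
  have hinv : ∀ k, leadingMinor a k * (leadingMinor a k)⁻¹ = 1 := fun k =>
    PowerSeries.mul_inv_cancel _ (by rw [hunit]; exact one_ne_zero)
  have : CharP (ZMod 2)⟦X⟧ 2 := charP_of_injective_ringHom (PowerSeries.C_injective (R := ZMod 2)) 2
  choose x hx1 hx2 using fun k => exists_schur a k (IsUnit.of_mul_eq_one _ (hinv k))
  -- The quotient of the minors of order n and k. It runs from the determinant at k = 0 to 1 at k =
  -- n, and all minors are units since their constant coefficient is 1.
  set h : ℕ → (ZMod 2)⟦X⟧ := fun k => leadingMinor a n * (leadingMinor a k)⁻¹ with hh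
  have hhn : h n = 1 := hinv n
  have hstep : ∀ k, h k = (1 + a k k + ∑ v ∈ Finset.range k, a k v * x k v) * h (k + 1) := by
    intro k
    have h1 := hinv k
    have h2 := hinv (k + 1)
    rw [hx2 k] at h2
    simp only [hh]
    rw [hx2 k]
    calc leadingMinor a n * (leadingMinor a k)⁻¹
        = leadingMinor a n * (leadingMinor a k)⁻¹ * (leadingMinor a k *
          (1 + a k k + ∑ v ∈ Finset.range k, a k v * x k v) * (leadingMinor a k *
          (1 + a k k + ∑ v ∈ Finset.range k, a k v * x k v))⁻¹) := by rw [h2, mul_one]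
      _ = (leadingMinor a k * (leadingMinor a k)⁻¹) *
          ((1 + a k k + ∑ v ∈ Finset.range k, a k v * x k v) *
          (leadingMinor a n * (leadingMinor a k *
          (1 + a k k + ∑ v ∈ Finset.range k, a k v * x k v))⁻¹)) := by ring
      _ = _ := by rw [h1, one_mul]
  -- A walk with head `k` that stands at v < k has to return to its head, which contributes `x k v`,
  -- and then continue with larger heads, which contributes `h (k + 1)`.
  let g : ℕ → ℕ → (ZMod 2)⟦X⟧ := fun k v => if k ≤ n then if v = k then h k else
    if v < k ∧ k < n then x k v * h (k + 1) else 0 else 0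
  have hg1 : ∀ k ≤ n, g k k = h k := fun k hk => by simp [g, hk]
  have hg2 : ∀ k < n, ∀ v < k, g k v = x k v * h (k + 1) := fun k hk v hv => by
    simp [g, hk.le, hk, hv, hv.ne]
  have hg3 : ∀ (b : ℕ → (ZMod 2)⟦X⟧), ∀ k < n, ∑ v ∈ Finset.range k, b v * g k v =
      (∑ v ∈ Finset.range k, b v * x k v) * h (k + 1) := by
    intro b k hk
    rw [Finset.sum_mul]
    refine Finset.sum_congr rfl fun v hv => ?_
    rw [hg2 k hk v (Finset.mem_range.1 hv), mul_assoc]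
  refine ⟨g, (hg1 n le_rfl).trans hhn, fun k hk => ?_, fun k hk v hv => ?_, fun k v h1 h2 => ?_, ?_⟩
  · rw [hg3 _ k hk, hg1 k hk.le, hg1 (k + 1) hk, hstep k]
    ring
  · rw [hg3 _ k hk, hg1 (k + 1) hk, hg2 k hk v hv, ← add_mul, ← hx1 k v hv]
  · dsimp only [g]
    split_ifs <;> first | rfl | omega
  · have h1 : leadingMinor a 0 = 1 := by simp [leadingMinor]
    have h0 := hinv 0
    rw [h1, one_mul] at h0
    rw [hg1 0 n.zero_le]
    simp only [hh]
    rw [h1, h0, mul_one]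

/-- The entries of the matrix with the weights `w`, without the entries in `del`. -/
noncomputable def entry (w : ℕ → ℕ → ℕ) (del : ℕ → ℕ → Prop) (i j : ℕ) : (ZMod 2)⟦X⟧ :=
  open Classical in if del i j then 0 else X ^ w i j

/-- If there is a unique heaviest permutation, then it gives the leading term of the determinant,
and it uses a deleted entry if and only if this term vanishes. -/
theorem coeff_leadingMinor_entry (w : ℕ → ℕ → ℕ) (del : ℕ → ℕ → Prop) (n : ℕ)
    (hw : ∀ i j, 1 ≤ w i j) (σ : Equiv.Perm (Fin n))
    (hσ : ∀ τ, τ ≠ σ → ∑ i, w (τ i) i < ∑ i, w (σ i) i) :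
    (∀ t, ∑ i, w (σ i) i < t → coeff t (leadingMinor (entry w del) n) = 0) ∧
    ((∃ i, del (σ i) i) → coeff (∑ i, w (σ i) i) (leadingMinor (entry w del) n) = 0) ∧
    ((∀ i, ¬ del (σ i) i) → coeff (∑ i, w (σ i) i) (leadingMinor (entry w del) n) = 1) := by
  classical
  -- Polynomials instead of power series, in order to speak of degrees.
  let q : Matrix (Fin n) (Fin n) (Polynomial (ZMod 2)) := 1 + Matrix.of fun i j : Fin n =>
    if del i j then 0 else Polynomial.X ^ w i j
  have hq : leadingMinor (entry w del) n = (q.det : (ZMod 2)⟦X⟧) := by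
    have h := (Polynomial.coeToPowerSeries.ringHom (R := ZMod 2)).map_det q
    rw [Polynomial.coeToPowerSeries.ringHom_apply] at h
    rw [h, leadingMinor]
    congr 1
    ext1 i j
    simp only [q, entry, RingHom.mapMatrix_apply, Matrix.map_apply, Matrix.add_apply,
      Matrix.of_apply, Matrix.one_apply, map_add]
    congr 1
    · split_ifs <;> simp
    · split_ifs <;> simp
  have hdeg : ∀ i j, (q i j).natDegree ≤ w i j := by
    intro i j
    simp only [q, Matrix.add_apply, Matrix.of_apply, Matrix.one_apply]
    refine (Polynomial.natDegree_add_le _ _).trans (max_le ?_ ?_)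
    · split_ifs <;> simp
    · split_ifs
      · simp
      · exact Polynomial.natDegree_X_pow_le _
  have hlead : ∀ i j, (q i j).coeff (w i j) = if del i j then 0 else 1 := by
    intro i j
    -- Positive weights keep the summand 1 on the diagonal out of the leading coefficient.
    have : w i j ≠ 0 := Nat.one_le_iff_ne_zero.1 (hw i j)
    simp only [q, Matrix.add_apply, Matrix.of_apply, Matrix.one_apply, Polynomial.coeff_add]
    split_ifs <;> simp [Polynomial.coeff_one, this]
  have hcoeff : ∀ t, ∑ i, w (σ i) i ≤ t → coeff t (leadingMinor (entry w del) n) =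
      (∏ i, q (σ i) i).coeff t := by
    intro t ht
    rw [hq, Polynomial.coeff_coe, Matrix.det_apply, Polynomial.finsetSum_coeff,
      Finset.sum_eq_single σ]
    · rcases Int.units_eq_one_or (Equiv.Perm.sign σ) with h | h
      · rw [h, one_smul]
      · rw [h, Units.neg_smul, one_smul, Polynomial.coeff_neg, CharTwo.neg_eq]
    -- The other permutations are lighter, so their products have degree below `t`.
    · intro τ _ hτ
      have h1 := (coeff_prod_sum_of_natDegree_le Finset.univ (fun i => q (τ i) i)
        (fun i => w (τ i) i) fun i _ => hdeg _ _).1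
      have h2 : (∏ i, q (τ i) i).coeff t = 0 :=
        Polynomial.coeff_eq_zero_of_natDegree_lt (h1.trans_lt ((hσ τ hτ).trans_le ht))
      rcases Int.units_eq_one_or (Equiv.Perm.sign τ) with h | h
      · rw [h, one_smul, h2]
      · rw [h, Units.neg_smul, one_smul, Polynomial.coeff_neg, h2, neg_zero]
    · simp
  obtain ⟨h1, h2⟩ := coeff_prod_sum_of_natDegree_le Finset.univ (fun i => q (σ i) i)
        (fun i => w (σ i) i) fun i _ => hdeg _ _
  refine ⟨fun t ht => ?_, fun ⟨i, hi⟩ => ?_, fun h => ?_⟩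
  · rw [hcoeff t ht.le]
    exact Polynomial.coeff_eq_zero_of_natDegree_lt (h1.trans_lt ht)
  · rw [hcoeff _ le_rfl, h2]
    exact Finset.prod_eq_zero (Finset.mem_univ i) (by simp [hlead, hi])
  · rw [hcoeff _ le_rfl, h2]
    exact Finset.prod_eq_one fun i _ => by simp [hlead, h i]

end PVER2HK

/-! ### Coefficients of the determinant by repeated squaring of a step matrix. -/

namespace PVER2HK

open PowerSeries

theorem sum_range_mul {R : Type*} [AddCommMonoid R] (a b : ℕ) (f : ℕ → R) :
    ∑ x ∈ Finset.range (a * b), f x =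
      ∑ i ∈ Finset.range a, ∑ j ∈ Finset.range b, f (i * b + j) := by
  induction a with
  | zero => simp
  | succ a ih => rw [Nat.succ_mul, Finset.sum_range_add, ih, Finset.sum_range_succ]

/-- The code of a triple, in mixed radix notation. -/
def code (Bv T k v t : ℕ) : ℕ := (k * Bv + v) * T + t

theorem code_lt {Bk Bv T k v t : ℕ} (hk : k < Bk) (hv : v < Bv) (ht : t < T) :
    code Bv T k v t < Bk * Bv * T := by
  have h1 : k * Bv + v + 1 ≤ Bk * Bv := by nlinarith
  unfold code
  nlinarith

theorem mul_add_div_of_lt {a b c : ℕ} (h : c < b) : (a * b + c) / b = a := by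
  rw [mul_comm, Nat.mul_add_div (by omega), Nat.div_eq_of_lt h, add_zero]

theorem mul_add_mod_of_lt {a b c : ℕ} (h : c < b) : (a * b + c) % b = c := by
  rw [Nat.mul_add_mod', Nat.mod_eq_of_lt h]

theorem code_div_div {Bv T k v t : ℕ} (hv : v < Bv) (ht : t < T) :
    code Bv T k v t / T / Bv = k := by
  rw [code, mul_add_div_of_lt ht, mul_add_div_of_lt hv]

theorem code_div_mod {Bv T k v t : ℕ} (hv : v < Bv) (ht : t < T) :
    code Bv T k v t / T % Bv = v := by
  rw [code, mul_add_div_of_lt ht, mul_add_mod_of_lt hv]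

theorem code_mod {Bv T k v t : ℕ} (ht : t < T) : code Bv T k v t % T = t := by
  rw [code, mul_add_mod_of_lt ht]

theorem sum_range_code {R : Type*} [AddCommMonoid R] (Bk Bv T : ℕ) (f : ℕ → R) :
    ∑ x ∈ Finset.range (Bk * Bv * T), f x =
      ∑ k ∈ Finset.range Bk, ∑ v ∈ Finset.range Bv, ∑ t ∈ Finset.range T, f (code Bv T k v t) := by
  rw [sum_range_mul, sum_range_mul]
  rfl

section Walks

variable (n : ℕ) (w : ℕ → ℕ → ℕ) (del : ℕ → ℕ → Prop)

/-- One step of a walk through the states `(k, v, t)`: the vertices of closed walks with head `k`,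
with the total weight `t` so far. -/
def Step (k v t k' v' t' : ℕ) : Prop :=
  (k = n ∧ v = n ∧ k' = n ∧ v' = n ∧ t' = t) ∨
  (k < n ∧ v = k ∧ k' = k + 1 ∧ v' = k + 1 ∧ t' = t) ∨
  (k < n ∧ v ≤ k ∧ k' = k ∧ v' < k ∧ ¬ del v v' ∧ t' = t + w v v') ∨
  (k < n ∧ v ≤ k ∧ k' = k + 1 ∧ v' = k + 1 ∧ ¬ del v k ∧ t' = t + w v k)

variable {n w del}

/-- The last hypothesis covers a step that carries the weight beyond the range `T`: its term is
missing from the sum, but it would be zero. -/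
theorem sum_single_triple {R : Type*} [AddCommMonoid R] (Bk Bv T x y z : ℕ) (f : ℕ → ℕ → ℕ → R)
    (hx : x < Bk) (hy : y < Bv) (hf : T ≤ z → f x y z = 0) :
    (∑ k ∈ Finset.range Bk, ∑ v ∈ Finset.range Bv, ∑ t ∈ Finset.range T,
      if k = x ∧ v = y ∧ t = z then f k v t else 0) = f x y z := by
  rw [Finset.sum_eq_single x, Finset.sum_eq_single y]
  · simp only [true_and, Finset.sum_ite_eq', Finset.mem_range]
    split_ifs with h
    · rfl
    · exact (hf (not_lt.1 h)).symm
  · intro v _ hv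
    simp [hv]
  · exact fun h => absurd (Finset.mem_range.2 hy) h
  · intro k _ hk
    simp [hk]
  · exact fun h => absurd (Finset.mem_range.2 hx) h

open Classical in
-- The kinds of moves exclude one another, so the indicator splits into a sum. Positive weights
-- separate skipping the head `k` from closing a walk there, as both lead to `(k + 1, k + 1)`.
theorem step_indicator_mul (hw : ∀ i j, 1 ≤ w i j) {k v : ℕ} (hkn : k < n) (hvk : v ≤ k)
    (t k' v' t' : ℕ) (z : ZMod 2) : (if Step n w del k v t k' v' t' then 1 else 0) * z =
      (if k' = k + 1 ∧ v' = k + 1 ∧ t' = t then (if v = k then z else 0) else 0) +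
      (∑ y ∈ Finset.range k, if k' = k ∧ v' = y ∧ t' = t + w v y then
        (if ¬ del v y then z else 0) else 0) +
      (if k' = k + 1 ∧ v' = k + 1 ∧ t' = t + w v k then
        (if ¬ del v k then z else 0) else 0) := by
  have hwk := hw v k
  have hsum : (∑ y ∈ Finset.range k, if k' = k ∧ v' = y ∧ t' = t + w v y then
      (if ¬ del v y then z else 0) else 0) =
      if k' = k ∧ v' < k ∧ t' = t + w v v' ∧ ¬ del v v' then z else 0 := by
    by_cases hv' : v' < k
    · rw [Finset.sum_eq_single v']
      · by_cases hd : del v v' <;> simp [hd, hv']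
      · intro y _ hy
        simp [hy.symm]
      · exact fun h => absurd (Finset.mem_range.2 hv') h
    · rw [if_neg (by omega)]
      refine Finset.sum_eq_zero fun y hy => ?_
      rw [if_neg]
      have := Finset.mem_range.1 hy
      omega
  rw [hsum]
  rw [← ite_and, ← ite_and, ite_mul, one_mul, zero_mul]
  have hS : Step n w del k v t k' v' t' ↔ ((k' = k + 1 ∧ v' = k + 1 ∧ t' = t) ∧ v = k) ∨
      (k' = k ∧ v' < k ∧ t' = t + w v v' ∧ ¬ del v v') ∨
      ((k' = k + 1 ∧ v' = k + 1 ∧ t' = t + w v k) ∧ ¬ del v k) := by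
    simp only [Step, hkn, hkn.ne, hvk, false_and, true_and, false_or]
    simp only [and_assoc, and_comm, and_left_comm]
  by_cases c1 : (k' = k + 1 ∧ v' = k + 1 ∧ t' = t) ∧ v = k
  · rw [if_pos (hS.2 (.inl c1)), if_pos c1, if_neg (by omega), if_neg (by omega), add_zero,
      add_zero]
  · by_cases c2 : k' = k ∧ v' < k ∧ t' = t + w v v' ∧ ¬ del v v'
    · rw [if_pos (hS.2 (.inr (.inl c2))), if_neg c1, if_pos c2, if_neg (by omega), add_zero,
        zero_add]
    · by_cases c3 : (k' = k + 1 ∧ v' = k + 1 ∧ t' = t + w v k) ∧ ¬ del v k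
      · rw [if_pos (hS.2 (.inr (.inr c3))), if_neg c1, if_neg c2, if_pos c3, add_zero,
          zero_add]
      · rw [if_neg (by tauto), if_neg c1, if_neg c2, if_neg c3, add_zero, add_zero]

open Classical in
/-- The coefficients of the solutions of the system are a fixed vector of the step matrix. -/
theorem sum_step_mul {Bk Bv T t₀ : ℕ} (hBk : n < Bk) (hBv : n < Bv) (ht₀ : t₀ < T)
    (hw : ∀ i j, 1 ≤ w i j) {g : ℕ → ℕ → (ZMod 2)⟦X⟧} (h1 : g n n = 1)
    (h2 : ∀ k < n, g k k = g (k + 1) (k + 1) + ∑ v ∈ Finset.range k, entry w del k v * g k v +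
        entry w del k k * g (k + 1) (k + 1))
    (h3 : ∀ k < n, ∀ v < k, g k v = ∑ v' ∈ Finset.range k, entry w del v v' * g k v' +
        entry w del v k * g (k + 1) (k + 1))
    (h4 : ∀ k v, ¬ (k = n ∧ v = n) → ¬ (k < n ∧ v ≤ k) → g k v = 0)
    {f : ℕ → ℕ → ℕ → ZMod 2}
    (hf : f = fun k v t => if t ≤ t₀ then coeff (t₀ - t) (g k v) else 0)
    (k v t : ℕ) :
    (∑ k' ∈ Finset.range Bk, ∑ v' ∈ Finset.range Bv, ∑ t' ∈ Finset.range T,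
      (if Step n w del k v t k' v' t' then 1 else 0) * f k' v' t') = f k v t := by
  have hfT : ∀ k v t, T ≤ t → f k v t = 0 := fun k v t ht => by
    rw [hf]
    simp [show ¬ t ≤ t₀ by omega]
  -- Multiplication by an entry X^w shifts the coefficient index, that is, adds w to the weight
  -- collected so far.
  have hterm : ∀ i j k v, (if t ≤ t₀ then coeff (t₀ - t) (entry w del i j * g k v) else 0) =
      if ¬ del i j then f k v (t + w i j) else 0 := by
    intro i j k v
    rw [entry, hf]
    by_cases hd : del i j
    · simp [hd]
    · simp only [hd, if_false, coeff_X_pow_mul', not_false_eq_true, if_true]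
      by_cases ht : t ≤ t₀
      · rw [if_pos ht]
        by_cases hwt : w i j ≤ t₀ - t
        · rw [if_pos hwt, if_pos (by omega), Nat.sub_sub]
        · rw [if_neg hwt, if_neg (by omega)]
      · rw [if_neg ht, if_neg (by omega)]
  by_cases hkn : k < n
  swap
  · by_cases hend : k = n ∧ v = n
    · obtain ⟨rfl, rfl⟩ := hend
      rw [← sum_single_triple Bk Bv T v v t f hBk hBv (hfT _ _ _)]
      refine Finset.sum_congr rfl fun k' _ => Finset.sum_congr rfl fun v' _ =>
        Finset.sum_congr rfl fun t' _ => ?_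
      simp [Step]
    · have h0 : f k v t = 0 := by
        rw [hf]
        simp [h4 k v hend (by omega)]
      rw [h0]
      refine Finset.sum_eq_zero fun k' _ => Finset.sum_eq_zero fun v' _ =>
        Finset.sum_eq_zero fun t' _ => ?_
      rw [if_neg, zero_mul]
      unfold Step
      omega
  by_cases hvk : v ≤ k
  swap
  · have h0 : f k v t = 0 := by
      rw [hf]
      simp [h4 k v (by omega) (by omega)]
    rw [h0]
    refine Finset.sum_eq_zero fun k' _ => Finset.sum_eq_zero fun v' _ =>
      Finset.sum_eq_zero fun t' _ => ?_
    rw [if_neg, zero_mul]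
    unfold Step
    omega
  have hsplit := fun k' v' t' => step_indicator_mul (del := del) hw hkn hvk t k' v' t' (f k' v' t')
  simp only [hsplit, Finset.sum_add_distrib]
  have e1 := sum_single_triple Bk Bv T (k + 1) (k + 1) t
    (fun k' v' t' => if v = k then f k' v' t' else 0) (by omega) (by omega)
    (fun h => by simp [hfT _ _ _ h])
  have e3 := sum_single_triple Bk Bv T (k + 1) (k + 1) (t + w v k)
    (fun k' v' t' => if ¬ del v k then f k' v' t' else 0) (by omega) (by omega)
    (fun h => by simp [hfT _ _ _ h])
  have e2 : (∑ k' ∈ Finset.range Bk, ∑ v' ∈ Finset.range Bv, ∑ t' ∈ Finset.range T,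
      ∑ y ∈ Finset.range k, if k' = k ∧ v' = y ∧ t' = t + w v y then
        (if ¬ del v y then f k' v' t' else 0) else 0) =
      ∑ y ∈ Finset.range k, if ¬ del v y then f k y (t + w v y) else 0 := by
    have h : ∀ y ∈ Finset.range k, (if ¬ del v y then f k y (t + w v y) else 0) =
        ∑ k' ∈ Finset.range Bk, ∑ v' ∈ Finset.range Bv, ∑ t' ∈ Finset.range T,
        if k' = k ∧ v' = y ∧ t' = t + w v y then (if ¬ del v y then f k' v' t' else 0) else 0 := by
      intro y hy
      have := Finset.mem_range.1 hy
      exact (sum_single_triple Bk Bv T k y (t + w v y)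
        (fun k' v' t' => if ¬ del v y then f k' v' t' else 0) (by omega) (by omega)
        (fun h => by simp [hfT _ _ _ h])).symm
    rw [Finset.sum_congr rfl h, Finset.sum_comm (s := Finset.range k)]
    refine Finset.sum_congr rfl fun k' _ => ?_
    rw [Finset.sum_comm (s := Finset.range k)]
    refine Finset.sum_congr rfl fun v' _ => ?_
    rw [Finset.sum_comm (s := Finset.range k)]
  rw [e1, e2, e3]
  simp only [← hterm]
  have hg : g k v = (if v = k then g (k + 1) (k + 1) else 0) +
      ∑ y ∈ Finset.range k, entry w del v y * g k y + entry w del v k * g (k + 1) (k + 1) := by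
    by_cases h : v = k
    · subst h
      rw [if_pos rfl]
      exact h2 v hkn
    · rw [if_neg h, zero_add]
      exact h3 k hkn v (by omega)
  have hfk : f k v t = if t ≤ t₀ then coeff (t₀ - t) (g k v) else 0 := by rw [hf]
  rw [hfk, hg]
  by_cases ht : t ≤ t₀
  · simp only [ht, if_true, map_add, map_sum]
    congr 2
    rw [hf]
    split_ifs <;> simp [ht]
  · simp only [ht, if_false, Finset.sum_const_zero, add_zero]
    rw [hf]
    simp [ht]

open Classical in
/-- Repeated squaring of the step matrix computes the coefficients of the determinant. -/
theorem iterated_square_step {Bk Bv T t₀ : ℕ} (hBk : n < Bk) (hBv : n < Bv) (ht₀ : t₀ < T)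
    (hw : ∀ i j, 1 ≤ w i j) (Q : ℕ → ℕ → ℕ → ZMod 2) (J : ℕ) (hJ : n + T < 2 ^ J)
    (hQ0 : ∀ a < Bk * Bv * T, ∀ b < Bk * Bv * T, Q 0 a b = if Step n w del (a / T / Bv)
      (a / T % Bv) (a % T) (b / T / Bv) (b / T % Bv) (b % T) then 1 else 0)
    (hQs : ∀ j < J, ∀ a < Bk * Bv * T, ∀ b < Bk * Bv * T,
      Q (j + 1) a b = ∑ c ∈ Finset.range (Bk * Bv * T), Q j a c * Q j c b) :
    Q J 0 (code Bv T n n t₀) = coeff t₀ (leadingMinor (entry w del) n) := by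
  have ha : ∀ i j, constantCoeff (entry w del i j) = 0 := by
    intro i j
    have : w i j ≠ 0 := Nat.one_le_iff_ne_zero.1 (hw i j)
    rw [entry]
    split_ifs <;> simp [this]
  obtain ⟨g, h1, h2, h3, h4, h5⟩ := exists_walk_system (entry w del) n ha
  set f : ℕ → ℕ → ℕ → ZMod 2 := fun k v t => if t ≤ t₀ then coeff (t₀ - t) (g k v) else 0 with hf
  set F : ℕ → ZMod 2 := fun a => f (a / T / Bv) (a / T % Bv) (a % T) with hF
  set Sz := Bk * Bv * T with hSz
  have hT : 0 < T := by omega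
  have hBv0 : 0 < Bv := by omega
  have hfix0 : ∀ a < Sz, ∑ b ∈ Finset.range Sz, Q 0 a b * F b = F a := by
    intro a ha
    rw [hF]
    dsimp only
    rw [← sum_step_mul hBk hBv ht₀ hw h1 h2 h3 h4 hf (a / T / Bv) (a / T % Bv) (a % T), hSz,
      sum_range_code]
    refine Finset.sum_congr rfl fun k' hk => Finset.sum_congr rfl fun v' hv =>
        Finset.sum_congr rfl fun t' ht => ?_
    rw [Finset.mem_range] at hk hv ht
    rw [hQ0 a ha _ (code_lt hk hv ht), code_div_div hv ht, code_div_mod hv ht, code_mod ht]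
  -- A fixed vector of the step matrix is also fixed by its powers.
  have hfix : ∀ j ≤ J, ∀ a < Sz, ∑ b ∈ Finset.range Sz, Q j a b * F b = F a := by
    intro j
    induction j with
    | zero => exact fun _ => hfix0
    | succ j ih =>
      intro hj a ha
      have e : ∀ b ∈ Finset.range Sz, Q (j + 1) a b * F b =
          ∑ c ∈ Finset.range Sz, Q j a c * (Q j c b * F b) := by
        intro b hb
        rw [hQs j hj a ha b (Finset.mem_range.1 hb), Finset.sum_mul]
        exact Finset.sum_congr rfl fun c _ => mul_assoc _ _ _
      rw [Finset.sum_congr rfl e, Finset.sum_comm]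
      rw [← ih (by omega) a ha]
      refine Finset.sum_congr rfl fun c hc => ?_
      rw [← Finset.mul_sum, ih (by omega) c (Finset.mem_range.1 hc)]
  -- `E` describes the absorbing states. Any move into another state raises head plus weight by at
  -- least 1, and this sum is at most n + T, so after 2 ^ J steps only absorbing states remain.
  let E : ℕ → Prop := fun a => a / T / Bv = n ∧ a / T % Bv = n
  let pot : ℕ → ℕ := fun a => a / T / Bv + a % T
  have hsupp : ∀ j ≤ J, ∀ a < Sz, ∀ b < Sz, Q j a b ≠ 0 →
      (E a → E b) ∧ (E b ∨ (pot a + 2 ^ j ≤ pot b ∧ pot b ≤ n + T)) := by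
    intro j
    induction j with
    | zero =>
      intro _ a ha b hb hab
      rw [hQ0 a ha b hb] at hab
      have hS : Step n w del (a / T / Bv) (a / T % Bv) (a % T) (b / T / Bv) (b / T % Bv)
          (b % T) := by
        by_contra hS
        rw [if_neg hS] at hab
        exact hab rfl
      have hbT := Nat.mod_lt b hT
      dsimp only [E, pot]
      have hw1 := hw (a / T % Bv) (b / T % Bv)
      have hw2 := hw (a / T % Bv) (a / T / Bv)
      unfold Step at hS
      rcases hS with h | h | h | h <;> omega
    | succ j ih =>
      intro hj a ha b hb hab
      rw [hQs j hj a ha b hb] at hab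
      obtain ⟨c, hc, hne⟩ := Finset.exists_ne_zero_of_sum_ne_zero hab
      have hc' := Finset.mem_range.1 hc
      obtain ⟨p1, p2⟩ := ih (by omega) a ha c hc' (left_ne_zero_of_mul hne)
      obtain ⟨q1, q2⟩ := ih (by omega) c hc' b hb (right_ne_zero_of_mul hne)
      refine ⟨fun h => q1 (p1 h), ?_⟩
      rcases p2 with p2 | p2
      · exact .inl (q1 p2)
      · rcases q2 with q2 | q2
        · exact .inl q2
        · right
          rw [pow_succ]
          omega
  have hpos : 0 < Sz := by
    have : 0 < Bk := by omega
    positivity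
  have hend := code_lt hBk hBv ht₀
  have hfin := hfix J le_rfl 0 hpos
  -- On absorbing states `F` is the coefficient of degree t₀ - t of 1, so only t = t₀ survives in
  -- the fixed point equation at state 0.
  rw [Finset.sum_eq_single (code Bv T n n t₀)] at hfin
  · have hF0 : F 0 = coeff t₀ (leadingMinor (entry w del) n) := by
      rw [← h5]
      simp [hF, hf]
    have hFe : F (code Bv T n n t₀) = 1 := by
      simp only [hF]
      rw [code_div_div hBv ht₀, code_div_mod hBv ht₀, code_mod ht₀]
      simp [hf, h1]
    rw [hFe, mul_one] at hfin
    rw [hfin, hF0]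
  · intro b hb hne
    have hb' := Finset.mem_range.1 hb
    by_cases hq : Q J 0 b = 0
    · rw [hq, zero_mul]
    · rcases (hsupp J le_rfl 0 hpos b hb' hq).2 with hE | hE
      · have hbt : b % T ≠ t₀ := by
          intro h
          refine hne ?_
          rw [code, ← h]
          obtain ⟨e1, e2⟩ := hE
          have h1 := Nat.div_add_mod' (b / T) Bv
          rw [e1, e2] at h1
          rw [h1, Nat.div_add_mod']
        have : F b = 0 := by
          simp only [hF, hf]
          obtain ⟨e1, e2⟩ := hE
          rw [e1, e2, h1]
          split_ifs with h
          · rw [coeff_one, if_neg (by omega)]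
          · rfl
        rw [this, mul_zero]
      · omega
  · exact fun h => absurd (Finset.mem_range.2 hend) h

end Walks

end PVER2HK

namespace PVER2HK

/-! ### The isolation lemma. -/

section Isolation

variable {Ω ι : Type*} [Finite Ω] [Nonempty Ω] [Fintype ι] [DecidableEq ι] {W : ℕ}

/-- Random weights with a fixed base. -/
def randomWeight (b : ι → ℕ) (emb : ι → Fin W) (R : ℕ) (ω : Fin W → Fin W) (x : ι) : ℕ :=
  b x + (ω (emb x) : ℕ) % R

/-- The element `x` distinguishes two heaviest members of the family. -/
def Ambiguous (mem : Ω → Finset ι) (w : ι → ℕ) (x : ι) : Prop :=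
  ∃ σ τ, (∀ ρ, ∑ y ∈ mem ρ, w y ≤ ∑ y ∈ mem σ, w y) ∧ (∀ ρ, ∑ y ∈ mem ρ, w y ≤ ∑ y ∈ mem τ, w y) ∧
    x ∈ mem σ ∧ x ∉ mem τ

omit [Fintype ι] in
theorem exists_isolated_or_ambiguous {mem : Ω → Finset ι} (hinj : Function.Injective mem)
    (w : ι → ℕ) : (∃ σ, ∀ τ, τ ≠ σ → ∑ y ∈ mem τ, w y < ∑ y ∈ mem σ, w y) ∨
      ∃ x, Ambiguous mem w x := by
  obtain ⟨σ, hσ⟩ := Finite.exists_max fun σ => ∑ y ∈ mem σ, w y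
  by_cases h : ∀ τ, τ ≠ σ → ∑ y ∈ mem τ, w y < ∑ y ∈ mem σ, w y
  · exact .inl ⟨σ, h⟩
  · right
    push Not at h
    obtain ⟨τ, hne, hle⟩ := h
    have hτ : ∀ ρ, ∑ y ∈ mem ρ, w y ≤ ∑ y ∈ mem τ, w y := fun ρ => (hσ ρ).trans hle
    have hmem : mem τ ≠ mem σ := fun h => hne (hinj h)
    by_cases hsub : mem σ ⊆ mem τ
    · have : ¬ mem τ ⊆ mem σ := fun h => hmem (h.antisymm hsub)
      obtain ⟨x, hx, hx'⟩ := Finset.not_subset.1 this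
      exact ⟨x, τ, σ, hτ, hσ, hx, hx'⟩
    · obtain ⟨x, hx, hx'⟩ := Finset.not_subset.1 hsub
      exact ⟨x, σ, τ, hσ, hτ, hx, hx'⟩

omit [Finite Ω] [Nonempty Ω] [Fintype ι] in
-- If the weight of `x` grew while the others stayed, the heaviest members with `x` would overtake
-- those without it, and the tie would be broken. By symmetry, at most one weight of `x` is
-- ambiguous for given other weights.
theorem Ambiguous.le {mem : Ω → Finset ι} {w w' : ι → ℕ} {x : ι} (h : Ambiguous mem w x)
    (h' : Ambiguous mem w' x) (heq : ∀ y, y ≠ x → w y = w' y) : w' x ≤ w x := by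
  by_contra hlt
  push Not at hlt
  obtain ⟨σ, τ, hσ, hτ, hxσ, -⟩ := h
  obtain ⟨-, τ', -, hτ', -, hxτ'⟩ := h'
  have h1 : ∑ y ∈ mem σ, w y < ∑ y ∈ mem σ, w' y := by
    refine Finset.sum_lt_sum (fun y _ => ?_) ⟨x, hxσ, hlt⟩
    by_cases hy : y = x
    · rw [hy]; exact hlt.le
    · exact (heq y hy).le
  have h2 : ∑ y ∈ mem τ', w' y = ∑ y ∈ mem τ', w y :=
    Finset.sum_congr rfl fun y hy => (heq y (by rintro rfl; exact hxτ' hy)).symm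
  have h3 := hτ' σ
  have h4 := hτ τ'
  have h5 := hσ τ
  omega

omit [Finite Ω] [Nonempty Ω] [Fintype ι] in
-- In an ambiguous table the residue modulo `R` of the word at `x` is determined by the rest.
-- Overwriting it with an arbitrary residue `c` thus maps pairs of ambiguous table and `c`
-- injectively to tables; R ∣ W keeps the new word in range.
theorem card_ambiguous_mul_le (mem : Ω → Finset ι) (b : ι → ℕ) {emb : ι → Fin W}
    (hemb : Function.Injective emb) {R : ℕ} (hR : 0 < R) (hRW : R ∣ W) (x : ι) :
    Nat.card {ω : Fin W → Fin W // Ambiguous mem (randomWeight b emb R ω) x} * R ≤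
      Nat.card (Fin W → Fin W) := by
  have hlt : ∀ (v : Fin W) (c : Fin R), (v : ℕ) / R * R + c < W := by
    intro v c
    obtain ⟨q, rfl⟩ := hRW
    have h1 : (v : ℕ) / R < q := Nat.div_lt_of_lt_mul v.2
    have := c.2
    nlinarith
  suffices Nat.card ({ω : Fin W → Fin W // Ambiguous mem (randomWeight b emb R ω) x} × Fin R) ≤
      Nat.card (Fin W → Fin W) by
    rwa [Nat.card_prod, Nat.card_fin] at this
  refine Nat.card_le_card_of_injective (fun p => Function.update p.1.1 (emb x)
    ⟨(p.1.1 (emb x) : ℕ) / R * R + p.2, hlt _ _⟩) ?_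
  rintro ⟨⟨ω, hω⟩, c⟩ ⟨⟨ω', hω'⟩, c'⟩ h
  dsimp only at h
  have hoff : ∀ z, z ≠ emb x → ω z = ω' z := by
    intro z hz
    have := congrFun h z
    rwa [Function.update_of_ne hz, Function.update_of_ne hz] at this
  have hx := congrArg Fin.val (congrFun h (emb x))
  rw [Function.update_self, Function.update_self] at hx
  dsimp only at hx
  have hw : ∀ y, y ≠ x → randomWeight b emb R ω y = randomWeight b emb R ω' y := by
    intro y hy
    rw [randomWeight, randomWeight, hoff _ fun e => hy (hemb e)]
  have h1 := hω.le hω' hw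
  have h2 := hω'.le hω fun y hy => (hw y hy).symm
  have hmod : (ω (emb x) : ℕ) % R = (ω' (emb x) : ℕ) % R := by
    unfold randomWeight at h1 h2
    omega
  have hd : (ω (emb x) : ℕ) / R = (ω' (emb x) : ℕ) / R := by
    have e1 := congrArg (· / R) hx
    simpa [mul_comm _ R, Nat.mul_add_div hR, Nat.div_eq_of_lt c.2, Nat.div_eq_of_lt c'.2] using e1
  have hc : c = c' := by
    rw [hd] at hx
    exact Fin.ext (by omega)
  subst hc
  have hval : ω (emb x) = ω' (emb x) := by
    refine Fin.ext ?_
    rw [← Nat.div_add_mod (ω (emb x) : ℕ) R, ← Nat.div_add_mod (ω' (emb x) : ℕ) R, hd, hmod]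
  have : ω = ω' := by
    funext z
    by_cases hz : z = emb x
    · rw [hz, hval]
    · exact hoff z hz
  subst this
  rfl

/-- The isolation lemma: random weights have a unique heaviest member of the family with high
probability. -/
theorem isolation {mem : Ω → Finset ι} (hinj : Function.Injective mem) (b : ι → ℕ)
    {emb : ι → Fin W} (hemb : Function.Injective emb) {R : ℕ} (hR : 0 < R) (hRW : R ∣ W) :
    Nat.card {ω : Fin W → Fin W // ¬ ∃ σ, ∀ τ, τ ≠ σ →
      ∑ y ∈ mem τ, randomWeight b emb R ω y < ∑ y ∈ mem σ, randomWeight b emb R ω y} * R ≤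
      Fintype.card ι * Nat.card (Fin W → Fin W) := by
  classical
  have h1 : Nat.card {ω : Fin W → Fin W // ¬ ∃ σ, ∀ τ, τ ≠ σ →
      ∑ y ∈ mem τ, randomWeight b emb R ω y < ∑ y ∈ mem σ, randomWeight b emb R ω y} ≤
      ∑ x, Nat.card {ω : Fin W → Fin W // Ambiguous mem (randomWeight b emb R ω) x} := by
    rw [← Nat.card_sigma]
    have hex : ∀ ω : {ω : Fin W → Fin W // ¬ ∃ σ, ∀ τ, τ ≠ σ →
      ∑ y ∈ mem τ, randomWeight b emb R ω y < ∑ y ∈ mem σ, randomWeight b emb R ω y},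
        ∃ x, Ambiguous mem (randomWeight b emb R ω) x := fun ω =>
      (exists_isolated_or_ambiguous hinj (randomWeight b emb R ω)).resolve_left ω.2
    choose x hx using hex
    refine Nat.card_le_card_of_injective (fun ω => ⟨x ω, ⟨ω, hx ω⟩⟩) fun ω ω' h => ?_
    have := congrArg (fun p : Σ x, {ω : Fin W → Fin W //
      Ambiguous mem (randomWeight b emb R ω) x} => p.2.1) h
    exact Subtype.ext this
  calc _ ≤ (∑ x, Nat.card {ω : Fin W → Fin W // Ambiguous mem (randomWeight b emb R ω) x}) * R :=
        Nat.mul_le_mul_right R h1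
    _ = ∑ x, Nat.card {ω : Fin W → Fin W // Ambiguous mem (randomWeight b emb R ω) x} * R :=
        Finset.sum_mul _ _ _
    _ ≤ ∑ _x : ι, Nat.card (Fin W → Fin W) :=
        Finset.sum_le_sum fun x _ => card_ambiguous_mul_le mem b hemb hR hRW x
    _ = _ := by simp

end Isolation

/-! ### Augmenting paths in permutations. -/

section Augmentation

variable {α : Type*} [Fintype α] [DecidableEq α]

open Classical in
/-- The number of edges in a permutation of the columns. -/
noncomputable def edgeCount (edge : α → α → Prop) (σ : Equiv.Perm α) : ℕ :=
  ∑ s, if edge (σ s) s then 1 else 0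

open Classical in
theorem edgeCount_mul_swap (edge : α → α → Prop) (σ : Equiv.Perm α) {a b : α} (hab : a ≠ b) :
    edgeCount edge (σ * Equiv.swap a b) + (if edge (σ a) a then 1 else 0) +
      (if edge (σ b) b then 1 else 0) = edgeCount edge σ + (if edge (σ b) a then 1 else 0) +
      (if edge (σ a) b then 1 else 0) := by
  have hb : b ∈ Finset.univ.erase a := Finset.mem_erase.2 ⟨hab.symm, Finset.mem_univ b⟩
  have key : ∀ f : α → ℕ, ∑ s, f s = f a + (f b + ∑ s ∈ (Finset.univ.erase a).erase b, f s) := by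
    intro f
    rw [Finset.add_sum_erase _ _ hb, Finset.add_sum_erase _ _ (Finset.mem_univ a)]
  rw [edgeCount, edgeCount, key, key fun s => if edge (σ s) s then 1 else 0]
  have hrest : ∑ s ∈ (Finset.univ.erase a).erase b,
      (if edge ((σ * Equiv.swap a b) s) s then 1 else 0) =
      ∑ s ∈ (Finset.univ.erase a).erase b, if edge (σ s) s then 1 else 0 := by
    refine Finset.sum_congr rfl fun s hs => ?_
    simp only [Finset.mem_erase, Finset.mem_univ, and_true] at hs
    rw [Equiv.Perm.mul_apply, Equiv.swap_apply_of_ne_of_ne hs.2 hs.1]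
  rw [hrest]
  simp only [Equiv.Perm.mul_apply, Equiv.swap_apply_left, Equiv.swap_apply_right]
  omega

/-- The rows that alternating paths with at most `k` edges of the matching reach from the
unmatched rows. -/
def rowReach (edge : α → α → Prop) (σ : Equiv.Perm α) : ℕ → α → Prop
  | 0, i => ¬ edge i (σ.symm i)
  | k + 1, i => rowReach edge σ k i ∨
      ∃ i', rowReach edge σ k i' ∧ ∃ s, edge i' s ∧ σ s = i ∧ edge i s

/-- An augmenting path leads to a permutation with more edges. -/
theorem exists_edgeCount_lt (edge : α → α → Prop) : ∀ (k : ℕ) (σ : Equiv.Perm α) (i s : α),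
    rowReach edge σ k i → edge i s → ¬ edge (σ s) s → ∃ τ, edgeCount edge σ < edgeCount edge τ := by
  intro k
  induction k with
  | zero =>
    intro σ i s hi his hs
    have hi' : ¬ edge i (σ.symm i) := hi
    have hne : σ.symm i ≠ s := by
      rintro rfl
      exact hi' his
    have h := edgeCount_mul_swap edge σ hne
    refine ⟨σ * Equiv.swap (σ.symm i) s, ?_⟩
    rw [Equiv.apply_symm_apply, if_neg hi', if_neg hs, if_pos his] at h
    omega
  | succ k ih =>
    intro σ i s hi his hs
    by_cases hik : rowReach edge σ k i
    · exact ih σ i s hik his hs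
    -- The row σ s₁ moves to the column `s`. Either this already gains an edge, or the count is
    -- unchanged and the column s₁, now without an edge, ends an augmenting path shorter by one
    -- matched edge.
    obtain ⟨i', hi', s₁, h1, rfl, h2⟩ := hi.resolve_left hik
    have hne : s₁ ≠ s := by
      rintro rfl
      exact hs h2
    have h := edgeCount_mul_swap edge σ hne
    rw [if_pos h2, if_neg hs, if_pos his] at h
    by_cases hj : edge (σ s) s₁
    · refine ⟨σ * Equiv.swap s₁ s, ?_⟩
      rw [if_pos hj] at h
      omega
    rw [if_neg hj] at h
    have hval1 : (σ * Equiv.swap s₁ s) s₁ = σ s := by simp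
    -- Earlier rows remain reachable, for an alternating path through s₁ within `k` rounds would
    -- contradict `hik`.
    have hmono : ∀ m ≤ k, ∀ a, rowReach edge σ m a → rowReach edge (σ * Equiv.swap s₁ s) m a := by
      intro m
      induction m with
      | zero =>
        intro _ a ha
        have ha' : ¬ edge a (σ.symm a) := ha
        change ¬ edge a ((σ * Equiv.swap s₁ s).symm a)
        obtain ⟨c, rfl⟩ := σ.surjective a
        rw [Equiv.symm_apply_apply] at ha'
        have hc1 : c ≠ s₁ := by
          rintro rfl
          exact ha' h2
        by_cases hcs : c = s
        · subst hcs
          rw [← hval1, Equiv.symm_apply_apply, hval1]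
          exact hj
        · have : (σ * Equiv.swap s₁ s) c = σ c := by
            rw [Equiv.Perm.mul_apply, Equiv.swap_apply_of_ne_of_ne hc1 hcs]
          rw [← this, Equiv.symm_apply_apply, this]
          exact ha'
      | succ m ihm =>
        intro hm a ha
        rcases ha with ha | ⟨a', ha', s₂, h3, rfl, h4⟩
        · exact .inl (ihm (by omega) a ha)
        · refine .inr ⟨a', ihm (by omega) a' ha', s₂, h3, ?_, h4⟩
          have hc1 : s₂ ≠ s₁ := by
            rintro rfl
            have hle : ∀ p q, p ≤ q → ∀ a, rowReach edge σ p a → rowReach edge σ q a := by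
              intro p q hpq a ha
              induction hpq with
              | refl => exact ha
              | step _ ih => exact .inl ih
            exact hik (hle (m + 1) k hm _ (.inr ⟨a', ha', _, h3, rfl, h4⟩))
          have hc2 : s₂ ≠ s := by
            rintro rfl
            exact hs h4
          rw [Equiv.Perm.mul_apply, Equiv.swap_apply_of_ne_of_ne hc1 hc2]
    obtain ⟨τ, hτ⟩ := ih (σ * Equiv.swap s₁ s) i' s₁ (hmono k le_rfl i' hi') h1
      (by rw [hval1]; exact hj)
    exact ⟨τ, by omega⟩

omit [DecidableEq α] in
open Classical in
/-- If each edge weighs more than everything else, then a heaviest permutation has the maximum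
number of edges. -/
theorem edgeCount_le_of_heaviest [Nonempty α] (edge : α → α → Prop) {w r : α → α → ℕ} {B R : ℕ}
    (hr : ∀ i s, r i s < R) (hB : Fintype.card α * R ≤ B)
    (hw : ∀ i s, w i s = 1 + B * (if edge i s then 1 else 0) + r i s) {σ : Equiv.Perm α}
    (hσ : ∀ τ : Equiv.Perm α, ∑ s, w (τ s) s ≤ ∑ s, w (σ s) s) (τ : Equiv.Perm α) :
    edgeCount edge τ ≤ edgeCount edge σ := by
  have hsum : ∀ τ : Equiv.Perm α, ∑ s, w (τ s) s =
      Fintype.card α + B * edgeCount edge τ + ∑ s, r (τ s) s := by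
    intro τ
    simp only [hw, Finset.sum_add_distrib, edgeCount, Finset.mul_sum]
    simp
  -- All random parts together weigh less than a single edge.
  have hlt : ∑ s, r (σ s) s < B := by
    refine lt_of_lt_of_le ?_ hB
    calc ∑ s, r (σ s) s < ∑ _s : α, R :=
          Finset.sum_lt_sum_of_nonempty Finset.univ_nonempty fun s _ => hr _ _
      _ = _ := by simp
  by_contra hcon
  push Not at hcon
  have h1 := hσ τ
  rw [hsum, hsum] at h1
  have h2 : B * (edgeCount edge σ + 1) ≤ B * edgeCount edge τ := Nat.mul_le_mul_left B hcon
  rw [mul_add, mul_one] at h2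
  omega

end Augmentation

end PVER2HK

/-! ### Semantics and running time of programs. -/

namespace PVER2HK

/-- This identifies an arbitrary halting run with the run constructed by the correctness proof. -/
theorem Exec.deterministic {W : ℕ} {ω : ℕ → ℕ} {P : Prog} {mem mem₁ mem₂ : ℕ → ℕ} {t₁ t₂ : ℕ}
    (h₁ : Exec W ω P mem mem₁ t₁) (h₂ : Exec W ω P mem mem₂ t₂) : mem₁ = mem₂ ∧ t₁ = t₂ := by
  induction h₁ generalizing mem₂ t₂ with
  | par => cases h₂; exact ⟨rfl, rfl⟩
  | seq _ _ ih1 ih2 =>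
    cases h₂ with
    | seq a b =>
      obtain ⟨rfl, rfl⟩ := ih1 a
      obtain ⟨rfl, rfl⟩ := ih2 b
      exact ⟨rfl, rfl⟩
  | cond_true hb _ ih =>
    cases h₂ with
    | cond_true _ a =>
      obtain ⟨rfl, rfl⟩ := ih a
      exact ⟨rfl, rfl⟩
    | cond_false hb' _ => exact absurd hb' hb
  | cond_false hb _ ih =>
    cases h₂ with
    | cond_true hb' _ => exact absurd hb hb'
    | cond_false _ a =>
      obtain ⟨rfl, rfl⟩ := ih a
      exact ⟨rfl, rfl⟩
  | loop_false hb =>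
    cases h₂ with
    | loop_false => exact ⟨rfl, rfl⟩
    | loop_true hb' _ _ => exact absurd hb hb'
  | loop_true hb _ _ ih1 ih2 =>
    cases h₂ with
    | loop_false hb' => exact absurd hb' hb
    | loop_true _ a b =>
      obtain ⟨rfl, rfl⟩ := ih1 a
      obtain ⟨rfl, rfl⟩ := ih2 b
      exact ⟨rfl, rfl⟩

namespace Prog

/-- A bound on the running time if each loop has at most `J` iterations. -/
def time (J : ℕ) : Prog → ℕ
  | par g a v => g.cost + a.cost + v.cost + 1
  | seq p q => p.time J + q.time J
  | cond b p q => b.cost + p.time J + q.time J + 1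
  | loop b p => (J + 1) * (b.cost + p.time J + 1)

/-- The nesting depth of the loops. -/
def depth : Prog → ℕ
  | par _ _ _ => 0
  | seq p q | cond _ p q => max p.depth q.depth
  | loop _ p => p.depth + 1

/-- Each level of nesting costs a factor J + 1, so the exponent is the loop depth. -/
theorem exists_time_le : ∀ P : Prog, ∃ κ, ∀ J, P.time J ≤ κ * (J + 1) ^ P.depth
  | par g a v => ⟨g.cost + a.cost + v.cost + 1, fun J => by simp [time, depth]⟩
  | seq p q => by
    obtain ⟨κ₁, h₁⟩ := p.exists_time_le
    obtain ⟨κ₂, h₂⟩ := q.exists_time_le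
    refine ⟨κ₁ + κ₂, fun J => ?_⟩
    have e1 : (J + 1) ^ p.depth ≤ (J + 1) ^ max p.depth q.depth :=
      Nat.pow_le_pow_right J.succ_pos (le_max_left _ _)
    have e2 : (J + 1) ^ q.depth ≤ (J + 1) ^ max p.depth q.depth :=
      Nat.pow_le_pow_right J.succ_pos (le_max_right _ _)
    rw [time, depth, add_mul]
    exact add_le_add ((h₁ J).trans (Nat.mul_le_mul_left _ e1))
      ((h₂ J).trans (Nat.mul_le_mul_left _ e2))
  | cond b p q => by
    obtain ⟨κ₁, h₁⟩ := p.exists_time_le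
    obtain ⟨κ₂, h₂⟩ := q.exists_time_le
    refine ⟨(b.cost + 1) + (κ₁ + κ₂), fun J => ?_⟩
    have e1 : (J + 1) ^ p.depth ≤ (J + 1) ^ max p.depth q.depth :=
      Nat.pow_le_pow_right J.succ_pos (le_max_left _ _)
    have e2 : (J + 1) ^ q.depth ≤ (J + 1) ^ max p.depth q.depth :=
      Nat.pow_le_pow_right J.succ_pos (le_max_right _ _)
    have e3 : 1 ≤ (J + 1) ^ max p.depth q.depth := Nat.one_le_pow _ _ J.succ_pos
    have h3 := (h₁ J).trans (Nat.mul_le_mul_left _ e1)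
    have h4 := (h₂ J).trans (Nat.mul_le_mul_left _ e2)
    have h5 := Nat.mul_le_mul_left (b.cost + 1) e3
    have h6 := add_mul κ₁ κ₂ ((J + 1) ^ max p.depth q.depth)
    rw [time, depth, add_mul]
    omega
  | loop b p => by
    obtain ⟨κ, h⟩ := p.exists_time_le
    refine ⟨b.cost + 1 + κ, fun J => ?_⟩
    have e3 : 1 ≤ (J + 1) ^ p.depth := Nat.one_le_pow _ _ J.succ_pos
    have h5 := Nat.mul_le_mul_left (b.cost + 1) e3
    have h6 := h J
    rw [time, depth, pow_succ, ← mul_assoc, mul_comm (J + 1)]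
    refine Nat.mul_le_mul_right _ ?_
    rw [add_mul]
    omega

end Prog

/-! ### Arrays -/

/-- The memory, seen as arrays of `N ^ 53` words with numbers below `32`. -/
def Rep (N : ℕ) (mem : ℕ → ℕ) (σ : ℕ → ℕ → ℕ) : Prop :=
  2 ≤ N ∧ σ 0 0 = N ∧ ∀ tag < 32, ∀ i < N ^ 53, mem (tag * N ^ 53 + i) = σ tag i

/-- The expression `e` has the value `x` for processor `p`. -/
def Ev (N : ℕ) (ω : ℕ → ℕ) (σ : ℕ → ℕ → ℕ) (p : ℕ) (e : Expr) (x : ℕ) : Prop :=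
  ∀ mem, Rep N mem σ → e.eval (N ^ 58) ω mem p = x

/-- The expression `e` is nonzero for processor `p` if and only if `G` holds. -/
def Gd (N : ℕ) (ω : ℕ → ℕ) (σ : ℕ → ℕ → ℕ) (p : ℕ) (e : Expr) (G : Prop) : Prop :=
  ∀ mem, Rep N mem σ → (e.eval (N ^ 58) ω mem p ≠ 0 ↔ G)

namespace Expr

/-- The power `N ^ k`. -/
def pw : ℕ → Expr
  | 0 => const 1
  | k + 1 => mul (pw k) (load (const 0))

/-- The word `e` of the array `tag`. -/
def ld (tag : ℕ) (e : Expr) : Expr := load (add (mul (const tag) (pw 53)) e)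

/-- The number formed from the digits of `p` in base `N` with the positions `a, …, a + b - 1`. -/
def dg (a b : ℕ) : Expr := mod (div pid (pw a)) (pw b)

/-- Index of the entry `(e, e')` of a matrix with rows of length `N ^ a`. -/
def ix (a : ℕ) (e e' : Expr) : Expr := add (mul e (pw a)) e'

def bool (e : Expr) : Expr := lt (const 0) e

def and (a b : Expr) : Expr := mul a.bool b.bool

def not (a : Expr) : Expr := eq a (const 0)

def or (a b : Expr) : Expr := (a.not.and b.not).not

def le (a b : Expr) : Expr := (lt b a).not

/-- The value of `v` if `g` is nonzero, and zero otherwise. -/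
def guard (g v : Expr) : Expr := mul g.bool v

end Expr

section Evaluation

variable {N : ℕ} {ω : ℕ → ℕ} {σ : ℕ → ℕ → ℕ} {p x y : ℕ} {a b : Expr} {G H : Prop}

theorem two_pow_le_pow (hN : 2 ≤ N) (k : ℕ) : 2 ^ k ≤ N ^ k := Nat.pow_le_pow_left hN k

theorem Ev.const (k : ℕ) (hk : k < 2 ^ 58) : Ev N ω σ p (.const k) k := fun _ hr =>
  Nat.mod_eq_of_lt (hk.trans_le (two_pow_le_pow hr.1 58))

theorem Ev.pid : Ev N ω σ p .pid p := fun _ _ => rfl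

theorem Ev.rand (ha : Ev N ω σ p a x) : Ev N ω σ p (.rand a) (ω x) := fun mem hr => by
  rw [Expr.eval, ha mem hr]

theorem Ev.add (ha : Ev N ω σ p a x) (hb : Ev N ω σ p b y) (h : x + y < N ^ 58) :
    Ev N ω σ p (.add a b) (x + y) := fun mem hr => by
  rw [Expr.eval, ha mem hr, hb mem hr, Nat.mod_eq_of_lt h]

theorem Ev.mul (ha : Ev N ω σ p a x) (hb : Ev N ω σ p b y) (h : x * y < N ^ 58) :
    Ev N ω σ p (.mul a b) (x * y) := fun mem hr => by
  rw [Expr.eval, ha mem hr, hb mem hr, Nat.mod_eq_of_lt h]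

theorem Ev.sub (ha : Ev N ω σ p a x) (hb : Ev N ω σ p b y) :
    Ev N ω σ p (.sub a b) (x - y) := fun mem hr => by
  rw [Expr.eval, ha mem hr, hb mem hr]

theorem Ev.div (ha : Ev N ω σ p a x) (hb : Ev N ω σ p b y) :
    Ev N ω σ p (.div a b) (x / y) := fun mem hr => by
  rw [Expr.eval, ha mem hr, hb mem hr]

theorem Ev.mod (ha : Ev N ω σ p a x) (hb : Ev N ω σ p b y) :
    Ev N ω σ p (.mod a b) (x % y) := fun mem hr => by
  rw [Expr.eval, ha mem hr, hb mem hr]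

theorem pow_lt_pow_of_two_le (hN : 2 ≤ N) {k l : ℕ} (h : k < l) : N ^ k < N ^ l :=
  Nat.pow_lt_pow_right hN h

/-- Cell 0 holds `N`, so one fixed program computes all the sizes it needs from it. -/
theorem Ev.pw : ∀ k < 58, Ev N ω σ p (.pw k) (N ^ k)
  | 0, _ => fun mem hr => by
    rw [Expr.pw, pow_zero]
    exact Ev.const 1 (by norm_num) mem hr
  | k + 1, hk => fun mem hr => by
    have h0 : mem 0 = N := by
      have := hr.2.2 0 (by norm_num) 0 (pow_pos (by have := hr.1; omega) 53)
      rw [zero_mul] at this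
      rw [← hr.2.1, ← this]
    rw [Expr.pw, Expr.eval, Ev.pw k (by omega) mem hr, Expr.eval,
      Ev.const (p := p) 0 (by norm_num) mem hr, h0, ← pow_succ,
      Nat.mod_eq_of_lt (pow_lt_pow_of_two_le hr.1 hk)]

/-- The 32 ≤ N^5 arrays of N^53 words fit into the word range N^58. -/
theorem array_bound (hN : 2 ≤ N) {tag : ℕ} (ht : tag < 32) (hx : x < N ^ 53) :
    tag * N ^ 53 + x < N ^ 58 := by
  have h1 : (tag + 1) * N ^ 53 ≤ N ^ 5 * N ^ 53 :=
    Nat.mul_le_mul_right _ ((show tag + 1 ≤ 2 ^ 5 by omega).trans (two_pow_le_pow hN 5))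
  rw [← pow_add, add_mul, one_mul] at h1
  norm_num at h1
  omega

theorem Ev.address {tag : ℕ} (ht : tag < 32) (ha : Ev N ω σ p a x) (hx : x < N ^ 53) :
    Ev N ω σ p (.add (.mul (.const tag) (.pw 53)) a) (tag * N ^ 53 + x) := fun mem hr => by
  have hb := array_bound hr.1 ht hx
  exact Ev.add (Ev.mul (Ev.const tag (by omega)) (Ev.pw 53 (by norm_num)) (by omega)) ha hb mem hr

theorem Ev.ld {tag : ℕ} (ht : tag < 32) (ha : Ev N ω σ p a x) (hx : x < N ^ 53) :
    Ev N ω σ p (.ld tag a) (σ tag x) := fun mem hr => by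
  rw [Expr.ld, Expr.eval, Ev.address ht ha hx mem hr, hr.2.2 tag ht x hx]

theorem Ev.dg {k l : ℕ} (hk : k < 58) (hl : l < 58) :
    Ev N ω σ p (.dg k l) (p / N ^ k % N ^ l) :=
  Ev.mod (Ev.div Ev.pid (Ev.pw k hk)) (Ev.pw l hl)

theorem mul_pow_add_lt {k l : ℕ} (hx : x < N ^ k) (hy : y < N ^ l) :
    x * N ^ l + y < N ^ (k + l) := by
  rw [pow_add]
  have : (x + 1) * N ^ l ≤ N ^ k * N ^ l := Nat.mul_le_mul_right _ hx
  rw [add_mul, one_mul] at this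
  omega

theorem Ev.ix {k l : ℕ} (ha : Ev N ω σ p a x) (hb : Ev N ω σ p b y) (hx : x < N ^ k)
    (hy : y < N ^ l) (h : k + l ≤ 57) : Ev N ω σ p (.ix l a b) (x * N ^ l + y) := fun mem hr => by
  have h1 := (mul_pow_add_lt hx hy).trans_le (Nat.pow_le_pow_right (by have := hr.1; omega)
    (show k + l ≤ 58 by omega))
  exact Ev.add (Ev.mul ha (Ev.pw l (by omega)) (by omega)) hb h1 mem hr

theorem Gd.nonzero (ha : Ev N ω σ p a x) : Gd N ω σ p a (x ≠ 0) := fun mem hr => by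
  rw [ha mem hr]

theorem Gd.lt (ha : Ev N ω σ p a x) (hb : Ev N ω σ p b y) :
    Gd N ω σ p (.lt a b) (x < y) := fun mem hr => by
  rw [Expr.eval, ha mem hr, hb mem hr]
  simp

theorem Gd.eq (ha : Ev N ω σ p a x) (hb : Ev N ω σ p b y) :
    Gd N ω σ p (.eq a b) (x = y) := fun mem hr => by
  rw [Expr.eval, ha mem hr, hb mem hr]
  simp

theorem Gd.not (ha : Gd N ω σ p a G) : Gd N ω σ p a.not (¬ G) := fun mem hr => by
  rw [Expr.not, Expr.eval, Ev.const (p := p) 0 (by norm_num) mem hr, ← ha mem hr]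
  simp

open Classical in
theorem Ev.bool (ha : Gd N ω σ p a G) : Ev N ω σ p a.bool (if G then 1 else 0) := fun mem hr => by
  rw [Expr.bool, Expr.eval, Ev.const (p := p) 0 (by norm_num) mem hr]
  have := ha mem hr
  by_cases hG : G <;> simp [hG] at this ⊢ <;> omega

theorem one_lt_words (hN : 2 ≤ N) : 1 < N ^ 58 :=
  lt_of_lt_of_le (by norm_num) (two_pow_le_pow hN 58)

/-- The second guard needs a meaning only where the first holds, because a zero factor hides any
value. Bounds checked first thus protect later array accesses. -/
theorem Gd.and (ha : Gd N ω σ p a G) (hb : G → Gd N ω σ p b H) :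
    Gd N ω σ p (a.and b) (G ∧ H) := fun mem hr => by
  classical
  rw [Expr.and, Expr.eval, Ev.bool ha mem hr]
  by_cases hG : G
  · rw [Ev.bool (hb hG) mem hr, if_pos hG]
    by_cases hH : H
    · simp [hG, hH, Nat.mod_eq_of_lt (one_lt_words hr.1)]
    · simp [hH]
  · simp [hG]

theorem Gd.or (ha : Gd N ω σ p a G) (hb : Gd N ω σ p b H) :
    Gd N ω σ p (a.or b) (G ∨ H) := fun mem hr => by
  rw [Expr.or, (ha.not.and fun _ => hb.not).not mem hr]
  tauto

theorem Gd.le (ha : Ev N ω σ p a x) (hb : Ev N ω σ p b y) :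
    Gd N ω σ p (a.le b) (x ≤ y) := fun mem hr => by
  rw [Expr.le, (Gd.lt hb ha).not mem hr, not_lt]

theorem Gd.congr (ha : Gd N ω σ p a G) (h : G ↔ H) : Gd N ω σ p a H := fun mem hr =>
  (ha mem hr).trans h

theorem Ev.guard [Decidable G] (ha : Gd N ω σ p a G) (hb : G → Ev N ω σ p b x) (hx : G → x < N ^ 58) :
    Ev N ω σ p (a.guard b) (if G then x else 0) := fun mem hr => by
  rw [Expr.guard, Expr.eval, Ev.bool ha mem hr]
  by_cases hG : G
  · simp [hG, hb hG mem hr, Nat.mod_eq_of_lt (hx hG)]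
  · simp [hG]

end Evaluation

/-! ### Program steps -/

/-- The processors `p < N ^ 53` with nonzero `g` write `v` to the cell `h` of the array `tag`. -/
def Prog.put (tag : ℕ) (g h v : Expr) : Prog :=
  .par ((Expr.lt .pid (.pw 53)).and g) (.add (.mul (.const tag) (.pw 53)) h) v

/-- Starting from the arrays `σ`, the program `P` halts with arrays that satisfy `Post`. -/
def Trans (N : ℕ) (ω : ℕ → ℕ) (J : ℕ) (P : Prog) (σ : ℕ → ℕ → ℕ) (Post : (ℕ → ℕ → ℕ) → Prop) :
    Prop :=
  ∀ mem, Rep N mem σ → ∃ mem' t σ', Exec (N ^ 58) ω P mem mem' t ∧ t ≤ P.time J ∧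
    Rep N mem' σ' ∧ Post σ'

section Steps

variable {N : ℕ} {ω : ℕ → ℕ} {J : ℕ} {σ : ℕ → ℕ → ℕ}

theorem Trans.mono {P : Prog} {Post Post' : (ℕ → ℕ → ℕ) → Prop} (h : Trans N ω J P σ Post)
    (hp : ∀ σ', Post σ' → Post' σ') : Trans N ω J P σ Post' := fun mem hr => by
  obtain ⟨mem', t, σ', h1, h2, h3, h4⟩ := h mem hr
  exact ⟨mem', t, σ', h1, h2, h3, hp σ' h4⟩

theorem Trans.seq {P P' : Prog} {Post Post' : (ℕ → ℕ → ℕ) → Prop} (h : Trans N ω J P σ Post)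
    (h' : ∀ σ', Post σ' → Trans N ω J P' σ' Post') : Trans N ω J (.seq P P') σ Post' :=
  fun mem hr => by
  obtain ⟨mem', t, σ', h1, h2, h3, h4⟩ := h mem hr
  obtain ⟨mem'', t', σ'', h1', h2', h3', h4'⟩ := h' σ' h4 mem' h3
  exact ⟨mem'', t + t', σ'', .seq h1 h1', add_le_add h2 h2', h3', h4'⟩

open Classical in
-- The function `U` of the cell makes all processors that write to the same cell agree, so the
-- priority rule plays no role.
theorem Trans.put {tag : ℕ} (ht : tag < 32) (ht0 : tag ≠ 0) {g h v : Expr} {G : ℕ → Prop}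
    {H V U : ℕ → ℕ} (hg : ∀ p < N ^ 53, Gd N ω σ p g (G p))
    (hh : ∀ p < N ^ 53, G p → Ev N ω σ p h (H p)) (hH : ∀ p < N ^ 53, G p → H p < N ^ 53)
    (hv : ∀ p < N ^ 53, G p → Ev N ω σ p v (V p)) (hU : ∀ p < N ^ 53, G p → V p = U (H p)) :
    Trans N ω J (.put tag g h v) σ fun σ' => σ' = Function.update σ tag fun x =>
      if ∃ p < N ^ 53, G p ∧ H p = x then U x else σ tag x := by
  intro mem hr
  refine ⟨_, _, _, .par _ _ _ _, le_rfl, ⟨hr.1, ?_, ?_⟩, rfl⟩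
  · rw [Function.update_of_ne ht0.symm, hr.2.1]
  intro tag' ht' i hi
  have hN := hr.1
  have hQ : N ^ 53 < N ^ 58 := pow_lt_pow_of_two_le hN (by norm_num)
  have hguard : ∀ p, ((Expr.lt .pid (.pw 53)).and g).eval (N ^ 58) ω mem p ≠ 0 ↔
      p < N ^ 53 ∧ G p := fun p =>
    Gd.and (Gd.lt Ev.pid (Ev.pw 53 (by norm_num))) (fun hp => hg p hp) mem hr
  have haddr : ∀ p < N ^ 53, G p → (Expr.add (.mul (.const tag) (.pw 53)) h).eval
      (N ^ 58) ω mem p = tag * N ^ 53 + H p := fun p hp hG =>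
    Ev.address ht (hh p hp hG) (hH p hp hG) mem hr
  have hinj : ∀ x < N ^ 53, tag * N ^ 53 + x = tag' * N ^ 53 + i → tag = tag' ∧ x = i := by
    intro x hx he
    have h1 := congrArg (· / N ^ 53) he
    have h2 := congrArg (· % N ^ 53) he
    have hpos : 0 < N ^ 53 := by omega
    simp only [mul_comm _ (N ^ 53), Nat.mul_add_div hpos, Nat.div_eq_of_lt hx, Nat.div_eq_of_lt hi,
      Nat.mul_add_mod, Nat.mod_eq_of_lt hx, Nat.mod_eq_of_lt hi, add_zero] at h1 h2
    exact ⟨h1, h2⟩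
  unfold parWrite
  split_ifs with hex
  · obtain ⟨hp1, hp2, hp3⟩ := Nat.find_spec hex
    obtain ⟨hp4, hp5⟩ := (hguard _).1 hp2
    rw [haddr _ hp4 hp5] at hp3
    obtain ⟨rfl, hi'⟩ := hinj _ (hH _ hp4 hp5) hp3
    rw [Function.update_self, hv _ hp4 hp5 mem hr, if_pos ⟨_, hp4, hp5, hi'⟩, hU _ hp4 hp5, hi']
  · rw [hr.2.2 tag' ht' i hi]
    by_cases htt : tag' = tag
    · subst htt
      rw [Function.update_self, if_neg]
      rintro ⟨p, hp, hG, rfl⟩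
      exact hex ⟨p, hp.trans hQ, (hguard p).2 ⟨hp, hG⟩, haddr p hp hG⟩
    · rw [Function.update_of_ne htt]

/-- All processors with a nonzero guard write to their own cells. -/
theorem Trans.put_own {tag : ℕ} (ht : tag < 32) (ht0 : tag ≠ 0) {g v : Expr} {G : ℕ → Prop}
    {V : ℕ → ℕ} (hg : ∀ p < N ^ 53, Gd N ω σ p g (G p))
    (hv : ∀ p < N ^ 53, G p → Ev N ω σ p v (V p)) :
    Trans N ω J (.put tag g .pid v) σ fun σ' => (∀ tag', tag' ≠ tag → σ' tag' = σ tag') ∧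
      ∀ x < N ^ 53, (G x → σ' tag x = V x) ∧ (¬ G x → σ' tag x = σ tag x) := by
  refine (Trans.put ht ht0 hg (H := id) (U := V) (fun p _ _ => Ev.pid) (fun p hp _ => hp) hv
    fun _ _ _ => rfl).mono ?_
  rintro σ' rfl
  refine ⟨fun tag' h => Function.update_of_ne h _ _, fun x hx => ?_⟩
  rw [Function.update_self]
  constructor
  · intro h
    rw [if_pos ⟨x, hx, h, rfl⟩]
  · intro h
    rw [if_neg]
    rintro ⟨p, _, hG, rfl⟩
    exact h hG

/-- All processors with a nonzero guard write `1`. -/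
theorem Trans.put_one {tag : ℕ} (ht : tag < 32) (ht0 : tag ≠ 0) {g h : Expr} {G : ℕ → Prop}
    {H : ℕ → ℕ} (hg : ∀ p < N ^ 53, Gd N ω σ p g (G p))
    (hh : ∀ p < N ^ 53, G p → Ev N ω σ p h (H p)) (hH : ∀ p < N ^ 53, G p → H p < N ^ 53) :
    Trans N ω J (.put tag g h (.const 1)) σ fun σ' => (∀ tag', tag' ≠ tag → σ' tag' = σ tag') ∧
      ∀ x, σ' tag x ≠ 0 ↔ (∃ p < N ^ 53, G p ∧ H p = x) ∨ σ tag x ≠ 0 := by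
  refine (Trans.put ht ht0 hg (V := fun _ => 1) (U := fun _ => 1) hh hH
    (fun p _ _ => Ev.const 1 (by norm_num)) fun _ _ _ => rfl).mono ?_
  rintro σ' rfl
  refine ⟨fun tag' h => Function.update_of_ne h _ _, fun x => ?_⟩
  rw [Function.update_self]
  split_ifs with h
  · simp [h]
  · simp [h]

/-- The loop body is executed while a counter, which is doubled each time, is less than `N ^ 16`. -/
def Prog.doubling (ct : ℕ) (P : Prog) : Prog :=
  .seq (.put ct (.eq .pid (.const 0)) .pid (.const 1))
    (.loop (.lt (.ld ct (.const 0)) (.pw 16))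
      (.seq P (.put ct (.eq .pid (.const 0)) .pid (.mul (.const 2) (.ld ct (.const 0))))))

/-- The counter after j rounds is 2 ^ j, so at most `J` rounds occur. `hstab` says that the
invariant ignores the counter, which changes after each body. -/
theorem Trans.doubling {ct : ℕ} (ht : ct < 32) (ht0 : ct ≠ 0) {P : Prog} (hJ : N ^ 16 ≤ 2 ^ J)
    (Inv : ℕ → (ℕ → ℕ → ℕ) → Prop)
    (hstab : ∀ j σ σ', (∀ tag, tag ≠ ct → σ' tag = σ tag) → Inv j σ → Inv j σ')
    (hbody : ∀ j σ, 2 ^ j < N ^ 16 → σ ct 0 = 2 ^ j → Inv j σ →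
      Trans N ω J P σ fun σ' => Inv (j + 1) σ' ∧ σ' ct 0 = 2 ^ j)
    (h0 : Inv 0 σ) :
    Trans N ω J (.doubling ct P) σ fun σ' => ∃ j, N ^ 16 ≤ 2 ^ j ∧ Inv j σ' := by
  refine (Trans.put_own (G := fun p => p = 0) (V := fun _ => 1) ht ht0
    (fun p _ => Gd.eq Ev.pid (Ev.const 0 (by norm_num)))
    fun p _ _ => Ev.const 1 (by norm_num)).seq ?_
  rintro σ₁ ⟨h1, h2⟩ mem hr
  have hpos : 0 < N ^ 53 := pow_pos (by have := hr.1; omega) 53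
  set B : Prog := .seq P (.put ct (.eq .pid (.const 0)) .pid
    (.mul (.const 2) (.ld ct (.const 0)))) with hB
  set b : Expr := .lt (.ld ct (.const 0)) (.pw 16) with hb
  -- Induction on the number m of rounds still allowed.
  have key : ∀ m j, j + m = J → ∀ mem σ, Rep N mem σ → σ ct 0 = 2 ^ j → Inv j σ →
      ∃ mem' t σ', Exec (N ^ 58) ω (.loop b B) mem mem' t ∧
        t ≤ (m + 1) * (b.cost + B.time J + 1) ∧ Rep N mem' σ' ∧ ∃ j, N ^ 16 ≤ 2 ^ j ∧ Inv j σ' := by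
    intro m
    induction m with
    | zero =>
      intro j hj mem σ hr hc hI
      obtain rfl : j = J := by omega
      have hcond := Gd.lt (N := N) (ω := ω) (p := 0) (Ev.ld ht (Ev.const 0 (by norm_num)) hpos)
        (Ev.pw 16 (by norm_num)) mem hr
      rw [hc] at hcond
      refine ⟨mem, _, σ, .loop_false ?_, ?_, hr, j, hJ, hI⟩
      · by_contra hne
        exact absurd (hcond.1 hne) (not_lt.2 hJ)
      · nlinarith
    | succ m ih =>
      intro j hj mem σ hr hc hI
      have hcond := Gd.lt (N := N) (ω := ω) (p := 0) (Ev.ld ht (Ev.const 0 (by norm_num)) hpos)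
        (Ev.pw 16 (by norm_num)) mem hr
      rw [hc] at hcond
      by_cases hlt : 2 ^ j < N ^ 16
      · have hbd : 2 * 2 ^ j < N ^ 58 := by
          have : N ^ 1 * N ^ 16 < N ^ 58 := by
            rw [← pow_add]
            exact pow_lt_pow_of_two_le hr.1 (by norm_num)
          have := hr.1
          nlinarith
        have hstep : Trans N ω J B σ fun σ' => Inv (j + 1) σ' ∧ σ' ct 0 = 2 ^ (j + 1) := by
          refine (hbody j σ hlt hc hI).seq fun σ₂ ⟨hI2, hc2⟩ => ?_
          refine (Trans.put_own (G := fun p => p = 0) (V := fun _ => 2 * σ₂ ct 0) ht ht0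
            (fun p _ => Gd.eq Ev.pid (Ev.const 0 (by norm_num)))
            fun p _ _ => Ev.mul (Ev.const 2 (by norm_num))
              (Ev.ld ht (Ev.const 0 (by norm_num)) hpos) (by rw [hc2]; exact hbd)).mono ?_
          rintro σ₃ ⟨h3, h4⟩
          refine ⟨hstab _ _ _ h3 hI2, ?_⟩
          rw [(h4 0 hpos).1 rfl, hc2, pow_succ, mul_comm]
        obtain ⟨mem', t, σ', e1, e2, e3, e4, e5⟩ := hstep mem hr
        obtain ⟨mem'', t', σ'', f1, f2, f3, f4⟩ := ih (j + 1) (by omega) mem' σ' e3 e5 e4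
        refine ⟨mem'', _, σ'', .loop_true (hcond.2 hlt) e1 f1, ?_, f3, f4⟩
        rw [add_mul (m + 1)]
        omega
      · refine ⟨mem, _, σ, .loop_false ?_, ?_, hr, j, not_lt.1 hlt, hI⟩
        · by_contra hne
          exact absurd (hcond.1 hne) hlt
        · nlinarith
  obtain ⟨mem', t, σ', e1, e2, e3, e4⟩ := key J 0 (zero_add J) mem σ₁ hr ((h2 0 hpos).1 rfl)
    (hstab _ _ _ h1 h0)
  exact ⟨mem', t, σ', e1, e2, e3, e4⟩

/-! ### Sums -/

/-- The sums of `f` over blocks of length `N ^ 16` are written to the array `tag`. -/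
def Prog.sum (tag : ℕ) (f : Expr) : Prog :=
  .seq (.put 5 (.const 1) .pid f) <|
  .seq (.doubling 1 (.put 5 (.lt (.add (.dg 0 16) (.ld 1 (.const 0))) (.pw 16)) .pid
    (.add (.ld 5 .pid) (.ld 5 (.add .pid (.ld 1 (.const 0))))))) <|
  .put tag (.lt .pid (.pw 37)) .pid (.ld 5 (.mul .pid (.pw 16)))

/-- All processors double the length of their partial sums at once by adding the partial sum that
starts 2 ^ j places later. The bound on `F` excludes overflow. -/
theorem Trans.sum {tag : ℕ} (ht : tag < 32) (ht0 : tag ≠ 0)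
    (hN : 2 ≤ N) (hJ : N ^ 16 ≤ 2 ^ J) {f : Expr} {F : ℕ → ℕ}
    (hf : ∀ p < N ^ 53, Ev N ω σ p f (F p)) (hF : ∀ p < N ^ 53, F p ≤ N ^ 16) :
    Trans N ω J (.sum tag f) σ fun σ' => (∀ t, t ≠ 1 → t ≠ 5 → t ≠ tag → σ' t = σ t) ∧
      ∀ x < N ^ 37, σ' tag x = ∑ c ∈ Finset.range (N ^ 16), F (x * N ^ 16 + c) := by
  have hQ : N ^ 53 < N ^ 58 := pow_lt_pow_of_two_le hN (by norm_num)
  have hpos : 0 < N ^ 53 := pow_pos (by omega) 53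
  have hLpos : 0 < N ^ 16 := pow_pos (by omega) 16
  have hLQ : N ^ 16 < N ^ 53 := pow_lt_pow_of_two_le hN (by norm_num)
  have hL2 : N ^ 16 * N ^ 16 * 2 ≤ N ^ 53 := by
    calc N ^ 16 * N ^ 16 * 2 ≤ N ^ 16 * N ^ 16 * N ^ 21 := Nat.mul_le_mul_left _
          ((show 2 ≤ 2 ^ 21 by norm_num).trans (two_pow_le_pow hN 21))
      _ = N ^ 53 := by rw [← pow_add, ← pow_add]
  have hmodL : N ^ 53 = N ^ 37 * N ^ 16 := by rw [← pow_add]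
  refine (Trans.put_own (G := fun _ => True) (V := F) (by norm_num) (by norm_num)
    (fun p _ => (Gd.nonzero (Ev.const 1 (by norm_num))).congr (by simp))
    fun p hp _ => hf p hp).seq ?_
  rintro σ₁ ⟨h1, h2⟩
  -- The sum of 2 ^ j consecutive terms from `p`, cut off at the end of the block of `p`; at a
  -- multiple of N^16 it finally is the full block sum.
  let part : ℕ → ℕ → ℕ := fun j p =>
    ∑ c ∈ Finset.range (min (2 ^ j) (N ^ 16 - p % N ^ 16)), F (p + c)
  have hbound : ∀ p c, p < N ^ 53 → c < N ^ 16 - p % N ^ 16 → p + c < N ^ 53 := by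
    intro p c hp hc
    have e1 := Nat.div_add_mod' p (N ^ 16)
    have e2 : p / N ^ 16 < N ^ 37 := Nat.div_lt_of_lt_mul (by rw [mul_comm, ← hmodL]; exact hp)
    have e3 : (p / N ^ 16 + 1) * N ^ 16 ≤ N ^ 37 * N ^ 16 := Nat.mul_le_mul_right _ e2
    rw [add_mul, one_mul] at e3
    omega
  have hpart : ∀ j p, p < N ^ 53 → part j p ≤ N ^ 16 * N ^ 16 := by
    intro j p hp
    calc part j p ≤ ∑ c ∈ Finset.range (min (2 ^ j) (N ^ 16 - p % N ^ 16)), N ^ 16 := by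
          refine Finset.sum_le_sum fun c hc => hF _ (hbound p c hp ?_)
          have := Finset.mem_range.1 hc
          omega
      _ ≤ N ^ 16 * N ^ 16 := by
          rw [Finset.sum_const, Finset.card_range, smul_eq_mul]
          exact Nat.mul_le_mul_right _ ((min_le_right _ _).trans (Nat.sub_le _ _))
  refine (Trans.doubling (ct := 1) (by norm_num) (by norm_num) hJ (fun j σ' =>
    (∀ t, t ≠ 1 → t ≠ 5 → σ' t = σ t) ∧ ∀ p < N ^ 53, σ' 5 p = part j p) ?_ ?_ ?_).seq ?_
  · rintro j σ₂ σ₃ h ⟨h3, h4⟩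
    refine ⟨fun t ht1 ht5 => (h t ht1).trans (h3 t ht1 ht5), fun p hp => ?_⟩
    rw [h 5 (by norm_num), h4 p hp]
  · rintro j σ₂ hj hc ⟨h3, h4⟩
    have hcnt : ∀ p, Ev N ω σ₂ p (.ld 1 (.const 0)) (2 ^ j) := fun p => by
      rw [← hc]
      exact Ev.ld (by norm_num) (Ev.const 0 (by norm_num)) hpos
    have hdg : ∀ p, Ev N ω σ₂ p (.dg 0 16) (p % N ^ 16) := fun p => by
      have := Ev.dg (N := N) (ω := ω) (σ := σ₂) (p := p) (k := 0) (l := 16) (by norm_num)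
        (by norm_num)
      rwa [pow_zero, Nat.div_one] at this
    refine (Trans.put_own (G := fun p => p % N ^ 16 + 2 ^ j < N ^ 16)
      (V := fun p => part j p + part j (p + 2 ^ j)) (by norm_num) (by norm_num) ?_ ?_).mono ?_
    · intro p hp
      have := Nat.mod_lt p hLpos
      have := Nat.le_mul_self (N ^ 16)
      exact Gd.lt (Ev.add (hdg p) (hcnt p) (by omega)) (Ev.pw 16 (by norm_num))
    · intro p hp hG
      replace hG : p % N ^ 16 + 2 ^ j < N ^ 16 := hG
      have hp' : p + 2 ^ j < N ^ 53 := hbound p _ hp (by omega)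
      rw [← h4 p hp, ← h4 _ hp']
      refine Ev.add (Ev.ld (by norm_num) Ev.pid hp)
        (Ev.ld (by norm_num) (Ev.add Ev.pid (hcnt p) (by omega)) hp') ?_
      rw [h4 p hp, h4 _ hp']
      have := hpart j p hp
      have := hpart j _ hp'
      omega
    · rintro σ₃ ⟨h5, h6⟩
      refine ⟨⟨fun t ht1 ht5 => (h5 t ht5).trans (h3 t ht1 ht5), fun p hp => ?_⟩, ?_⟩
      · have hlt := Nat.mod_lt p hLpos
        by_cases hG : p % N ^ 16 + 2 ^ j < N ^ 16
        · rw [(h6 p hp).1 hG]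
          have hmod : (p + 2 ^ j) % N ^ 16 = p % N ^ 16 + 2 ^ j := by
            rw [Nat.add_mod, Nat.mod_eq_of_lt hj, Nat.mod_eq_of_lt hG]
          have e : min (2 ^ (j + 1)) (N ^ 16 - p % N ^ 16) = min (2 ^ j) (N ^ 16 - p % N ^ 16) +
              min (2 ^ j) (N ^ 16 - (p + 2 ^ j) % N ^ 16) := by
            rw [hmod, pow_succ]
            omega
          simp only [part]
          rw [e, Finset.sum_range_add]
          congr 1
          refine Finset.sum_congr rfl fun c _ => ?_
          congr 1
          omega
        · rw [(h6 p hp).2 hG, h4 p hp]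
          have e : min (2 ^ (j + 1)) (N ^ 16 - p % N ^ 16) =
              min (2 ^ j) (N ^ 16 - p % N ^ 16) := by
            rw [pow_succ]
            omega
          simp only [part]
          rw [e]
      · rw [h5 1 (by norm_num), hc]
  · refine ⟨fun t _ ht5 => h1 t ht5, fun p hp => ?_⟩
    have hlt := Nat.mod_lt p hLpos
    rw [(h2 p hp).1 trivial]
    have e : min (2 ^ 0) (N ^ 16 - p % N ^ 16) = 1 := by
      rw [pow_zero]
      omega
    simp only [part]
    rw [e, Finset.sum_range_one, add_zero]
  · rintro σ₂ ⟨j, hj, h3, h4⟩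
    have hmul : ∀ p, p < N ^ 37 → p * N ^ 16 < N ^ 53 := fun p hp => by
      rw [hmodL]
      exact Nat.mul_lt_mul_of_pos_right hp hLpos
    have h37 : N ^ 37 < N ^ 53 := pow_lt_pow_of_two_le hN (by norm_num)
    refine (Trans.put_own (G := fun p => p < N ^ 37) (V := fun p => σ₂ 5 (p * N ^ 16)) ht ht0
      (fun p _ => Gd.lt Ev.pid (Ev.pw 37 (by norm_num))) fun p hp hG =>
      Ev.ld (by norm_num) (Ev.mul Ev.pid (Ev.pw 16 (by norm_num)) ((hmul p hG).trans hQ))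
        (hmul p hG)).mono ?_
    rintro σ₃ ⟨h5, h6⟩
    refine ⟨fun t ht1 ht5 htt => (h5 t htt).trans (h3 t ht1 ht5), fun x hx => ?_⟩
    rw [(h6 x (hx.trans h37)).1 hx, h4 _ (hmul x hx)]
    simp only [part]
    have e : min (2 ^ j) (N ^ 16 - x * N ^ 16 % N ^ 16) = N ^ 16 := by
      rw [Nat.mul_mod_left]
      omega
    rw [e]

end Steps

end PVER2HK

namespace PVER2HK

theorem div_mul_of_lt {a b c d : ℕ} (h : c < b) : (a * b + c) / (b * d) = a / d := by
  rw [← Nat.div_div_eq_div_mul, mul_add_div_of_lt h]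

/-! ### The graph of the expanded users -/

namespace Expr

def users : Expr := ld 0 (const 1)

/-- The guard for the edges between the copies `m * N + j` and the subchannels. -/
def edgeGuard : Expr :=
  (lt pid (pw 4)).and <| (lt (dg 3 1) users).and <|
  (lt (dg 2 1) (ld 0 (add (const 2) (dg 3 1)))).and <| (lt (dg 0 2) (pw 1)).and <|
  ld 0 (add (add (const 2) (mul (const 2) users)) (add (mul (dg 3 1) (pw 1)) (dg 0 2)))

end Expr

section Stages

variable {N : ℕ} {ω : ℕ → ℕ} {J : ℕ} {σ : ℕ → ℕ → ℕ}

theorem size_bound (hN : 2 ≤ N) {M m s : ℕ} (hM : M ≤ N) (hm : m < N) (hs : s < N) :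
    2 + 2 * M + (m * N + s) < N ^ 53 ∧ 2 + M + m < N ^ 53 ∧ 2 + 2 * M + M * N + s < N ^ 53 := by
  have h1 : N ^ 5 ≤ N ^ 53 := Nat.pow_le_pow_right (by omega) (by norm_num)
  have h2 : (m + 1) * N ≤ N * N := Nat.mul_le_mul_right _ hm
  have h3 : M * N ≤ N * N := Nat.mul_le_mul_right _ hM
  have h4 : N * N * 8 ≤ N ^ 5 := by
    calc N * N * 8 ≤ N * N * N ^ 3 := Nat.mul_le_mul_left _ (two_pow_le_pow hN 3)
      _ = N ^ 5 := by ring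
  rw [add_mul, one_mul] at h2
  have h5 : 2 * N ≤ N * N := Nat.mul_le_mul_right _ hN
  generalize N * N = q at *
  generalize N ^ 53 = r at *
  generalize N ^ 5 = r' at *
  generalize m * N = u at *
  generalize M * N = v at *
  omega

theorem lt_array (hN : 2 ≤ N) {k x : ℕ} (hk : k ≤ 53) (hx : x < N ^ k) : x < N ^ 53 :=
  hx.trans_le (Nat.pow_le_pow_right (by omega) hk)

theorem lt_words (hN : 2 ≤ N) {k x : ℕ} (hk : k ≤ 58) (hx : x < N ^ k) : x < N ^ 58 :=
  hx.trans_le (Nat.pow_le_pow_right (by omega) hk)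

open Classical in
-- Row m N + j is copy j of user m. Padding rows and columns to N² gives a square matrix; padded
-- positions carry no edges.
theorem trans_edges (hN : 2 ≤ N) {M : ℕ} (hM : M ≤ N) (h1 : σ 0 1 = M) (h2 : ∀ x, σ 2 x = 0) :
    Trans N ω J (.put 2 .edgeGuard .pid (.const 1)) σ fun σ' => (∀ t, t ≠ 2 → σ' t = σ t) ∧
      ∀ i < N ^ 2, ∀ s < N ^ 2, σ' 2 (i * N ^ 2 + s) =
        if i / N < M ∧ i % N < σ 0 (2 + i / N) ∧ s < N ∧ σ 0 (2 + 2 * M + (i / N * N + s)) ≠ 0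
          then 1 else 0 := by
  have hN0 : 0 < N := by omega
  have hpos : 0 < N ^ 53 := pow_pos (by omega) 53
  have hone : 1 < N ^ 53 := lt_of_lt_of_le (by norm_num) (two_pow_le_pow hN 53)
  have hQ : N ^ 53 < N ^ 58 := pow_lt_pow_of_two_le hN (by norm_num)
  have hu : ∀ p, Ev N ω σ p .users M := fun p => by
    rw [← h1]
    exact Ev.ld (by norm_num) (Ev.const 1 (by norm_num)) hone
  have hdig : ∀ p k, p / N ^ k % N ^ 1 < N := fun p k => by
    rw [pow_one]
    exact Nat.mod_lt _ hN0
  refine (Trans.put_own (V := fun _ => 1) (G := fun p => p < N ^ 4 ∧ p / N ^ 3 % N ^ 1 < M ∧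
    p / N ^ 2 % N ^ 1 < σ 0 (2 + p / N ^ 3 % N ^ 1) ∧ p / N ^ 0 % N ^ 2 < N ^ 1 ∧
    σ 0 (2 + 2 * M + (p / N ^ 3 % N ^ 1 * N ^ 1 + p / N ^ 0 % N ^ 2)) ≠ 0) (by norm_num)
    (by norm_num) (fun p hp => ?_) fun p _ _ => Ev.const 1 (by norm_num)).mono ?_
  · refine (Gd.lt Ev.pid (Ev.pw 4 (by norm_num))).and fun _ => ?_
    have hm := Ev.dg (N := N) (ω := ω) (σ := σ) (p := p) (k := 3) (l := 1) (by norm_num)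
      (by norm_num)
    have hs := Ev.dg (N := N) (ω := ω) (σ := σ) (p := p) (k := 0) (l := 2) (by norm_num)
      (by norm_num)
    refine (Gd.lt hm (hu p)).and fun hmM => ?_
    have hb := size_bound hN hM (hdig p 3) hN0
    refine (Gd.lt (Ev.dg (by norm_num) (by norm_num)) (Ev.ld (by norm_num)
      (Ev.add (Ev.const 2 (by norm_num)) hm (by omega)) (by omega))).and fun _ => ?_
    refine (Gd.lt hs (Ev.pw 1 (by norm_num))).and fun hsN => ?_
    rw [pow_one] at hsN
    have hb' := (size_bound hN hM (hdig p 3) hsN).1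
    have e : p / N ^ 3 % N ^ 1 * N ^ 1 = p / N ^ 3 % N ^ 1 * N := by rw [pow_one N]
    refine Gd.nonzero (Ev.ld (by norm_num) (Ev.add (Ev.add (Ev.const 2 (by norm_num))
      (Ev.mul (Ev.const 2 (by norm_num)) (hu p) ?_) ?_) (Ev.add (Ev.mul hm (Ev.pw 1 (by norm_num))
      ?_) hs ?_) ?_) ?_) <;> omega
  · rintro σ' ⟨h3, h4⟩
    refine ⟨h3, fun i hi s hs => ?_⟩
    have hlt : i * N ^ 2 + s < N ^ 4 := mul_pow_add_lt (k := 2) (l := 2) hi hs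
    have e1 : (i * N ^ 2 + s) / N ^ 3 % N ^ 1 = i / N := by
      rw [show N ^ 3 = N ^ 2 * N by ring, div_mul_of_lt hs, pow_one, Nat.mod_eq_of_lt]
      exact Nat.div_lt_of_lt_mul (by rw [← sq]; exact hi)
    have e2 : (i * N ^ 2 + s) / N ^ 2 % N ^ 1 = i % N := by
      rw [mul_add_div_of_lt hs, pow_one]
    have e3 : (i * N ^ 2 + s) / N ^ 0 % N ^ 2 = s := by
      rw [pow_zero, Nat.div_one, mul_add_mod_of_lt hs]
    obtain ⟨h5, h6⟩ := h4 _ (lt_array hN (by norm_num) hlt)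
    rw [e1, e2, e3, pow_one] at h5 h6
    split_ifs with h
    · exact h5 ⟨hlt, h⟩
    · rw [h6 fun hc => h hc.2, h2]

/-! ### Weights -/

/-- The guarded weight of an entry. -/
def Expr.weight : Expr :=
  .add (.add (.const 1) (.mul (.pw 7) (.ld 2 .pid))) (.mod (.rand .pid) (.pw 5))

/-- Weights below N^8 over N² columns keep the weight of a permutation below N^10, the range of
degrees in the walk states. -/
theorem weight_lt (hN : 2 ≤ N) {x r : ℕ} (hx : x ≤ 1) (hr : r < N ^ 5) :
    1 + N ^ 7 * x + r < N ^ 8 := by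
  have h1 : N ^ 7 * x ≤ N ^ 7 * 1 := Nat.mul_le_mul_left _ hx
  rw [mul_one] at h1
  have h2 : N ^ 5 * 4 ≤ N ^ 7 := by
    calc N ^ 5 * 4 ≤ N ^ 5 * N ^ 2 := Nat.mul_le_mul_left _ (two_pow_le_pow hN 2)
      _ = N ^ 7 := by ring
  have h3 : N ^ 7 * 2 ≤ N ^ 8 := by
    calc N ^ 7 * 2 ≤ N ^ 7 * N := Nat.mul_le_mul_left _ hN
      _ = N ^ 8 := by ring
  generalize N ^ 7 * x = u at *
  omega

theorem trans_weights (hN : 2 ≤ N) (h2 : ∀ x < N ^ 4, σ 2 x ≤ 1) :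
    Trans N ω J (.put 3 (.lt .pid (.pw 4)) .pid .weight) σ fun σ' => (∀ t, t ≠ 3 → σ' t = σ t) ∧
      ∀ x < N ^ 4, σ' 3 x = 1 + N ^ 7 * σ 2 x + ω x % N ^ 5 := by
  have h5 : 0 < N ^ 5 := pow_pos (by omega) 5
  refine (Trans.put_own (V := fun x => 1 + N ^ 7 * σ 2 x + ω x % N ^ 5) (G := fun p => p < N ^ 4)
    (by norm_num) (by norm_num) (fun p hp => Gd.lt Ev.pid (Ev.pw 4 (by norm_num)))
    fun p hp hp4 => ?_).mono ?_
  · have hb := lt_words hN (by norm_num) (weight_lt hN (h2 p hp4) (Nat.mod_lt (ω p) h5))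
    exact Ev.add (Ev.add (Ev.const 1 (by norm_num)) (Ev.mul (Ev.pw 7 (by norm_num))
      (Ev.ld (by norm_num) Ev.pid hp) (((Nat.le_add_left _ _).trans (Nat.le_add_right _ _)).trans_lt
        hb)) ((Nat.le_add_right _ _).trans_lt hb))
      (Ev.mod (Ev.rand Ev.pid) (Ev.pw 5 (by norm_num))) hb
  · rintro σ' ⟨h3, h4⟩
    exact ⟨h3, fun x hx => (h4 x (lt_array hN (by norm_num) hx)).1 hx⟩

/-! ### The walk matrix -/

/-- A step of a walk between the coded states `a` and `b`, without the entry `e`. -/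
def CodedStep (N : ℕ) (w : ℕ → ℕ → ℕ) (e a b : ℕ) : Prop :=
  Step (N ^ 2) w (fun i s => e = i * N ^ 2 + s) (a / N ^ 10 / N ^ 3) (a / N ^ 10 % N ^ 3)
    (a % N ^ 10) (b / N ^ 10 / N ^ 3) (b / N ^ 10 % N ^ 3) (b % N ^ 10)

namespace Expr

/-- The weight of the entry `(v, v')`. -/
def wt (v v' : Expr) : Expr := ld 3 (ix 2 v v')

def step (e k v t k' v' t' : Expr) : Expr :=
  or ((eq k (pw 2)).and <| (eq v (pw 2)).and <| (eq k' (pw 2)).and <| (eq v' (pw 2)).and <| eq t' t)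
  <| or ((lt k (pw 2)).and <| (eq v k).and <| (eq k' (add k (const 1))).and <|
    (eq v' (add k (const 1))).and <| eq t' t)
  <| or ((lt k (pw 2)).and <| (le v k).and <| (eq k' k).and <| (lt v' k).and <|
    (eq e (ix 2 v v')).not.and <| eq t' (add t (wt v v')))
  <| (lt k (pw 2)).and <| (le v k).and <| (eq k' (add k (const 1))).and <|
    (eq v' (add k (const 1))).and <| (eq e (ix 2 v k)).not.and <| eq t' (add t (wt v k))

def codedStep (e a b : Expr) : Expr :=
  step e (div (div a (pw 10)) (pw 3)) (mod (div a (pw 10)) (pw 3)) (mod a (pw 10))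
    (div (div b (pw 10)) (pw 3)) (mod (div b (pw 10)) (pw 3)) (mod b (pw 10))

end Expr

theorem Gd.step (hN : 2 ≤ N) {w : ℕ → ℕ → ℕ}
    (hw : ∀ i < N ^ 2, ∀ s < N ^ 2, σ 3 (i * N ^ 2 + s) = w i s ∧ w i s < N ^ 8)
    {p e k v t k' v' t' : ℕ} {xe xk xv xt xk' xv' xt' : Expr} (he : Ev N ω σ p xe e)
    (hk : Ev N ω σ p xk k) (hv : Ev N ω σ p xv v) (ht : Ev N ω σ p xt t)
    (hk' : Ev N ω σ p xk' k') (hv' : Ev N ω σ p xv' v') (ht' : Ev N ω σ p xt' t')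
    (htb : t < N ^ 10) :
    Gd N ω σ p (.step xe xk xv xt xk' xv' xt')
      (Step (N ^ 2) w (fun i s => e = i * N ^ 2 + s) k v t k' v' t') := by
  have h2 := Ev.pw (N := N) (ω := ω) (σ := σ) (p := p) 2 (by norm_num)
  have h3 : N ^ 2 < N ^ 8 := pow_lt_pow_of_two_le hN (by norm_num)
  have h8 : N ^ 8 < N ^ 10 := pow_lt_pow_of_two_le hN (by norm_num)
  have h10 : N ^ 10 * 2 ≤ N ^ 58 := by
    calc N ^ 10 * 2 ≤ N ^ 10 * N ^ 48 := Nat.mul_le_mul_left _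
          ((show 2 ≤ 2 ^ 48 by norm_num).trans (two_pow_le_pow hN 48))
      _ = N ^ 58 := by rw [← pow_add]
  have hk1 : k < N ^ 2 → Ev N ω σ p (.add xk (.const 1)) (k + 1) := fun h =>
    Ev.add hk (Ev.const 1 (by norm_num)) (by omega)
  have hix : ∀ {i s xi xs}, Ev N ω σ p xi i → Ev N ω σ p xs s → i < N ^ 2 → s < N ^ 2 →
      Ev N ω σ p (.ix 2 xi xs) (i * N ^ 2 + s) := fun h h' hi hs =>
    Ev.ix (k := 2) h h' hi hs (by norm_num)
  have hwt : ∀ {i s xi xs}, Ev N ω σ p xi i → Ev N ω σ p xs s → i < N ^ 2 → s < N ^ 2 →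
      Ev N ω σ p (.add xt (.wt xi xs)) (t + w i s) := fun h h' hi hs => by
    obtain ⟨e1, e2⟩ := hw _ hi _ hs
    refine Ev.add ht ?_ (by omega)
    rw [← e1]
    exact Ev.ld (by norm_num) (hix h h' hi hs)
      (lt_array hN (by norm_num) (mul_pow_add_lt (k := 2) (l := 2) hi hs))
  refine Gd.or ?_ (Gd.or ?_ (Gd.or ?_ ?_))
  · exact (Gd.eq hk h2).and fun _ => (Gd.eq hv h2).and fun _ => (Gd.eq hk' h2).and fun _ =>
      (Gd.eq hv' h2).and fun _ => Gd.eq ht' ht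
  · exact (Gd.lt hk h2).and fun h => (Gd.eq hv hk).and fun _ => (Gd.eq hk' (hk1 h)).and fun _ =>
      (Gd.eq hv' (hk1 h)).and fun _ => Gd.eq ht' ht
  · exact (Gd.lt hk h2).and fun h => (Gd.le hv hk).and fun hvk => (Gd.eq hk' hk).and fun _ =>
      (Gd.lt hv' hk).and fun hvk' =>
      (Gd.eq he (hix hv hv' (hvk.trans_lt h) (hvk'.trans h))).not.and fun _ =>
      Gd.eq ht' (hwt hv hv' (hvk.trans_lt h) (hvk'.trans h))
  · exact (Gd.lt hk h2).and fun h => (Gd.le hv hk).and fun hvk => (Gd.eq hk' (hk1 h)).and fun _ =>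
      (Gd.eq hv' (hk1 h)).and fun _ =>
      (Gd.eq he (hix hv hk (hvk.trans_lt h) h)).not.and fun _ =>
      Gd.eq ht' (hwt hv hk (hvk.trans_lt h) h)

open Classical in
-- One matrix for each number `e`: those below N^4 encode the entry to delete, and N^4 encodes none
-- and yields the full determinant. A state takes 3 + 3 + 10 digits in base N, as heads and vertices
-- range up to N² inclusive.
theorem trans_matrix (hN : 2 ≤ N) {w : ℕ → ℕ → ℕ}
    (hw : ∀ i < N ^ 2, ∀ s < N ^ 2, σ 3 (i * N ^ 2 + s) = w i s ∧ w i s < N ^ 8)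
    (h4 : ∀ x, σ 4 x = 0) :
    Trans N ω J (.put 4 (.codedStep (.dg 32 5) (.dg 16 16) (.dg 0 16)) .pid (.const 1)) σ fun σ' =>
      (∀ t, t ≠ 4 → σ' t = σ t) ∧ ∀ e < N ^ 5, ∀ a < N ^ 16, ∀ b < N ^ 16,
        σ' 4 ((e * N ^ 16 + a) * N ^ 16 + b) = if CodedStep N w e a b then 1 else 0 := by
  have hpos : 0 < N ^ 10 := pow_pos (by omega) 10
  refine (Trans.put_own (V := fun _ => 1) (G := fun p =>
    CodedStep N w (p / N ^ 32 % N ^ 5) (p / N ^ 16 % N ^ 16) (p / N ^ 0 % N ^ 16)) (by norm_num)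
    (by norm_num) (fun p hp => ?_) fun p _ _ => Ev.const 1 (by norm_num)).mono ?_
  · have ha := Ev.dg (N := N) (ω := ω) (σ := σ) (p := p) (k := 16) (l := 16) (by norm_num)
      (by norm_num)
    have hb := Ev.dg (N := N) (ω := ω) (σ := σ) (p := p) (k := 0) (l := 16) (by norm_num)
      (by norm_num)
    have e10 := Ev.pw (N := N) (ω := ω) (σ := σ) (p := p) 10 (by norm_num)
    have e3 := Ev.pw (N := N) (ω := ω) (σ := σ) (p := p) 3 (by norm_num)
    exact Gd.step hN hw (Ev.dg (by norm_num) (by norm_num)) ((ha.div e10).div e3)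
      ((ha.div e10).mod e3) (ha.mod e10) ((hb.div e10).div e3) ((hb.div e10).mod e3) (hb.mod e10)
      (Nat.mod_lt _ hpos)
  · rintro σ' ⟨h5, h6⟩
    refine ⟨h5, fun e he a ha b hb => ?_⟩
    have hlt := mul_pow_add_lt (mul_pow_add_lt he ha) hb
    obtain ⟨h7, h8⟩ := h6 _ (lt_array hN (by norm_num) hlt)
    have e1 : ((e * N ^ 16 + a) * N ^ 16 + b) / N ^ 32 % N ^ 5 = e := by
      rw [show N ^ 32 = N ^ 16 * N ^ 16 by rw [← pow_add], div_mul_of_lt hb, mul_add_div_of_lt ha,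
        Nat.mod_eq_of_lt he]
    have e2 : ((e * N ^ 16 + a) * N ^ 16 + b) / N ^ 16 % N ^ 16 = a := by
      rw [mul_add_div_of_lt hb, mul_add_mod_of_lt ha]
    have e3 : ((e * N ^ 16 + a) * N ^ 16 + b) / N ^ 0 % N ^ 16 = b := by
      rw [pow_zero, Nat.div_one, mul_add_mod_of_lt hb]
    rw [e1, e2, e3] at h7 h8
    split_ifs with h
    · exact h7 h
    · rw [h8 h, h4]

/-! ### Repeated squaring -/

/-- The product of the entries `(a, c)` and `(c, b)` of the matrix number `e`. -/
def Expr.product : Expr :=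
  .mul (.mod (.ld 4 (.ix 16 (.ix 16 (.dg 48 5) (.dg 32 16)) (.dg 0 16))) (.const 2))
    (.mod (.ld 4 (.ix 16 (.ix 16 (.dg 48 5) (.dg 0 16)) (.dg 16 16))) (.const 2))

def Prog.squaring : Prog := .doubling 18 (.sum 4 .product)

open Classical in
/-- The iterated squares of the walk matrix. -/
noncomputable def squares (N : ℕ) (w : ℕ → ℕ → ℕ) (e : ℕ) : ℕ → ℕ → ℕ → ZMod 2
  | 0, a, b => if CodedStep N w e a b then 1 else 0
  | j + 1, a, b => ∑ c ∈ Finset.range (N ^ 16), squares N w e j a c * squares N w e j c b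

/-- The digits 5 + 16 + 16 + 16 = 53 of a processor are the matrix number, row, column and summation
index. Only parities matter, so factors are reduced modulo 2 and sums stay at most N^16. -/
theorem trans_product (hN : 2 ≤ N) (hJ : N ^ 16 ≤ 2 ^ J) :
    Trans N ω J (.sum 4 .product) σ fun σ' => (∀ t, t ≠ 1 → t ≠ 5 → t ≠ 4 → σ' t = σ t) ∧
      ∀ e < N ^ 5, ∀ a < N ^ 16, ∀ b < N ^ 16, (σ' 4 ((e * N ^ 16 + a) * N ^ 16 + b) : ZMod 2) =
        ∑ c ∈ Finset.range (N ^ 16), (σ 4 ((e * N ^ 16 + a) * N ^ 16 + c) : ZMod 2) *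
          (σ 4 ((e * N ^ 16 + c) * N ^ 16 + b) : ZMod 2) := by
  have h16 : 0 < N ^ 16 := pow_pos (by omega) 16
  have h5 : 0 < N ^ 5 := pow_pos (by omega) 5
  have hle : ∀ x y : ℕ, x % 2 * (y % 2) ≤ 1 := fun x y => by
    have h1 := Nat.mod_lt x (show 0 < 2 by norm_num)
    have h2 := Nat.mod_lt y (show 0 < 2 by norm_num)
    exact Nat.mul_le_mul (Nat.le_of_lt_succ h1) (Nat.le_of_lt_succ h2)
  refine (Trans.sum (F := fun p => σ 4 ((p / N ^ 48 % N ^ 5 * N ^ 16 + p / N ^ 32 % N ^ 16) *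
    N ^ 16 + p / N ^ 0 % N ^ 16) % 2 * (σ 4 ((p / N ^ 48 % N ^ 5 * N ^ 16 + p / N ^ 0 % N ^ 16) *
    N ^ 16 + p / N ^ 16 % N ^ 16) % 2)) (by norm_num) (by norm_num) hN hJ ?_ ?_).mono ?_
  · intro p hp
    have hd : ∀ k, k < 58 → Ev N ω σ p (.dg k 16) (p / N ^ k % N ^ 16) := fun k hk =>
      Ev.dg hk (by norm_num)
    have he : Ev N ω σ p (.dg 48 5) (p / N ^ 48 % N ^ 5) := Ev.dg (by norm_num) (by norm_num)
    have hl : ∀ k k', k < 58 → k' < 58 → Ev N ω σ p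
        (.ld 4 (.ix 16 (.ix 16 (.dg 48 5) (.dg k 16)) (.dg k' 16)))
        (σ 4 ((p / N ^ 48 % N ^ 5 * N ^ 16 + p / N ^ k % N ^ 16) * N ^ 16 +
          p / N ^ k' % N ^ 16)) := fun k k' hk hk' => by
      have b1 := mul_pow_add_lt (Nat.mod_lt (p / N ^ 48) h5) (Nat.mod_lt (p / N ^ k) h16)
      exact Ev.ld (by norm_num) (Ev.ix (Ev.ix he (hd k hk) (Nat.mod_lt _ h5) (Nat.mod_lt _ h16)
        (by norm_num)) (hd k' hk') b1 (Nat.mod_lt _ h16) (by norm_num))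
        (lt_array hN (by norm_num) (mul_pow_add_lt b1 (Nat.mod_lt _ h16)))
    exact Ev.mul ((hl 32 0 (by norm_num) (by norm_num)).mod (Ev.const 2 (by norm_num)))
      ((hl 0 16 (by norm_num) (by norm_num)).mod (Ev.const 2 (by norm_num)))
      ((hle _ _).trans_lt (one_lt_words hN))
  · intro p _
    exact (hle _ _).trans h16
  · rintro σ' ⟨h1, h2⟩
    refine ⟨h1, fun e he a ha b hb => ?_⟩
    rw [h2 _ (mul_pow_add_lt (mul_pow_add_lt he ha) hb), Nat.cast_sum]
    refine Finset.sum_congr rfl fun c hc => ?_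
    replace hc := Finset.mem_range.1 hc
    have e1 : (((e * N ^ 16 + a) * N ^ 16 + b) * N ^ 16 + c) / N ^ 48 % N ^ 5 = e := by
      rw [show N ^ 48 = N ^ 16 * (N ^ 16 * N ^ 16) by rw [← pow_add, ← pow_add], div_mul_of_lt hc,
        div_mul_of_lt hb, mul_add_div_of_lt ha, Nat.mod_eq_of_lt he]
    have e2 : (((e * N ^ 16 + a) * N ^ 16 + b) * N ^ 16 + c) / N ^ 32 % N ^ 16 = a := by
      rw [show N ^ 32 = N ^ 16 * N ^ 16 by rw [← pow_add], div_mul_of_lt hc, mul_add_div_of_lt hb,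
        mul_add_mod_of_lt ha]
    have e3 : (((e * N ^ 16 + a) * N ^ 16 + b) * N ^ 16 + c) / N ^ 16 % N ^ 16 = b := by
      rw [mul_add_div_of_lt hc, mul_add_mod_of_lt hb]
    have e4 : (((e * N ^ 16 + a) * N ^ 16 + b) * N ^ 16 + c) / N ^ 0 % N ^ 16 = c := by
      rw [pow_zero, Nat.div_one, mul_add_mod_of_lt hc]
    simp only [e1, e2, e3, e4]
    rw [Nat.cast_mul, ZMod.natCast_mod _ 2, ZMod.natCast_mod _ 2]

open PowerSeries in
/-- The matrix powers hold the coefficients of the determinants. -/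
theorem trans_squaring (hN : 2 ≤ N) (hJ : N ^ 16 ≤ 2 ^ J) {w : ℕ → ℕ → ℕ} (hw1 : ∀ i s, 1 ≤ w i s)
    (h4 : ∀ e < N ^ 5, ∀ a < N ^ 16, ∀ b < N ^ 16,
      (σ 4 ((e * N ^ 16 + a) * N ^ 16 + b) : ZMod 2) = squares N w e 0 a b) :
    Trans N ω J .squaring σ fun σ' => (∀ t, t ≠ 1 → t ≠ 5 → t ≠ 4 → t ≠ 18 → σ' t = σ t) ∧
      ∀ e < N ^ 5, ∀ t < N ^ 10,
        (σ' 4 ((e * N ^ 16) * N ^ 16 + code (N ^ 3) (N ^ 10) (N ^ 2) (N ^ 2) t) : ZMod 2) =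
          coeff t (leadingMinor (entry w fun i s => e = i * N ^ 2 + s) (N ^ 2)) := by
  refine (Trans.doubling (ct := 18) (by norm_num) (by norm_num) hJ (fun j σ' =>
    (∀ t, t ≠ 1 → t ≠ 5 → t ≠ 4 → t ≠ 18 → σ' t = σ t) ∧
    ∀ e < N ^ 5, ∀ a < N ^ 16, ∀ b < N ^ 16,
      (σ' 4 ((e * N ^ 16 + a) * N ^ 16 + b) : ZMod 2) = squares N w e j a b) ?_ ?_ ?_).mono ?_
  · rintro j σ₁ σ₂ h ⟨h1, h2⟩
    refine ⟨fun t ht1 ht5 ht4 ht => (h t ht).trans (h1 t ht1 ht5 ht4 ht), fun e he a ha b hb => ?_⟩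
    rw [h 4 (by norm_num)]
    exact h2 e he a ha b hb
  · rintro j σ₁ _ hc ⟨h1, h2⟩
    refine (trans_product hN hJ).mono ?_
    rintro σ₂ ⟨h3, h5⟩
    refine ⟨⟨fun t ht1 ht5 ht4 ht => (h3 t ht1 ht5 ht4).trans (h1 t ht1 ht5 ht4 ht),
      fun e he a ha b hb => ?_⟩, ?_⟩
    · rw [h5 e he a ha b hb, squares]
      refine Finset.sum_congr rfl fun c hc => ?_
      rw [h2 e he a ha c (Finset.mem_range.1 hc), h2 e he c (Finset.mem_range.1 hc) b hb]
    · rw [h3 18 (by norm_num) (by norm_num) (by norm_num), hc]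
  · exact ⟨fun _ _ _ _ _ => rfl, h4⟩
  · rintro σ' ⟨j, hj, h1, h2⟩
    refine ⟨h1, fun e he t ht => ?_⟩
    have hS : N ^ 3 * N ^ 3 * N ^ 10 = N ^ 16 := by rw [← pow_add, ← pow_add]
    have h23 : N ^ 2 < N ^ 3 := pow_lt_pow_of_two_le hN (by norm_num)
    -- The number of steps exceeds the bound n + T on head plus weight.
    have hlt : N ^ 2 + N ^ 10 < 2 ^ j := by
      refine lt_of_lt_of_le ?_ hj
      have h3 : N ^ 2 < N ^ 10 := pow_lt_pow_of_two_le hN (by norm_num)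
      have h4 : N ^ 10 * 2 ≤ N ^ 16 := by
        calc N ^ 10 * 2 ≤ N ^ 10 * N ^ 6 := Nat.mul_le_mul_left _
              ((show 2 ≤ 2 ^ 6 by norm_num).trans (two_pow_le_pow hN 6))
          _ = N ^ 16 := by rw [← pow_add]
      omega
    have hcode := code_lt h23 h23 ht
    rw [hS] at hcode
    rw [← iterated_square_step h23 h23 ht hw1 (squares N w e) j hlt
      (fun a _ b _ => rfl) (fun j _ a _ b _ => by rw [hS]; rfl),
      ← h2 e he 0 (pow_pos (by omega) 16) _ hcode, add_zero]

end Stages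

end PVER2HK

namespace PVER2HK

/-! ### Bounded reachability -/

section Within

variable (r : ℕ → ℕ → Prop)

/-- `k` is reachable from `i` in at most `m` steps. -/
def Within : ℕ → ℕ → ℕ → Prop
  | 0, i, k => i = k
  | m + 1, i, k => ∃ c, Within m i c ∧ (c = k ∨ r c k)

variable {r}

theorem within_one {i k : ℕ} : Within r 1 i k ↔ i = k ∨ r i k := by
  simp [Within]

theorem within_add {a : ℕ} : ∀ {b i k : ℕ},
    Within r (a + b) i k ↔ ∃ c, Within r a i c ∧ Within r b c k
  | 0, i, k => by simp [Within]
  | b + 1, i, k => by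
    rw [← add_assoc, Within]
    simp only [within_add (b := b), Within]
    constructor
    · rintro ⟨c, ⟨d, h1, h2⟩, h3⟩
      exact ⟨d, h1, c, h2, h3⟩
    · rintro ⟨d, h1, c, h2, h3⟩
      exact ⟨c, ⟨d, h1, h2⟩, h3⟩

theorem within_mono {a b i k : ℕ} (hab : a ≤ b) (h : Within r a i k) : Within r b i k := by
  induction hab with
  | refl => exact h
  | step _ ih => exact ⟨k, ih, .inl rfl⟩

theorem Within.reflTransGen : ∀ {m i k : ℕ}, Within r m i k → Relation.ReflTransGen r i k
  | 0, _, _, h => by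
    rw [show _ = _ from h]
  | m + 1, i, k, ⟨c, h1, h2⟩ => by
    rcases h2 with rfl | h2
    · exact h1.reflTransGen
    · exact h1.reflTransGen.tail h2

theorem Within.lt {n : ℕ} (hr : ∀ i k, r i k → k < n) :
    ∀ {m i k : ℕ}, i < n → Within r m i k → k < n
  | 0, _, _, hi, h => by rwa [← show _ = _ from h]
  | m + 1, i, k, hi, ⟨c, h1, h2⟩ => by
    rcases h2 with rfl | h2
    · exact h1.lt hr hi
    · exact hr _ _ h2

/-- The sets reached in m steps grow strictly until they become stable, which happens within n steps
in a set of n elements. -/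
theorem within_of_reflTransGen {n : ℕ} (hr : ∀ i k, r i k → k < n) {i k : ℕ} (hi : i < n)
    (h : Relation.ReflTransGen r i k) : Within r n i k := by
  classical
  let S : ℕ → Finset ℕ := fun m => (Finset.range n).filter (Within r m i)
  have hS : ∀ m k, k ∈ S m ↔ Within r m i k := fun m k => by
    simp only [S, Finset.mem_filter, Finset.mem_range, and_iff_right_iff_imp]
    exact fun h => h.lt hr hi
  have hstable : ∀ m, S (m + 1) = S m → Within r m i k := by
    intro m hm
    have key : ∀ c, Relation.ReflTransGen r i c → Within r m i c := by
      intro c hc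
      induction hc with
      | refl => exact within_mono (Nat.zero_le m) rfl
      | tail _ hcd ih => exact (hS _ _).1 (hm ▸ (hS _ _).2 ⟨_, ih, .inr hcd⟩)
    exact key k h
  have hcard : ∀ m, (∃ m' < m, S (m' + 1) = S m') ∨ m + 1 ≤ (S m).card := by
    intro m
    induction m with
    | zero =>
      right
      exact Finset.card_pos.2 ⟨i, (hS 0 i).2 rfl⟩
    | succ m ih =>
      rcases ih with ⟨m', hm', h⟩ | ih
      · exact .inl ⟨m', by omega, h⟩
      · by_cases he : S (m + 1) = S m
        · exact .inl ⟨m, by omega, he⟩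
        · right
          have hsub : S m ⊂ S (m + 1) := by
            refine Finset.ssubset_iff_subset_ne.2 ⟨fun c hc => ?_, Ne.symm he⟩
            exact (hS _ _).2 ⟨c, (hS _ _).1 hc, .inl rfl⟩
          have := Finset.card_lt_card hsub
          omega
  rcases hcard n with ⟨m', hm', h⟩ | h
  · exact within_mono hm'.le (hstable m' h)
  · have := (Finset.card_filter_le (Finset.range n) (Within r n i))
    rw [Finset.card_range] at this
    have h' : n + 1 ≤ ((Finset.range n).filter (Within r n i)).card := h
    omega

end Within

section Stages

variable {N : ℕ} {ω : ℕ → ℕ} {J : ℕ} {σ : ℕ → ℕ → ℕ}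

/-- A step in which a processor for each triple of numbers writes `1`. -/
theorem trans_triple (hN : 2 ≤ N) (a b c : ℕ) (habc : a + b + c ≤ 53) {tag : ℕ} (ht : tag < 32)
    (ht0 : tag ≠ 0) {g h : Expr} {G : ℕ → ℕ → ℕ → Prop} {H : ℕ → ℕ → ℕ → ℕ}
    (hgh : ∀ p x y z, Ev N ω σ p (.dg (b + c) a) x → Ev N ω σ p (.dg c b) y →
      Ev N ω σ p (.dg 0 c) z → x < N ^ a → y < N ^ b → z < N ^ c → Gd N ω σ p g (G x y z) ∧
      Ev N ω σ p h (H x y z) ∧ H x y z < N ^ 53) :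
    Trans N ω J (.put tag g h (.const 1)) σ fun σ' => (∀ t, t ≠ tag → σ' t = σ t) ∧
      ∀ i, σ' tag i ≠ 0 ↔
        (∃ x < N ^ a, ∃ y < N ^ b, ∃ z < N ^ c, G x y z ∧ H x y z = i) ∨ σ tag i ≠ 0 := by
  have hpos : ∀ k, 0 < N ^ k := fun k => pow_pos (by omega) k
  have h' := fun p => hgh p _ _ _ (Ev.dg (by omega) (by omega)) (Ev.dg (by omega) (by omega))
    (Ev.dg (by omega) (by omega)) (Nat.mod_lt _ (hpos a)) (Nat.mod_lt _ (hpos b))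
    (Nat.mod_lt _ (hpos c))
  refine (Trans.put_one ht ht0 (fun p _ => (h' p).1) (fun p _ _ => (h' p).2.1)
    fun p _ _ => (h' p).2.2).mono ?_
  rintro σ' ⟨h1, h2⟩
  refine ⟨h1, fun i => (h2 i).trans (or_congr_left ⟨?_, ?_⟩)⟩
  · rintro ⟨p, _, hG, hH⟩
    exact ⟨_, Nat.mod_lt _ (hpos a), _, Nat.mod_lt _ (hpos b), _, Nat.mod_lt _ (hpos c), hG, hH⟩
  · rintro ⟨x, hx, y, hy, z, hz, hG, hH⟩
    have hlt := lt_array hN habc (mul_pow_add_lt (mul_pow_add_lt hx hy) hz)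
    refine ⟨_, hlt, ?_⟩
    rw [pow_zero, Nat.div_one, mul_add_mod_of_lt hz, mul_add_div_of_lt hz, mul_add_mod_of_lt hy,
      add_comm b c, pow_add N c b, div_mul_of_lt hz, mul_add_div_of_lt hy, Nat.mod_eq_of_lt hx]
    exact ⟨hG, hH⟩

/-! ### The permutation -/

/-- The coefficient of degree `t` of the determinant number `e`. -/
def Expr.detBit (e t : Expr) : Expr :=
  .mod (.ld 4 (.ix 16 (.mul e (.pw 16)) (.ix 10 (.ix 3 (.pw 2) (.pw 2)) t))) (.const 2)

theorem Ev.detBit (hN : 2 ≤ N) {p e t : ℕ} {xe xt : Expr} (he : Ev N ω σ p xe e)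
    (ht : Ev N ω σ p xt t) (hlt : e < N ^ 5) (hlt' : t < N ^ 10) : Ev N ω σ p (.detBit xe xt)
      (σ 4 ((e * N ^ 16) * N ^ 16 + code (N ^ 3) (N ^ 10) (N ^ 2) (N ^ 2) t) % 2) := by
  have h23 : N ^ 2 < N ^ 3 := pow_lt_pow_of_two_le hN (by norm_num)
  have h16 : 0 < N ^ 16 := pow_pos (by omega) 16
  have h1 : e * N ^ 16 < N ^ 21 := mul_pow_add_lt (y := 0) hlt h16
  have h2 : code (N ^ 3) (N ^ 10) (N ^ 2) (N ^ 2) t < N ^ 16 := by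
    have := code_lt h23 h23 hlt'
    rwa [← pow_add, ← pow_add] at this
  have h3 : N ^ 2 * N ^ 3 + N ^ 2 < N ^ 6 := mul_pow_add_lt h23 h23
  refine Ev.mod (Ev.ld (by norm_num) (Ev.ix (Ev.mul he (Ev.pw 16 (by norm_num))
    (lt_words hN (by norm_num) h1)) ?_ h1 h2 (by norm_num))
    (lt_array hN (by norm_num) (mul_pow_add_lt h1 h2))) (Ev.const 2 (by norm_num))
  exact Ev.ix (Ev.ix (Ev.pw 2 (by norm_num)) (Ev.pw 2 (by norm_num)) h23 h23 (by norm_num)) ht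
    h3 hlt' (by norm_num)

/-- The degree in the first digit is smaller than a degree with a nonzero coefficient. -/
def Prog.markLower : Prog :=
  .put 6 ((Expr.lt (.dg 10 10) (.dg 0 10)).and (.detBit (.pw 4) (.dg 0 10))) (.dg 10 10) (.const 1)

/-- Select the edges that the leading term of the determinant uses. -/
def Prog.select : Prog :=
  .put 7 ((Expr.ld 2 (.dg 10 4)).and <| (Expr.detBit (.pw 4) (.dg 0 10)).and <|
    (Expr.ld 6 (.dg 0 10)).not.and (Expr.detBit (.dg 10 4) (.dg 0 10)).not) (.dg 10 4) (.const 1)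

/-- Array 6 marks the degrees below a nonzero coefficient of the full determinant, so an unmarked
degree with nonzero coefficient is the top one. An edge is selected if its deletion kills this
coefficient. -/
theorem trans_select (hN : 2 ≤ N) (h6 : ∀ x, σ 6 x = 0) (h7 : ∀ x, σ 7 x = 0) {d : ℕ → ℕ → ZMod 2}
    (hd : ∀ e < N ^ 5, ∀ t < N ^ 10,
      (σ 4 ((e * N ^ 16) * N ^ 16 + code (N ^ 3) (N ^ 10) (N ^ 2) (N ^ 2) t) : ZMod 2) = d e t) :
    Trans N ω J (.seq .markLower .select) σ fun σ' => (∀ t, t ≠ 6 → t ≠ 7 → σ' t = σ t) ∧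
      ∀ x < N ^ 4, σ' 7 x ≠ 0 ↔ σ 2 x ≠ 0 ∧ ∃ t < N ^ 10, d (N ^ 4) t ≠ 0 ∧
        (∀ t' < N ^ 10, t < t' → d (N ^ 4) t' = 0) ∧ d x t = 0 := by
  have h45 : N ^ 4 < N ^ 5 := pow_lt_pow_of_two_le hN (by norm_num)
  have hbit : ∀ e < N ^ 5, ∀ t < N ^ 10,
      σ 4 ((e * N ^ 16) * N ^ 16 + code (N ^ 3) (N ^ 10) (N ^ 2) (N ^ 2) t) % 2 = 0 ↔
        d e t = 0 := fun e he t ht => by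
    rw [← hd e he t ht, ZMod.natCast_eq_zero_iff, Nat.dvd_iff_mod_eq_zero]
  refine (trans_triple (G := fun _ y z => y < z ∧ _ ≠ 0) (H := fun _ y _ => y) hN 2 10 10
    (by norm_num) (by norm_num) (by norm_num) fun p x y z _ hy hz _ hy' hz' =>
    ⟨(Gd.lt hy hz).and fun _ => Gd.nonzero (Ev.detBit hN (Ev.pw 4 (by norm_num)) hz h45 hz'), hy,
      lt_array hN (by norm_num) hy'⟩).seq ?_
  rintro σ₁ ⟨h1, h2⟩
  have hmark : ∀ t < N ^ 10, σ₁ 6 t = 0 ↔ ∀ t' < N ^ 10, t < t' → d (N ^ 4) t' = 0 := by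
    intro t ht
    rw [← not_iff_not, ← ne_eq, h2 t, h6]
    push Not
    constructor
    · rintro (⟨-, -, y, hy, z, hz, ⟨hyz, hne⟩, rfl⟩ | h)
      · exact ⟨z, hz, hyz, fun h => hne ((hbit _ h45 z hz).2 h)⟩
      · exact absurd rfl h
    · rintro ⟨z, hz, hyz, hne⟩
      exact .inl ⟨0, pow_pos (by omega) 2, t, ht, z, hz,
        ⟨hyz, fun h => hne ((hbit _ h45 z hz).1 h)⟩, rfl⟩
  refine (trans_triple (G := fun _ y z => σ₁ 2 y ≠ 0 ∧ _ ≠ 0 ∧ ¬ σ₁ 6 z ≠ 0 ∧ ¬ _ ≠ 0)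
    (H := fun _ y _ => y) hN 2 4 10
    (by norm_num) (by norm_num) (by norm_num) fun p x y z _ hy hz _ hy' hz' =>
    ⟨(Gd.nonzero (Ev.ld (by norm_num) hy (lt_array hN (by norm_num) hy'))).and fun _ =>
      (Gd.nonzero (Ev.detBit hN (Ev.pw 4 (by norm_num)) hz h45 hz')).and fun _ =>
      (Gd.nonzero (Ev.ld (by norm_num) hz (lt_array hN (by norm_num) hz'))).not.and fun _ =>
      (Gd.nonzero (Ev.detBit hN hy hz (hy'.trans h45) hz')).not, hy,
      lt_array hN (by norm_num) hy'⟩).mono ?_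
  rintro σ₂ ⟨h3, h4⟩
  refine ⟨fun t ht6 ht7 => (h3 t ht7).trans (h1 t ht6), fun x hx => ?_⟩
  rw [h4 x, h1 7 (by norm_num), h7, h1 2 (by norm_num), h1 4 (by norm_num)]
  constructor
  · rintro (⟨-, -, y, hy, z, hz, ⟨e1, e2, e3, e4⟩, rfl⟩ | h)
    · exact ⟨e1, z, hz, fun h => e2 ((hbit _ h45 z hz).2 h), (hmark z hz).1 (not_ne_iff.1 e3),
        (hbit _ (hy.trans h45) z hz).1 (not_ne_iff.1 e4)⟩
    · exact absurd rfl h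
  · rintro ⟨e1, z, hz, e2, e3, e4⟩
    exact .inl ⟨0, pow_pos (by omega) 2, x, hx, z, hz, ⟨e1,
      fun h => e2 ((hbit _ h45 z hz).1 h), not_ne_iff.2 ((hmark z hz).2 e3),
      not_ne_iff.2 ((hbit _ (hx.trans h45) z hz).2 e4)⟩, rfl⟩

/-! ### Verification -/

namespace Prog

/-- Mark conflicts between selected edges. -/
def checkConflicts : Prog :=
  .put 8 ((Expr.eq (.dg 4 2) (.dg 2 2)).not.and
    (((Expr.ld 7 (.ix 2 (.dg 4 2) (.dg 0 2))).and (.ld 7 (.ix 2 (.dg 2 2) (.dg 0 2)))).or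
    ((Expr.ld 7 (.ix 2 (.dg 0 2) (.dg 4 2))).and (.ld 7 (.ix 2 (.dg 0 2) (.dg 2 2))))))
    (.const 0) (.const 1)

/-- Mark the matched rows and columns. -/
def markRows : Prog := .put 9 (.ld 7 (.ix 2 (.dg 2 2) (.dg 0 2))) (.dg 2 2) (.const 1)

def markCols : Prog := .put 10 (.ld 7 (.ix 2 (.dg 2 2) (.dg 0 2))) (.dg 0 2) (.const 1)

/-- The alternating paths of length at most two between rows. -/
def initReach : Prog :=
  .put 11 ((Expr.eq (.dg 4 2) (.dg 2 2)).or ((Expr.ld 2 (.ix 2 (.dg 4 2) (.dg 0 2))).and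
    (.ld 7 (.ix 2 (.dg 2 2) (.dg 0 2))))) (.ix 2 (.dg 4 2) (.dg 2 2)) (.const 1)

def closeReach : Prog :=
  .doubling 18 (.put 11 ((Expr.ld 11 (.ix 2 (.dg 4 2) (.dg 0 2))).and
    (.ld 11 (.ix 2 (.dg 0 2) (.dg 2 2)))) (.ix 2 (.dg 4 2) (.dg 2 2)) (.const 1))

/-- Mark augmenting paths. -/
def checkAugmenting : Prog :=
  .put 8 ((Expr.ld 9 (.dg 4 2)).not.and <| (Expr.ld 11 (.ix 2 (.dg 4 2) (.dg 2 2))).and <|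
    (Expr.ld 2 (.ix 2 (.dg 2 2) (.dg 0 2))).and (Expr.ld 10 (.dg 0 2)).not) (.const 0) (.const 1)

def verify : Prog :=
  .seq checkConflicts <| .seq markRows <| .seq markCols <| .seq initReach <|
  .seq closeReach checkAugmenting

end Prog

/-- An alternating path of length two, from `i` to `j`. -/
def AltStep (n : ℕ) (E X : ℕ → ℕ → Prop) (i j : ℕ) : Prop :=
  i < n ∧ j < n ∧ ∃ s < n, E i s ∧ X j s

/-- Two different edges in `X` are not disjoint, or there is an augmenting path. -/
def Defective (n : ℕ) (E X : ℕ → ℕ → Prop) : Prop :=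
  (∃ x < n, ∃ y < n, ∃ z < n, x ≠ y ∧ (X x z ∧ X y z ∨ X z x ∧ X z y)) ∨
  ∃ i < n, ∃ j < n, ∃ s < n, (∀ s' < n, ¬ X i s') ∧ Relation.ReflTransGen (AltStep n E X) i j ∧
    E j s ∧ ∀ i' < n, ¬ X i' s

/-- Composing the relation with itself doubles the admitted number of steps, and N² steps exhaust
all paths. -/
theorem trans_closeReach (hN : 2 ≤ N) (hJ : N ^ 16 ≤ 2 ^ J) {r : ℕ → ℕ → Prop}
    (hr : ∀ i k, r i k → k < N ^ 2)
    (h11 : ∀ i < N ^ 2, ∀ k < N ^ 2, σ 11 (i * N ^ 2 + k) ≠ 0 ↔ i = k ∨ r i k) :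
    Trans N ω J .closeReach σ fun σ' => (∀ t, t ≠ 11 → t ≠ 18 → σ' t = σ t) ∧
      ∀ i < N ^ 2, ∀ k < N ^ 2, σ' 11 (i * N ^ 2 + k) ≠ 0 ↔ Relation.ReflTransGen r i k := by
  have hld : ∀ {σ p x y ex ey tag}, tag < 32 → Ev N ω σ p ex x → Ev N ω σ p ey y → x < N ^ 2 →
      y < N ^ 2 → Ev N ω σ p (.ld tag (.ix 2 ex ey)) (σ tag (x * N ^ 2 + y)) :=
    fun ht hx hy hx' hy' => Ev.ld ht (Ev.ix (k := 2) hx hy hx' hy' (by norm_num))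
      (lt_array hN (by norm_num) (mul_pow_add_lt (k := 2) hx' hy'))
  refine (Trans.doubling (ct := 18) (by norm_num) (by norm_num) hJ (fun j σ' =>
    (∀ t, t ≠ 11 → t ≠ 18 → σ' t = σ t) ∧ ∀ i < N ^ 2, ∀ k < N ^ 2,
      σ' 11 (i * N ^ 2 + k) ≠ 0 ↔ Within r (2 ^ j) i k) ?_ ?_ ?_).mono ?_
  · rintro j σ₁ σ₂ h ⟨h1, h2⟩
    refine ⟨fun t ht11 ht => (h t ht).trans (h1 t ht11 ht), fun i hi k hk => ?_⟩
    rw [h 11 (by norm_num)]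
    exact h2 i hi k hk
  · rintro j σ₁ _ hc ⟨h1, h2⟩
    refine (trans_triple (G := fun x y z => σ₁ 11 (x * N ^ 2 + z) ≠ 0 ∧ σ₁ 11 (z * N ^ 2 + y) ≠ 0)
      (H := fun x y _ => x * N ^ 2 + y) hN 2 2 2 (by norm_num) (by norm_num) (by norm_num)
      fun p x y z hx hy hz hx' hy' hz' => ⟨(Gd.nonzero (hld (by norm_num) hx hz hx' hz')).and
        fun _ => Gd.nonzero (hld (by norm_num) hz hy hz' hy'),
        Ev.ix (k := 2) hx hy hx' hy' (by norm_num),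
        lt_array hN (by norm_num) (mul_pow_add_lt (k := 2) hx' hy')⟩).mono ?_
    rintro σ₂ ⟨h3, h4⟩
    refine ⟨⟨fun t ht11 ht => (h3 t ht11).trans (h1 t ht11 ht), fun i hi k hk => ?_⟩, ?_⟩
    · rw [h4, h2 i hi k hk, show 2 ^ (j + 1) = 2 ^ j + 2 ^ j by rw [pow_succ, mul_two], within_add]
      constructor
      · rintro (⟨x, hx, y, hy, z, hz, ⟨e1, e2⟩, he⟩ | h)
        · have e3 := congrArg (· / N ^ 2) he
          have e4 := congrArg (· % N ^ 2) he
          simp only [mul_add_div_of_lt hy, mul_add_div_of_lt hk, mul_add_mod_of_lt hy,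
            mul_add_mod_of_lt hk] at e3 e4
          subst e3 e4
          exact ⟨z, (h2 x hx z hz).1 e1, (h2 z hz y hy).1 e2⟩
        · exact ⟨k, h, within_mono (Nat.zero_le _) rfl⟩
      · rintro ⟨c, e1, e2⟩
        have hc := e1.lt hr hi
        exact .inl ⟨i, hi, k, hk, c, hc, ⟨(h2 i hi c hc).2 e1, (h2 c hc k hk).2 e2⟩, rfl⟩
    · rw [h3 18 (by norm_num), hc]
  · refine ⟨fun _ _ _ => rfl, fun i hi k hk => ?_⟩
    rw [pow_zero, within_one]
    exact h11 i hi k hk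
  · rintro σ' ⟨j, hj, h1, h2⟩
    refine ⟨h1, fun i hi k hk => (h2 i hi k hk).trans ⟨Within.reflTransGen, fun h => ?_⟩⟩
    have : N ^ 2 < N ^ 16 := pow_lt_pow_of_two_le hN (by norm_num)
    exact within_mono (by omega) (within_of_reflTransGen hr hi h)

/-- The flag tests the selection itself and not how it came about: disjoint edges without an
augmenting path form a maximum matching by Berge's criterion. Correctness of the output rests on
this test alone. -/
theorem trans_verify (hN : 2 ≤ N) (hJ : N ^ 16 ≤ 2 ^ J) (h8 : ∀ x, σ 8 x = 0) (h9 : ∀ x, σ 9 x = 0)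
    (h10 : ∀ x, σ 10 x = 0) (h11 : ∀ x, σ 11 x = 0) :
    Trans N ω J .verify σ fun σ' =>
      (∀ t, t ≠ 8 → t ≠ 9 → t ≠ 10 → t ≠ 11 → t ≠ 18 → σ' t = σ t) ∧
      (σ' 8 0 ≠ 0 ↔ Defective (N ^ 2) (fun i s => σ 2 (i * N ^ 2 + s) ≠ 0)
        fun i s => σ 7 (i * N ^ 2 + s) ≠ 0) := by
  have hld : ∀ {σ p x y ex ey tag}, tag < 32 → Ev N ω σ p ex x → Ev N ω σ p ey y → x < N ^ 2 →
      y < N ^ 2 → Ev N ω σ p (.ld tag (.ix 2 ex ey)) (σ tag (x * N ^ 2 + y)) :=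
    fun ht hx hy hx' hy' => Ev.ld ht (Ev.ix (k := 2) hx hy hx' hy' (by norm_num))
      (lt_array hN (by norm_num) (mul_pow_add_lt (k := 2) hx' hy'))
  have hpos : 0 < N ^ 53 := pow_pos (by omega) 53
  have hpos2 : 0 < N ^ 2 := pow_pos (by omega) 2
  have hlt2 : ∀ {x}, x < N ^ 2 → x < N ^ 53 := fun hx => lt_array hN (by norm_num) hx
  refine (trans_triple (G := fun x y z => ¬ x = y ∧ (σ 7 (x * N ^ 2 + z) ≠ 0 ∧
    σ 7 (y * N ^ 2 + z) ≠ 0 ∨ σ 7 (z * N ^ 2 + x) ≠ 0 ∧ σ 7 (z * N ^ 2 + y) ≠ 0))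
    (H := fun _ _ _ => 0) hN 2 2 2 (by norm_num) (by norm_num) (by norm_num)
    fun p x y z hx hy hz hx' hy' hz' => ⟨(Gd.eq hx hy).not.and fun _ =>
      ((Gd.nonzero (hld (by norm_num) hx hz hx' hz')).and fun _ =>
        Gd.nonzero (hld (by norm_num) hy hz hy' hz')).or
      ((Gd.nonzero (hld (by norm_num) hz hx hz' hx')).and fun _ =>
        Gd.nonzero (hld (by norm_num) hz hy hz' hy')), Ev.const 0 (by norm_num), hpos⟩).seq ?_
  rintro σ₁ ⟨a1, b1⟩
  refine (trans_triple (G := fun x y z => σ₁ 7 (y * N ^ 2 + z) ≠ 0) (H := fun _ y _ => y) hN 2 2 2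
    (by norm_num) (by norm_num) (by norm_num) fun p x y z hx hy hz hx' hy' hz' =>
    ⟨Gd.nonzero (hld (by norm_num) hy hz hy' hz'), hy, hlt2 hy'⟩).seq ?_
  rintro σ₂ ⟨a2, b2⟩
  refine (trans_triple (G := fun x y z => σ₂ 7 (y * N ^ 2 + z) ≠ 0) (H := fun _ _ z => z) hN 2 2 2
    (by norm_num) (by norm_num) (by norm_num) fun p x y z hx hy hz hx' hy' hz' =>
    ⟨Gd.nonzero (hld (by norm_num) hy hz hy' hz'), hz, hlt2 hz'⟩).seq ?_
  rintro σ₃ ⟨a3, b3⟩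
  refine (trans_triple (G := fun x y z => x = y ∨ σ₃ 2 (x * N ^ 2 + z) ≠ 0 ∧
    σ₃ 7 (y * N ^ 2 + z) ≠ 0) (H := fun x y _ => x * N ^ 2 + y) hN 2 2 2
    (by norm_num) (by norm_num) (by norm_num) fun p x y z hx hy hz hx' hy' hz' =>
    ⟨(Gd.eq hx hy).or ((Gd.nonzero (hld (by norm_num) hx hz hx' hz')).and fun _ =>
      Gd.nonzero (hld (by norm_num) hy hz hy' hz')),
      Ev.ix (k := 2) hx hy hx' hy' (by norm_num),
      lt_array hN (by norm_num) (mul_pow_add_lt (k := 2) hx' hy')⟩).seq ?_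
  rintro σ₄ ⟨a4, b4⟩
  have c2 : σ₃ 2 = σ 2 := by
    rw [a3 _ (by norm_num), a2 _ (by norm_num), a1 _ (by norm_num)]
  have c7 : σ₃ 7 = σ 7 := by
    rw [a3 _ (by norm_num), a2 _ (by norm_num), a1 _ (by norm_num)]
  refine (trans_closeReach (r := AltStep (N ^ 2) (fun i s => σ 2 (i * N ^ 2 + s) ≠ 0)
        fun i s => σ 7 (i * N ^ 2 + s) ≠ 0) hN hJ (fun i k h => h.2.1) ?_).seq ?_
  · intro i hi k hk
    rw [b4, c2, c7, a3 11 (by norm_num), a2 11 (by norm_num), a1 11 (by norm_num), h11]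
    constructor
    · rintro (⟨x, hx, y, hy, z, hz, h, he⟩ | h)
      · have e3 := congrArg (· / N ^ 2) he
        have e4 := congrArg (· % N ^ 2) he
        simp only [mul_add_div_of_lt hy, mul_add_div_of_lt hk, mul_add_mod_of_lt hy,
          mul_add_mod_of_lt hk] at e3 e4
        subst e3 e4
        exact h.imp_right fun h => ⟨hx, hy, z, hz, h⟩
      · exact absurd rfl h
    · rintro (rfl | ⟨_, _, s, hs, h⟩)
      · exact .inl ⟨i, hi, i, hi, 0, hpos2, .inl rfl, rfl⟩
      · exact .inl ⟨i, hi, k, hk, s, hs, .inr h, rfl⟩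
  rintro σ₅ ⟨a5, b5⟩
  refine (trans_triple (G := fun x y z => ¬ σ₅ 9 x ≠ 0 ∧ σ₅ 11 (x * N ^ 2 + y) ≠ 0 ∧
    σ₅ 2 (y * N ^ 2 + z) ≠ 0 ∧ ¬ σ₅ 10 z ≠ 0) (H := fun _ _ _ => 0) hN 2 2 2
    (by norm_num) (by norm_num) (by norm_num) fun p x y z hx hy hz hx' hy' hz' =>
    ⟨(Gd.nonzero (Ev.ld (by norm_num) hx (hlt2 hx'))).not.and fun _ =>
      (Gd.nonzero (hld (by norm_num) hx hy hx' hy')).and fun _ =>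
      (Gd.nonzero (hld (by norm_num) hy hz hy' hz')).and fun _ =>
      (Gd.nonzero (Ev.ld (by norm_num) hz (hlt2 hz'))).not, Ev.const 0 (by norm_num), hpos⟩).mono ?_
  rintro σ₆ ⟨a6, b6⟩
  refine ⟨fun t t8 t9 t10 t11 t18 => by
    rw [a6 t t8, a5 t t11 t18, a4 t t11, a3 t t10, a2 t t9, a1 t t8], ?_⟩
  have d2 : σ₅ 2 = σ 2 := by rw [a5 _ (by norm_num) (by norm_num), a4 _ (by norm_num), c2]
  have d8 : σ₅ 8 = σ₁ 8 := by
    rw [a5 _ (by norm_num) (by norm_num), a4 _ (by norm_num), a3 _ (by norm_num),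
      a2 _ (by norm_num)]
  have d9 : ∀ x < N ^ 2, ¬ σ₅ 9 x ≠ 0 ↔ ∀ s' < N ^ 2, ¬ σ 7 (x * N ^ 2 + s') ≠ 0 := by
    intro x _
    rw [a5 _ (by norm_num) (by norm_num), a4 _ (by norm_num), a3 _ (by norm_num), b2,
      a1 9 (by norm_num), h9, a1 7 (by norm_num)]
    constructor
    · intro h s' hs' hX
      exact h (.inl ⟨0, hpos2, x, by assumption, s', hs', hX, rfl⟩)
    · rintro h (⟨-, -, y, hy, z, hz, hX, rfl⟩ | h')
      · exact h z hz hX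
      · exact h' rfl
  have d10 : ∀ z < N ^ 2, ¬ σ₅ 10 z ≠ 0 ↔ ∀ i' < N ^ 2, ¬ σ 7 (i' * N ^ 2 + z) ≠ 0 := by
    intro z _
    rw [a5 _ (by norm_num) (by norm_num), a4 _ (by norm_num), b3,
      a2 10 (by norm_num), a1 10 (by norm_num), h10, a2 7 (by norm_num), a1 7 (by norm_num)]
    constructor
    · intro h i' hi' hX
      exact h (.inl ⟨0, hpos2, i', hi', z, by assumption, hX, rfl⟩)
    · rintro h (⟨-, -, y, hy, z, hz, hX, rfl⟩ | h')
      · exact h y hy hX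
      · exact h' rfl
  rw [b6, d8, b1, h8, Defective, or_comm]
  refine or_congr ⟨?_, ?_⟩ ⟨?_, ?_⟩
  · rintro (⟨x, hx, y, hy, z, hz, h, -⟩ | h)
    · exact ⟨x, hx, y, hy, z, hz, h⟩
    · exact absurd rfl h
  · rintro ⟨x, hx, y, hy, z, hz, h⟩
    exact .inl ⟨x, hx, y, hy, z, hz, h, rfl⟩
  · rintro ⟨x, hx, y, hy, z, hz, ⟨e1, e2, e3, e4⟩, -⟩
    refine ⟨x, hx, y, hy, z, hz, (d9 x hx).1 e1, (b5 x hx y hy).1 e2, ?_, (d10 z hz).1 e4⟩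
    rwa [d2] at e3
  · rintro ⟨x, hx, y, hy, z, hz, e1, e2, e3, e4⟩
    refine ⟨x, hx, y, hy, z, hz, ⟨(d9 x hx).2 e1, (b5 x hx y hy).2 e2, ?_, (d10 z hz).2 e4⟩, rfl⟩
    rwa [d2]

end Stages

end PVER2HK

namespace PVER2HK

/-! ### The allocation of the remaining subchannels -/

open Finset

/-- Ranks are strictly increasing in the order, hence injective, and so run exactly through 0, …,
|A| - 1. -/
theorem card_filter_rank_lt {A : Finset ℕ} {ord : ℕ → ℕ} (hord : Set.InjOn ord A) {r : ℕ}
    (hr : r ≤ #A) : #{s ∈ A | #{s' ∈ A | ord s' < ord s} < r} = r := by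
  set rk : ℕ → ℕ := fun s => #{s' ∈ A | ord s' < ord s} with hrk
  have hlt : ∀ s ∈ A, ∀ s' ∈ A, ord s < ord s' → rk s < rk s' := by
    intro s hs s' _ h
    refine card_lt_card (ssubset_iff_of_subset (fun x hx => ?_) |>.2 ⟨s, ?_, ?_⟩)
    · rw [mem_filter] at hx ⊢
      exact ⟨hx.1, hx.2.trans h⟩
    · exact mem_filter.2 ⟨hs, h⟩
    · simp
  have hinj : Set.InjOn rk A := by
    intro s hs s' hs' h
    by_contra hne
    rcases lt_or_gt_of_ne (fun he => hne (hord hs hs' he)) with h' | h'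
    · exact (hlt s hs s' hs' h').ne h
    · exact (hlt s' hs' s hs h').ne' h
  have himage : A.image rk = range #A := by
    refine eq_of_subset_of_card_le (fun x hx => ?_) ?_
    · obtain ⟨s, hs, rfl⟩ := mem_image.1 hx
      exact mem_range.2 (card_lt_card (filter_ssubset.2 ⟨s, hs, lt_irrefl _⟩))
    · rw [card_range, card_image_of_injOn hinj]
  have h1 : #{s ∈ A | rk s < r} = #({s ∈ A | rk s < r}.image rk) :=
    (card_image_of_injOn (hinj.mono (coe_subset.2 (filter_subset _ _)))).symm
  rw [h1, show {s ∈ A | rk s < r}.image rk = range r by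
    ext x
    rw [mem_image, mem_range]
    constructor
    · rintro ⟨s, hs, rfl⟩
      exact (mem_filter.1 hs).2
    · intro hx
      obtain ⟨s, hs, rfl⟩ := mem_image.1 (himage ▸ mem_range.2 (hx.trans_le hr))
      exact ⟨s, mem_filter.2 ⟨hs, hx⟩, rfl⟩, card_range]

/-- Counting the values up to `r` inverts a monotone function. It lets each free subchannel find its
user from its rank by one sum, without a sequential scan. -/
theorem card_filter_le_iff {M r : ℕ} {R : ℕ → ℕ} (hR : ∀ a b, a ≤ b → b < M → R a ≤ R b) {m : ℕ}
    (hm : m < M) : #{c ∈ range M | R c ≤ r} ≤ m ↔ r < R m := by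
  constructor
  · intro h
    by_contra hle
    have : range (m + 1) ⊆ {c ∈ range M | R c ≤ r} := fun c hc => by
      have hc' := mem_range.1 hc
      exact mem_filter.2 ⟨mem_range.2 (by omega), (hR c m (by omega) hm).trans (not_lt.1 hle)⟩
    have := card_le_card this
    rw [card_range] at this
    omega
  · intro h
    have : {c ∈ range M | R c ≤ r} ⊆ range m := fun c hc => by
      obtain ⟨hc1, hc2⟩ := mem_filter.1 hc
      rw [mem_range] at hc1 ⊢
      by_contra hle
      have := hR m c (not_lt.1 hle) hc1
      omega
    simpa using card_le_card this

/-- The demands of the users up to `m`. -/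
def demand (M : ℕ) (q : ℕ → ℕ) (m : ℕ) : ℕ := ∑ c ∈ range M with c ≤ m, q c

/-- The number of subchannels matched to users up to `m`. -/
def served (N : ℕ) (fo : ℕ → ℕ) (m : ℕ) : ℕ := #{s ∈ range N | fo s ≠ 0 ∧ fo s ≤ m + 1}

/-- The number of free subchannels before `s`. -/
def freeRank (N : ℕ) (fo ord : ℕ → ℕ) (s : ℕ) : ℕ := #{s' ∈ range N | fo s' = 0 ∧ ord s' < ord s}

/-- The user that receives the subchannel `s`; here `fo` is one more than the matched user. -/
def allot (M N : ℕ) (q fo ord : ℕ → ℕ) (s : ℕ) : ℕ :=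
  if fo s ≠ 0 then fo s - 1
  else #{c ∈ range M | demand M q c - served N fo c ≤ freeRank N fo ord s}

section Allot

variable {M N : ℕ} {q fo ord : ℕ → ℕ}

theorem demand_eq {m : ℕ} (hm : m < M) : demand M q m = ∑ c ∈ range (m + 1), q c := by
  unfold demand
  congr 1
  ext c
  simp only [mem_filter, mem_range]
  omega

theorem served_succ (m : ℕ) :
    served N fo (m + 1) = served N fo m + #{s ∈ range N | fo s = m + 1 + 1} := by
  unfold served
  rw [← card_union_of_disjoint]
  · congr 1
    ext s
    simp only [mem_union, mem_filter, mem_range]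
    omega
  · rw [disjoint_filter]
    omega

theorem served_zero : served N fo 0 = #{s ∈ range N | fo s = 1} := by
  unfold served
  congr 1
  ext s
  simp only [mem_filter, mem_range]
  omega

theorem served_le (hfo : ∀ m < M, #{s ∈ range N | fo s = m + 1} ≤ q m) :
    ∀ m < M, served N fo m ≤ demand M q m := by
  intro m
  induction m with
  | zero =>
    intro hm
    rw [demand_eq hm, served_zero]
    simpa using hfo 0 hm
  | succ m ih =>
    intro hm
    have := ih (by omega)
    have h1 := hfo (m + 1) hm
    rw [demand_eq (by omega)] at this
    rw [served_succ, demand_eq hm, sum_range_succ]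
    omega

/-- No user is matched to more subchannels than it demands, so truncated subtraction is exact and
each further user can only add to the cumulative deficit. -/
theorem deficit_mono (hfo : ∀ m < M, #{s ∈ range N | fo s = m + 1} ≤ q m) (a b : ℕ) (hab : a ≤ b)
    (hb : b < M) : demand M q a - served N fo a ≤ demand M q b - served N fo b := by
  induction b, hab using Nat.le_induction with
  | base => exact le_rfl
  | succ b _ ih =>
    refine (ih (by omega)).trans ?_
    have h1 := hfo (b + 1) hb
    rw [served_succ, demand_eq hb, demand_eq (show b < M by omega), sum_range_succ _ (b + 1)]
    omega

/-- The users up to `m` hold their matched subchannels and the free ones of rank below their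
cumulative deficit; the two counts add up to the demand. -/
theorem card_allot_le (hsum : ∑ m ∈ range M, q m = N)
    (hfo : ∀ m < M, #{s ∈ range N | fo s = m + 1} ≤ q m) (hM : ∀ s < N, fo s ≤ M)
    (hord : Set.InjOn ord (range N)) {m : ℕ} (hm : m < M) :
    #{s ∈ range N | allot M N q fo ord s ≤ m} = demand M q m := by
  set A : Finset ℕ := {s ∈ range N | fo s = 0} with hA
  have hAcard : ∀ m < M, demand M q m - served N fo m ≤ #A := by
    intro m hm
    refine (deficit_mono hfo m (M - 1) (by omega) (by omega)).trans ?_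
    rw [demand_eq (by omega), show M - 1 + 1 = M by omega, hsum]
    have h1 : served N fo (M - 1) = #{s ∈ range N | ¬ fo s = 0} := by
      unfold served
      congr 1
      ext s
      simp only [mem_filter, mem_range]
      constructor
      · rintro ⟨h1, h2, -⟩
        exact ⟨h1, h2⟩
      · rintro ⟨h1, h2⟩
        have := hM s h1
        exact ⟨h1, h2, by omega⟩
    have h2 := card_filter_add_card_filter_not (s := range N) (fun s => fo s = 0)
    rw [card_range, ← hA] at h2
    omega
  have hrk : ∀ s, freeRank N fo ord s = #{s' ∈ A | ord s' < ord s} := fun s => by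
    rw [freeRank, hA, filter_filter]
  have hsplit : {s ∈ range N | allot M N q fo ord s ≤ m} =
      {s ∈ range N | fo s ≠ 0 ∧ fo s ≤ m + 1} ∪
      {s ∈ A | #{s' ∈ A | ord s' < ord s} < demand M q m - served N fo m} := by
    ext s
    rw [mem_union, mem_filter, mem_filter, mem_filter, ← hrk,
      ← card_filter_le_iff (deficit_mono hfo) hm, hA, mem_filter, allot]
    by_cases h : fo s = 0
    · simp [h]
    · have : fo s - 1 ≤ m ↔ fo s ≤ m + 1 := by omega
      simp [this, h]
  rw [hsplit, card_union_of_disjoint, card_filter_rank_lt _ (hAcard m hm)]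
  · have := served_le hfo m hm
    unfold served at *
    omega
  · exact hord.mono (coe_subset.2 (filter_subset _ _))
  · rw [disjoint_left]
    intro s h1 h2
    exact (mem_filter.1 h1).2.1 (mem_filter.1 (mem_filter.1 h2).1).2

theorem allot_lt (hsum : ∑ m ∈ range M, q m = N)
    (hfo : ∀ m < M, #{s ∈ range N | fo s = m + 1} ≤ q m) (hM : ∀ s < N, fo s ≤ M)
    (hord : Set.InjOn ord (range N)) (hpos : 0 < M) {s : ℕ} (hs : s < N) :
    allot M N q fo ord s < M := by
  have h := card_allot_le hsum hfo hM hord (show M - 1 < M by omega)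
  rw [demand_eq (by omega), show M - 1 + 1 = M by omega, hsum] at h
  have h' : {s ∈ range N | allot M N q fo ord s ≤ M - 1} = range N :=
    eq_of_subset_of_card_le (filter_subset _ _) (by rw [card_range, h])
  have h3 := mem_range.2 hs
  rw [← h'] at h3
  have := (mem_filter.1 h3).2
  omega

theorem card_allot_eq (hsum : ∑ m ∈ range M, q m = N)
    (hfo : ∀ m < M, #{s ∈ range N | fo s = m + 1} ≤ q m) (hM : ∀ s < N, fo s ≤ M)
    (hord : Set.InjOn ord (range N)) {m : ℕ} (hm : m < M) :
    #{s ∈ range N | allot M N q fo ord s = m} = q m := by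
  have h := card_allot_le hsum hfo hM hord hm
  cases m with
  | zero =>
    rw [demand_eq hm] at h
    simpa using h
  | succ m =>
    have h' := card_allot_le hsum hfo hM hord (show m < M by omega)
    have hsplit : {s ∈ range N | allot M N q fo ord s ≤ m + 1} =
        {s ∈ range N | allot M N q fo ord s ≤ m} ∪
          {s ∈ range N | allot M N q fo ord s = m + 1} := by
      ext s
      simp only [mem_union, mem_filter, mem_range]
      omega
    rw [hsplit, card_union_of_disjoint, h', demand_eq hm, demand_eq (by omega),
      sum_range_succ _ (m + 1)] at h
    · omega
    · rw [disjoint_filter]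
      omega

theorem allot_mono {s s' : ℕ} (hs : fo s = 0) (hs' : fo s' = 0) (h : ord s ≤ ord s') :
    allot M N q fo ord s ≤ allot M N q fo ord s' := by
  simp only [allot, hs, hs', ne_eq, not_true_eq_false, if_false]
  refine card_le_card fun c hc => ?_
  obtain ⟨h1, h2⟩ := mem_filter.1 hc
  refine mem_filter.2 ⟨h1, h2.trans (card_le_card fun x hx => ?_)⟩
  obtain ⟨h3, h4, h5⟩ := mem_filter.1 hx
  exact mem_filter.2 ⟨h3, h4, h5.trans_le h⟩

end Allot

end PVER2HK

namespace PVER2HK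

/-! ### The output -/

namespace Expr

def block : Expr := dg 16 37

def summand : Expr := dg 0 16

def demandTerm : Expr :=
  ((lt summand users).and (le summand block)).guard (ld 0 (add (add (const 2) users) summand))

def servedTerm : Expr :=
  ((lt summand (pw 1)).and <| (ld 12 summand).and <|
    le (ld 12 summand) (add block (const 1))).guard (const 1)

/-- The place of the subchannel `s` in the random order. -/
def place (s : Expr) : Expr :=
  ld 0 (add (add (add (const 2) (mul (const 2) users)) (mul users (pw 1))) s)

def rankTerm : Expr :=
  ((lt block (pw 1)).and <| (lt summand (pw 1)).and <| (ld 12 summand).not.and <|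
    lt (place summand) (place block)).guard (const 1)

def allotTerm : Expr :=
  ((lt summand users).and <| (lt block (pw 1)).and <|
    le (sub (ld 13 summand) (ld 14 summand)) (ld 15 block)).guard (const 1)

/-- The contents of the output cells. -/
def result : Expr :=
  add ((lt pid (pw 1)).guard (ld 12 pid))
    ((lt pid (pw 1)).not.guard (add
      ((ld 12 (sub pid (pw 1))).guard (sub (ld 12 (sub pid (pw 1))) (const 1)))
      ((ld 12 (sub pid (pw 1))).not.guard (ld 16 (sub pid (pw 1))))))

end Expr

/-- For each matched subchannel, write one more than the matched user. -/
def Prog.matched : Prog :=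
  .put 12 ((Expr.lt .pid (.pw 4)).and (.ld 7 .pid)) (.dg 0 2) (.add (.dg 3 1) (.const 1))

def Prog.allocate : Prog :=
  .seq (.sum 13 .demandTerm) <| .seq (.sum 14 .servedTerm) <| .seq (.sum 15 .rankTerm) <|
  .sum 16 .allotTerm

def Prog.output : Prog := .par (.lt .pid (.mul (.const 2) (.pw 1))) .pid .result

section Stages

variable {N : ℕ} {ω : ℕ → ℕ} {J : ℕ} {σ : ℕ → ℕ → ℕ}

open Classical in
-- The hypothesis on `U` says that all selected rows of a column belong to the same user, so
-- concurrent writes agree.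
theorem trans_matched (hN : 2 ≤ N) (h12 : ∀ x, σ 12 x = 0) {U : ℕ → ℕ}
    (hU : ∀ i < N ^ 2, ∀ s < N ^ 2, σ 7 (i * N ^ 2 + s) ≠ 0 → U s = i / N + 1) :
    Trans N ω J .matched σ fun σ' => (∀ t, t ≠ 12 → σ' t = σ t) ∧
      ∀ s < N ^ 2, σ' 12 s = if ∃ i < N ^ 2, σ 7 (i * N ^ 2 + s) ≠ 0 then U s else 0 := by
  have h2 : 0 < N ^ 2 := pow_pos (by omega) 2
  have hdiv : ∀ p < N ^ 4, p / N ^ 2 < N ^ 2 := fun p hp =>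
    Nat.div_lt_of_lt_mul (by rw [← pow_add]; exact hp)
  refine (Trans.put (G := fun p => p < N ^ 4 ∧ σ 7 p ≠ 0) (H := fun p => p % N ^ 2)
    (V := fun p => p / N ^ 3 % N ^ 1 + 1) (U := U) (by norm_num) (by norm_num) (fun p hp =>
    (Gd.lt Ev.pid (Ev.pw 4 (by norm_num))).and fun _ => Gd.nonzero (Ev.ld (by norm_num) Ev.pid hp))
    (fun p _ _ => ?_) (fun p _ _ => lt_array hN (by norm_num) (Nat.mod_lt p h2)) (fun p _ _ => ?_)
    fun p _ hp => ?_).mono ?_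
  · have := Ev.dg (N := N) (ω := ω) (σ := σ) (p := p) (k := 0) (l := 2) (by norm_num)
      (by norm_num)
    rwa [pow_zero, Nat.div_one] at this
  · have h1 := Nat.mod_lt (p / N ^ 3) (show 0 < N ^ 1 from pow_pos (by omega) 1)
    have h3 : N ^ 1 < N ^ 58 := pow_lt_pow_of_two_le hN (by norm_num)
    exact Ev.add (Ev.dg (by norm_num) (by norm_num)) (Ev.const 1 (by norm_num)) (by omega)
  · have h1 := hU _ (hdiv p hp.1) _ (Nat.mod_lt p h2) (by rw [Nat.div_add_mod']; exact hp.2)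
    show p / N ^ 3 % N ^ 1 + 1 = U (p % N ^ 2)
    rw [h1, Nat.div_div_eq_div_mul, show N ^ 2 * N = N ^ 3 by ring, pow_one, Nat.mod_eq_of_lt]
    exact Nat.div_lt_of_lt_mul (by rw [← pow_succ]; exact hp.1)
  · rintro σ' rfl
    refine ⟨fun t ht => Function.update_of_ne ht _ _, fun s hs => ?_⟩
    rw [Function.update_self, h12]
    by_cases h : ∃ i < N ^ 2, σ 7 (i * N ^ 2 + s) ≠ 0
    · rw [if_pos h]
      obtain ⟨i, hi, h⟩ := h
      have hlt := mul_pow_add_lt (k := 2) (l := 2) hi hs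
      exact if_pos ⟨_, lt_array hN (by norm_num) hlt, ⟨hlt, h⟩, mul_add_mod_of_lt hs⟩
    · rw [if_neg h, if_neg]
      rintro ⟨p, _, ⟨hp4, hp⟩, rfl⟩
      exact h ⟨_, hdiv p hp4, by rwa [Nat.div_add_mod']⟩

theorem sum_range_guard {K L : ℕ} (h : K ≤ L) (P : ℕ → Prop) [DecidablePred P] (f : ℕ → ℕ) :
    ∑ c ∈ Finset.range L, (if c < K ∧ P c then f c else 0) =
      ∑ c ∈ Finset.range K with P c, f c := by
  rw [← Finset.sum_filter]
  congr 1
  ext c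
  simp only [Finset.mem_filter, Finset.mem_range]
  constructor
  · rintro ⟨_, h⟩
    exact h
  · rintro ⟨h1, h2⟩
    exact ⟨by omega, h1, h2⟩

theorem card_filter_range_le (K : ℕ) (P : ℕ → Prop) [DecidablePred P] :
    ((Finset.range K).filter P).card ≤ K :=
  (Finset.card_filter_le _ _).trans (Finset.card_range K).le

/-- Demands, served requests, ranks and users are each sums over one index, so four calls of the
parallel summation suffice; guards confine the N^16 summands to the real range. -/
theorem trans_allocate (hN : 2 ≤ N) (hJ : N ^ 16 ≤ 2 ^ J) {M : ℕ} (hM : M ≤ N) (h1 : σ 0 1 = M)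
    {q fo ord : ℕ → ℕ} (hq : ∀ m < M, σ 0 (2 + M + m) = q m)
    (hsum : ∑ m ∈ Finset.range M, q m = N)
    (hfo : ∀ s < N, σ 12 s = fo s)
    (hord : ∀ s < N, σ 0 (2 + 2 * M + M * N + s) = ord s) :
    Trans N ω J .allocate σ fun σ' => σ' 12 = σ 12 ∧ σ' 0 = σ 0 ∧ ∀ s < N,
      σ' 16 s = ((Finset.range M).filter fun c => demand M q c - served N fo c ≤
        freeRank N fo ord s).card := by
  have hN16 : N ≤ N ^ 16 := Nat.le_self_pow (by norm_num) N
  have hN37 : N ≤ N ^ 37 := Nat.le_self_pow (by norm_num) N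
  have hN16pos : 0 < N ^ 16 := pow_pos (by omega) 16
  have hN0 : 0 < N := by omega
  have hQ : N ^ 53 < N ^ 58 := pow_lt_pow_of_two_le hN (by norm_num)
  have h53 : ∀ {x}, x < N → x < N ^ 53 := fun hx =>
    lt_array hN (k := 1) (by norm_num) (by simpa using hx)
  have hone : (1 : ℕ) ≤ N ^ 16 := hN16pos
  have hone' := one_lt_words hN
  have hu : ∀ {σ' : ℕ → ℕ → ℕ}, σ' 0 = σ 0 → ∀ p, Ev N ω σ' p .users M := fun h p => by
    rw [← h1, ← h]
    exact Ev.ld (by norm_num) (Ev.const 1 (by norm_num))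
      (lt_of_lt_of_le (by norm_num) (two_pow_le_pow hN 53))
  have hblock : ∀ (σ' : ℕ → ℕ → ℕ) p, Ev N ω σ' p .block (p / N ^ 16 % N ^ 37) := fun _ _ =>
    Ev.dg (by norm_num) (by norm_num)
  have hsummand : ∀ (σ' : ℕ → ℕ → ℕ) p, Ev N ω σ' p .summand (p / N ^ 0 % N ^ 16) := fun _ _ =>
    Ev.dg (by norm_num) (by norm_num)
  have hpw : ∀ (σ' : ℕ → ℕ → ℕ) p, Ev N ω σ' p (.pw 1) N := fun σ' p => by
    have := Ev.pw (N := N) (ω := ω) (σ := σ') (p := p) 1 (by norm_num)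
    rwa [pow_one] at this
  have hplace : ∀ {σ' : ℕ → ℕ → ℕ}, σ' 0 = σ 0 → ∀ p e s, s < N → Ev N ω σ' p e s →
      Ev N ω σ' p (.place e) (ord s) := fun {σ'} h p e s hs he => by
    have hb := (size_bound hN hM hN0 hs).2.2
    rw [← hord s hs, ← h]
    refine Ev.ld (by norm_num) (Ev.add (Ev.add (Ev.add (Ev.const 2 (by norm_num)) (Ev.mul
      (Ev.const 2 (by norm_num)) (hu h p) ?_) ?_) (Ev.mul (hu h p) (hpw σ' p) ?_) ?_) he ?_) hb <;>
      omega
  have hcoord : ∀ x < N ^ 37, ∀ c < N ^ 16, (x * N ^ 16 + c) / N ^ 16 % N ^ 37 = x ∧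
      (x * N ^ 16 + c) / N ^ 0 % N ^ 16 = c := fun x hx c hc => by
    rw [mul_add_div_of_lt hc, Nat.mod_eq_of_lt hx, pow_zero, Nat.div_one, mul_add_mod_of_lt hc]
    exact ⟨rfl, rfl⟩
  have hqle : ∀ m < M, q m ≤ N := fun m hm => by
    rw [← hsum]
    exact Finset.single_le_sum (f := q) (fun _ _ => Nat.zero_le _) (Finset.mem_range.2 hm)
  have hle : ∀ (G : Prop) [Decidable G], (if G then 1 else 0) ≤ N ^ 16 := fun G => by
    split_ifs <;> omega
  -- The demands.
  refine (Trans.sum (F := fun p => if p / N ^ 0 % N ^ 16 < M ∧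
    p / N ^ 0 % N ^ 16 ≤ p / N ^ 16 % N ^ 37 then q (p / N ^ 0 % N ^ 16) else 0) (by norm_num)
    (by norm_num) hN hJ ?_ ?_).seq ?_
  · intro p hp
    refine Ev.guard ((Gd.lt (hsummand _ p) (hu rfl p)).and fun _ => Gd.le (hsummand _ p)
      (hblock _ p)) (fun h => ?_) fun h => ?_
    · have hb := (size_bound hN hM (h.1.trans_le hM) hN0).2.1
      have hb' := (Nat.le_add_right _ _).trans_lt hb
      rw [← hq _ h.1]
      refine Ev.ld (by norm_num) (Ev.add (Ev.add (Ev.const 2 (by norm_num)) (hu rfl p) ?_)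
        (hsummand _ p) ?_) hb <;> omega
    · exact (hqle _ h.1).trans_lt (lt_words hN (k := 2) (by norm_num) (by nlinarith))
  · intro p _
    split_ifs with h
    · exact (hqle _ h.1).trans hN16
    · omega
  rintro σ₁ ⟨a1, b1⟩
  have d1 : ∀ m < M, σ₁ 13 m = demand M q m := fun m hm => by
    rw [b1 m (by omega), demand, ← sum_range_guard (hM.trans hN16) (fun c => c ≤ m) q]
    refine Finset.sum_congr rfl fun c hc => ?_
    obtain ⟨e1, e2⟩ := hcoord m (by omega) c (Finset.mem_range.1 hc)
    rw [e1, e2]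
  -- The numbers of served requests.
  have f1 : ∀ s < N, σ₁ 12 s = fo s := fun s hs => by
    rw [a1 12 (by norm_num) (by norm_num) (by norm_num), hfo s hs]
  have hld12 : ∀ {σ' : ℕ → ℕ → ℕ}, (∀ s < N, σ' 12 s = fo s) → ∀ p e s, s < N →
      Ev N ω σ' p e s → Ev N ω σ' p (.ld 12 e) (fo s) := fun h p e s hs he => by
    rw [← h s hs]
    exact Ev.ld (by norm_num) he (h53 hs)
  have h37 : ∀ p, p / N ^ 16 % N ^ 37 + 1 < N ^ 58 := fun p => by
    have h1 := Nat.mod_lt (p / N ^ 16) (show 0 < N ^ 37 from pow_pos hN0 37)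
    have h2 : N ^ 37 < N ^ 58 := pow_lt_pow_of_two_le hN (by norm_num)
    omega
  refine (Trans.sum (F := fun p => if p / N ^ 0 % N ^ 16 < N ∧ (fo (p / N ^ 0 % N ^ 16) ≠ 0 ∧
    fo (p / N ^ 0 % N ^ 16) ≤ p / N ^ 16 % N ^ 37 + 1) then 1 else 0) (by norm_num)
    (by norm_num) hN hJ ?_ fun p _ => hle _).seq ?_
  · intro p hp
    refine Ev.guard ((Gd.lt (hsummand _ p) (hpw _ p)).and fun h => (Gd.nonzero
      (hld12 f1 p _ _ h (hsummand _ p))).and fun _ => Gd.le (hld12 f1 p _ _ h (hsummand _ p))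
      (Ev.add (hblock _ p) (Ev.const 1 (by norm_num)) (h37 p)))
      (fun h => Ev.const 1 (by norm_num)) fun _ => hone'
  rintro σ₂ ⟨a2, b2⟩
  have d2 : ∀ m < M, σ₂ 14 m = served N fo m := fun m hm => by
    rw [b2 m (by omega), served, Finset.card_eq_sum_ones,
      ← sum_range_guard hN16 (fun s => fo s ≠ 0 ∧ fo s ≤ m + 1) fun _ => 1]
    refine Finset.sum_congr rfl fun c hc => ?_
    obtain ⟨e1, e2⟩ := hcoord m (by omega) c (Finset.mem_range.1 hc)
    rw [e1, e2]
  have f2 : ∀ s < N, σ₂ 12 s = fo s := fun s hs => by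
    rw [a2 12 (by norm_num) (by norm_num) (by norm_num), f1 s hs]
  have c2 : σ₂ 0 = σ 0 := by
    rw [a2 0 (by norm_num) (by norm_num) (by norm_num),
      a1 0 (by norm_num) (by norm_num) (by norm_num)]
  -- The ranks.
  refine (Trans.sum (F := fun p => if p / N ^ 16 % N ^ 37 < N ∧ p / N ^ 0 % N ^ 16 < N ∧
    ¬ fo (p / N ^ 0 % N ^ 16) ≠ 0 ∧ ord (p / N ^ 0 % N ^ 16) < ord (p / N ^ 16 % N ^ 37) then 1
    else 0) (by norm_num) (by norm_num) hN hJ ?_ fun p _ => hle _).seq ?_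
  · intro p hp
    refine Ev.guard ((Gd.lt (hblock _ p) (hpw _ p)).and fun h => (Gd.lt (hsummand _ p)
      (hpw _ p)).and fun h' => (Gd.nonzero (hld12 f2 p _ _ h' (hsummand _ p))).not.and fun _ =>
      Gd.lt (hplace c2 p _ _ h' (hsummand _ p)) (hplace c2 p _ _ h (hblock _ p)))
      (fun h => Ev.const 1 (by norm_num)) fun _ => hone'
  rintro σ₃ ⟨a3, b3⟩
  have d3 : ∀ s < N, σ₃ 15 s = freeRank N fo ord s := fun s hs => by
    rw [b3 s (by omega), freeRank, Finset.card_eq_sum_ones,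
      ← sum_range_guard hN16 (fun s' => fo s' = 0 ∧ ord s' < ord s) fun _ => 1]
    refine Finset.sum_congr rfl fun c hc => ?_
    obtain ⟨e1, e2⟩ := hcoord s (by omega) c (Finset.mem_range.1 hc)
    rw [e1, e2]
    exact if_congr (by simp [hs]) rfl rfl
  have c3 : σ₃ 0 = σ 0 := by rw [a3 0 (by norm_num) (by norm_num) (by norm_num), c2]
  have d1' : ∀ m < M, σ₃ 13 m = demand M q m := fun m hm => by
    rw [a3 13 (by norm_num) (by norm_num) (by norm_num),
      a2 13 (by norm_num) (by norm_num) (by norm_num), d1 m hm]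
  have d2' : ∀ m < M, σ₃ 14 m = served N fo m := fun m hm => by
    rw [a3 14 (by norm_num) (by norm_num) (by norm_num), d2 m hm]
  -- The users.
  refine (Trans.sum (F := fun p => if p / N ^ 0 % N ^ 16 < M ∧ p / N ^ 16 % N ^ 37 < N ∧
    demand M q (p / N ^ 0 % N ^ 16) - served N fo (p / N ^ 0 % N ^ 16) ≤
      freeRank N fo ord (p / N ^ 16 % N ^ 37) then 1 else 0) (by norm_num) (by norm_num) hN hJ ?_
    fun p _ => hle _).mono ?_
  · intro p hp
    refine Ev.guard ((Gd.lt (hsummand _ p) (hu c3 p)).and fun h => (Gd.lt (hblock _ p)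
      (hpw _ p)).and fun h' => ?_) (fun h => Ev.const 1 (by norm_num)) fun _ => hone'
    rw [← d1' _ h, ← d2' _ h, ← d3 _ h']
    exact Gd.le (Ev.sub (Ev.ld (by norm_num) (hsummand _ p) (h53 (h.trans_le hM)))
      (Ev.ld (by norm_num) (hsummand _ p) (h53 (h.trans_le hM))))
      (Ev.ld (by norm_num) (hblock _ p) (h53 h'))
  rintro σ₄ ⟨a4, b4⟩
  refine ⟨?_, ?_, fun s hs => ?_⟩
  · rw [a4 12 (by norm_num) (by norm_num) (by norm_num),
      a3 12 (by norm_num) (by norm_num) (by norm_num),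
      a2 12 (by norm_num) (by norm_num) (by norm_num),
      a1 12 (by norm_num) (by norm_num) (by norm_num)]
  · rw [a4 0 (by norm_num) (by norm_num) (by norm_num), c3]
  · rw [b4 s (by omega), Finset.card_eq_sum_ones, ← sum_range_guard (hM.trans hN16)
      (fun c => demand M q c - served N fo c ≤ freeRank N fo ord s) fun _ => 1]
    refine Finset.sum_congr rfl fun c hc => ?_
    obtain ⟨e1, e2⟩ := hcoord s (by omega) c (Finset.mem_range.1 hc)
    rw [e1, e2]
    exact if_congr (by simp [hs]) rfl rfl

/-- The final step writes the matching and the allocation. -/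
theorem exec_output (hN : 2 ≤ N) {M : ℕ} {q fo ord : ℕ → ℕ} (hM : M ≤ N)
    (hfo : ∀ s < N, σ 12 s = fo s) (hfo' : ∀ s < N, fo s ≤ N) (hown : ∀ s < N, σ 16 s = ((Finset.range M).filter fun c =>
      demand M q c - served N fo c ≤ freeRank N fo ord s).card) {mem : ℕ → ℕ} (hr : Rep N mem σ) :
    ∃ mem' t, Exec (N ^ 58) ω .output mem mem' t ∧ t ≤ Prog.output.time J ∧
      ∀ s < N, mem' s = fo s ∧ mem' (N + s) = allot M N q fo ord s := by
  -- This step overwrites the input and with it the array invariant, so its result is read off the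
  -- memory cells directly.
  refine ⟨_, _, .par _ _ _ _, le_rfl, ?_⟩
  have h2 : 2 * N < N ^ 53 := by
    have : N ^ 2 < N ^ 53 := pow_lt_pow_of_two_le hN (by norm_num)
    nlinarith
  have hQ : N ^ 53 < N ^ 58 := pow_lt_pow_of_two_le hN (by norm_num)
  have hpw : ∀ p, Ev N ω σ p (.pw 1) N := fun p => by
    have := Ev.pw (N := N) (ω := ω) (σ := σ) (p := p) 1 (by norm_num)
    rwa [pow_one] at this
  have hcell : ∀ x < 2 * N, ∀ v, Ev N ω σ x .result v →
      parWrite (N ^ 58) ω mem (.lt .pid (.mul (.const 2) (.pw 1))) .pid .result x = v := by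
    intro x hx v hv
    have hex : ∃ p, p < N ^ 58 ∧
        (Expr.lt .pid (.mul (.const 2) (.pw 1))).eval (N ^ 58) ω mem p ≠ 0 ∧
        Expr.pid.eval (N ^ 58) ω mem p = x :=
      ⟨x, by omega,
        (Gd.lt Ev.pid (Ev.mul (Ev.const 2 (by norm_num)) (hpw x) (by omega)) mem hr).2 hx, rfl⟩
    unfold parWrite
    rw [dif_pos hex]
    have h3 : Nat.find hex = x := (Nat.find_spec hex).2.2
    rw [h3]
    exact hv mem hr
  have hld : ∀ {p s e}, s < N → Ev N ω σ p e s → Ev N ω σ p (.ld 12 e) (fo s) := fun hs he => by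
    rw [← hfo _ hs]
    exact Ev.ld (by norm_num) he (by omega)
  intro s hs
  have hf := hfo' s hs
  constructor
  · refine hcell s (by omega) _ ?_
    have h3 : Gd N ω σ s (.lt .pid (.pw 1)) (s < N) := Gd.lt Ev.pid (hpw s)
    have e1 := Ev.guard h3 (fun _ => hld hs Ev.pid) fun _ => by omega
    have e2 := Ev.guard (b := (.add
      ((Expr.ld 12 (.sub .pid (.pw 1))).guard (.sub (.ld 12 (.sub .pid (.pw 1))) (.const 1)))
      ((Expr.ld 12 (.sub .pid (.pw 1))).not.guard (.ld 16 (.sub .pid (.pw 1)))))) (x := 0)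
      h3.not (fun h => absurd hs h) fun h => absurd hs h
    rw [if_pos hs] at e1
    rw [if_neg (not_not.2 hs)] at e2
    exact Ev.add e1 e2 (by omega)
  · refine hcell (N + s) (by omega) _ ?_
    have hge : ¬ N + s < N := by omega
    have h3 : Gd N ω σ (N + s) (.lt .pid (.pw 1)) (N + s < N) := Gd.lt Ev.pid (hpw _)
    have h4 : Ev N ω σ (N + s) (.sub .pid (.pw 1)) s := by
      have := Ev.sub (Ev.pid (N := N) (ω := ω) (σ := σ) (p := N + s)) (hpw (N + s))
      rwa [Nat.add_sub_cancel_left] at this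
    have hc := card_filter_range_le M (fun c => demand M q c - served N fo c ≤ freeRank N fo ord s)
    have h16 := hown s hs
    have e1 := Ev.guard (b := .ld 12 .pid) (x := 0) h3 (fun h => absurd h hge)
      fun h => absurd h hge
    have e3 := Ev.guard (Gd.nonzero (hld hs h4)) (fun _ => Ev.sub (hld hs h4)
      (Ev.const 1 (by norm_num))) fun _ => by omega
    have e4 := Ev.guard (Gd.nonzero (hld hs h4)).not (fun _ => Ev.ld (tag := 16) (by norm_num) h4
      (by omega)) fun _ => by omega
    have hval : (if fo s ≠ 0 then fo s - 1 else 0) + (if ¬ fo s ≠ 0 then σ 16 s else 0) =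
        allot M N q fo ord s := by
      rw [allot, h16]
      by_cases h : fo s = 0 <;> simp [h]
    have hlt : allot M N q fo ord s ≤ N := by
      rw [allot]
      split_ifs <;> omega
    have e5 := Ev.add e3 e4 (by rw [hval]; omega)
    rw [hval] at e5
    have e6 := Ev.guard h3.not (fun _ => e5) fun _ => by omega
    rw [if_neg hge] at e1
    rw [if_pos hge] at e6
    have e7 := Ev.add e1 e6 (by omega)
    rwa [zero_add] at e7

end Stages

end PVER2HK

namespace PVER2HK

/-! ### The search for a maximum matching -/

theorem defective_congr {n : ℕ} {E E' X : ℕ → ℕ → Prop} (h : ∀ i < n, ∀ s < n, E i s ↔ E' i s) :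
    Defective n E X ↔ Defective n E' X := by
  have hA : AltStep n E X = AltStep n E' X := by
    funext i j
    refine propext (and_congr_right fun hi => and_congr_right fun _ =>
      exists_congr fun s => and_congr_right fun hs => and_congr_left fun _ => h i hi s hs)
  rw [Defective, Defective, hA]
  refine or_congr_right ?_
  refine exists_congr fun i => and_congr_right fun _ => exists_congr fun j =>
    and_congr_right fun hj => exists_congr fun s => and_congr_right fun hs => ?_
  rw [h j hj s hs]

/-- The edges between the copies `m * N + j` of the users and the subchannels. -/
def SlotEdge (M N : ℕ) (inp : ℕ → ℕ) (i s : ℕ) : Prop :=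
  i / N < M ∧ i % N < inp (2 + i / N) ∧ s < N ∧ inp (2 + 2 * M + (i / N * N + s)) ≠ 0

open Classical in
/-- The weights of the entries of the matrix. -/
noncomputable def slotWeight (N : ℕ) (E : ℕ → ℕ → Prop) (ω : ℕ → ℕ) (i s : ℕ) : ℕ :=
  1 + N ^ 7 * (if E i s then 1 else 0) + ω (i * N ^ 2 + s) % N ^ 5

theorem one_le_slotWeight (N : ℕ) (E : ℕ → ℕ → Prop) (ω : ℕ → ℕ) (i s : ℕ) :
    1 ≤ slotWeight N E ω i s := (Nat.le_add_right _ _).trans (Nat.le_add_right _ _)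

open PowerSeries in
/-- The coefficient of degree `t` of the determinant without the entry `e`. -/
noncomputable def detCoeff (N : ℕ) (w : ℕ → ℕ → ℕ) (e t : ℕ) : ZMod 2 :=
  coeff t (leadingMinor (entry w fun i s => e = i * N ^ 2 + s) (N ^ 2))

/-- The edge is used in the leading term of the determinant. -/
def Leading (N : ℕ) (w : ℕ → ℕ → ℕ) (x : ℕ) : Prop :=
  ∃ t < N ^ 10, detCoeff N w (N ^ 4) t ≠ 0 ∧
    (∀ t' < N ^ 10, t < t' → detCoeff N w (N ^ 4) t' = 0) ∧ detCoeff N w x t = 0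

def Prog.search : Prog :=
  .seq (.put 2 .edgeGuard .pid (.const 1)) <| .seq (.put 3 (.lt .pid (.pw 4)) .pid .weight) <|
  .seq (.put 4 (.codedStep (.dg 32 5) (.dg 16 16) (.dg 0 16)) .pid (.const 1)) <|
  .seq .squaring <| .seq (.seq .markLower .select) .verify

section Stages

variable {N : ℕ} {ω : ℕ → ℕ} {J : ℕ} {σ : ℕ → ℕ → ℕ}

theorem trans_search (hN : 2 ≤ N) (hJ : N ^ 16 ≤ 2 ^ J) {M : ℕ} (hM : M ≤ N) (h1 : σ 0 1 = M)
    (h0 : ∀ t, t ≠ 0 → ∀ x, σ t x = 0) :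
    Trans N ω J .search σ fun σ' => σ' 0 = σ 0 ∧ (∀ x, σ' 12 x = 0) ∧
      (∀ i < N ^ 2, ∀ s < N ^ 2, σ' 7 (i * N ^ 2 + s) ≠ 0 ↔ SlotEdge M N (σ 0) i s ∧
        Leading N (slotWeight N (SlotEdge M N (σ 0)) ω) (i * N ^ 2 + s)) ∧
      (σ' 8 0 ≠ 0 ↔ Defective (N ^ 2) (SlotEdge M N (σ 0))
        fun i s => σ' 7 (i * N ^ 2 + s) ≠ 0) := by
  classical
  set E := SlotEdge M N (σ 0) with hE
  set w := slotWeight N E ω with hw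
  have hpos2 : 0 < N ^ 2 := pow_pos (by omega) 2
  refine (trans_edges hN hM h1 (h0 2 (by norm_num))).seq ?_
  rintro σ₁ ⟨a1, b1⟩
  have b1' : ∀ i < N ^ 2, ∀ s < N ^ 2, σ₁ 2 (i * N ^ 2 + s) = if E i s then 1 else 0 :=
    fun i hi s hs => (b1 i hi s hs).trans (if_congr Iff.rfl rfl rfl)
  have hsplit : ∀ x < N ^ 4, ∃ i < N ^ 2, ∃ s < N ^ 2, x = i * N ^ 2 + s := fun x hx =>
    ⟨x / N ^ 2, Nat.div_lt_of_lt_mul (by rw [← pow_add]; exact hx), _, Nat.mod_lt x hpos2,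
      (Nat.div_add_mod' _ _).symm⟩
  refine (trans_weights hN ?_).seq ?_
  · intro x hx
    obtain ⟨i, hi, s, hs, rfl⟩ := hsplit x hx
    rw [b1' i hi s hs]
    split_ifs <;> omega
  rintro σ₂ ⟨a2, b2⟩
  have b2' : ∀ i < N ^ 2, ∀ s < N ^ 2, σ₂ 3 (i * N ^ 2 + s) = w i s ∧ w i s < N ^ 8 := by
    intro i hi s hs
    rw [b2 _ (mul_pow_add_lt (k := 2) (l := 2) hi hs), b1' i hi s hs]
    exact ⟨rfl, weight_lt hN (by split_ifs <;> omega) (Nat.mod_lt _ (pow_pos (by omega) 5))⟩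
  refine (trans_matrix hN b2' ?_).seq ?_
  · intro x
    rw [a2 4 (by norm_num), a1 4 (by norm_num), h0 4 (by norm_num)]
  rintro σ₃ ⟨a3, b3⟩
  refine (trans_squaring hN hJ (w := w) (one_le_slotWeight N E ω) fun e he a ha b hb => ?_).seq ?_
  · rw [b3 e he a ha b hb, squares]
    split_ifs <;> simp
  rintro σ₄ ⟨a4, b4⟩
  have c4 : ∀ t, t ≠ 1 → t ≠ 2 → t ≠ 3 → t ≠ 4 → t ≠ 5 → t ≠ 18 → σ₄ t = σ t :=
    fun t t1 t2 t3 t4 t5 t18 => by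
      rw [a4 t t1 t5 t4 t18, a3 t t4, a2 t t3, a1 t t2]
  have d4 : σ₄ 2 = σ₁ 2 := by
    rw [a4 2 (by norm_num) (by norm_num) (by norm_num) (by norm_num), a3 2 (by norm_num),
      a2 2 (by norm_num)]
  refine (trans_select hN (d := detCoeff N w) (fun x => ?_) (fun x => ?_)
    fun e he t ht => b4 e he t ht).seq ?_
  · rw [c4 6 (by norm_num) (by norm_num) (by norm_num) (by norm_num) (by norm_num) (by norm_num),
      h0 6 (by norm_num)]
  · rw [c4 7 (by norm_num) (by norm_num) (by norm_num) (by norm_num) (by norm_num) (by norm_num),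
      h0 7 (by norm_num)]
  rintro σ₅ ⟨a5, b5⟩
  have c5 : ∀ t, t ≠ 1 → t ≠ 2 → t ≠ 3 → t ≠ 4 → t ≠ 5 → t ≠ 6 → t ≠ 7 → t ≠ 18 → σ₅ t = σ t :=
    fun t t1 t2 t3 t4 t5 t6 t7 t18 => by rw [a5 t t6 t7, c4 t t1 t2 t3 t4 t5 t18]
  refine (trans_verify hN hJ (fun x => ?_) (fun x => ?_) (fun x => ?_) fun x => ?_).mono ?_
  · rw [c5, h0] <;> norm_num
  · rw [c5, h0] <;> norm_num
  · rw [c5, h0] <;> norm_num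
  · rw [c5, h0] <;> norm_num
  rintro σ₆ ⟨a6, b6⟩
  have e7 : σ₆ 7 = σ₅ 7 := by
    rw [a6 7 (by norm_num) (by norm_num) (by norm_num) (by norm_num) (by norm_num)]
  have hE2 : ∀ i < N ^ 2, ∀ s < N ^ 2, σ₅ 2 (i * N ^ 2 + s) ≠ 0 ↔ E i s := fun i hi s hs => by
    rw [a5 2 (by norm_num) (by norm_num), d4, b1' i hi s hs]
    simp
  refine ⟨?_, fun x => ?_, fun i hi s hs => ?_, ?_⟩
  · rw [a6 0, c5 0] <;> norm_num
  · rw [a6 12, c5 12, h0 12] <;> norm_num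
  · rw [e7, b5 _ (mul_pow_add_lt (k := 2) (l := 2) hi hs), ← hE2 i hi s hs,
      a5 2 (by norm_num) (by norm_num), d4]
    exact Iff.rfl
  · rw [b6, e7]
    exact defective_congr hE2

end Stages

/-- The leading term of the determinant gives the heaviest permutation. -/
theorem leading_iff {N : ℕ} (hN : 2 ≤ N) {w : ℕ → ℕ → ℕ} (hw1 : ∀ i s, 1 ≤ w i s)
    (hw : ∀ i s, w i s < N ^ 8) (σ : Equiv.Perm (Fin (N ^ 2)))
    (hσ : ∀ τ, τ ≠ σ → ∑ i, w (τ i) i < ∑ i, w (σ i) i) (i s : Fin (N ^ 2)) :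
    Leading N w (i * N ^ 2 + s) ↔ σ s = i := by
  have hT : ∑ i, w (σ i) i < N ^ 10 := by
    have : Nonempty (Fin (N ^ 2)) := ⟨⟨0, pow_pos (by omega) 2⟩⟩
    calc ∑ i, w (σ i) i < ∑ _i : Fin (N ^ 2), N ^ 8 :=
          Finset.sum_lt_sum_of_nonempty Finset.univ_nonempty fun s _ => hw _ _
      _ = N ^ 10 := by
          rw [Finset.sum_const, Finset.card_univ, Fintype.card_fin, smul_eq_mul, ← pow_add]
  -- Codes of entries are below N^4, so the number N^4 deletes nothing.
  have hnone : ∀ i s : Fin (N ^ 2), ¬ N ^ 4 = i * N ^ 2 + s := fun i s =>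
    (mul_pow_add_lt (k := 2) (l := 2) i.2 s.2).ne'
  have hfull := coeff_leadingMinor_entry w (fun i s => N ^ 4 = i * N ^ 2 + s) (N ^ 2) hw1 σ hσ
  have hi := coeff_leadingMinor_entry w (fun i' s' => (i * N ^ 2 + s : ℕ) = i' * N ^ 2 + s') (N ^ 2)
    hw1 σ hσ
  have htop : detCoeff N w (N ^ 4) (∑ i, w (σ i) i) = 1 := hfull.2.2 fun s => hnone _ _
  have hdel : detCoeff N w (i * N ^ 2 + s) (∑ i, w (σ i) i) = 0 ↔ σ s = i := by
    constructor
    · intro h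
      by_contra hne
      have := hi.2.2 fun s' he => hne ?_
      · exact one_ne_zero (this.symm.trans h)
      · have e1 := congrArg (· / N ^ 2) he
        have e2 := congrArg (· % N ^ 2) he
        simp only [mul_add_div_of_lt (Fin.isLt _), mul_add_mod_of_lt (Fin.isLt _)] at e1 e2
        rw [Fin.ext e2]
        exact (Fin.ext e1).symm
    · rintro rfl
      exact hi.2.1 ⟨s, rfl⟩
  rw [← hdel]
  constructor
  · rintro ⟨t, ht, h1, h2, h3⟩
    -- The degree `t` must be the weight of σ: above it all coefficients vanish, and below it the
    -- leading coefficient 1 contradicts `h2`.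
    rcases lt_trichotomy t (∑ i, w (σ i) i) with h | h | h
    · exact absurd (htop.symm.trans (h2 _ hT h)) one_ne_zero
    · rwa [← h]
    · exact absurd (hfull.1 t h) h1
  · intro h
    exact ⟨_, hT, by rw [htop]; exact one_ne_zero, fun t' _ ht' => hfull.1 t' ht', h⟩

/-- If there is a unique heaviest permutation, then the selected matching has no defect. -/
theorem not_defective {N : ℕ} (hN : 2 ≤ N) {E X : ℕ → ℕ → Prop} {ω : ℕ → ℕ}
    (hX : ∀ i < N ^ 2, ∀ s < N ^ 2, X i s ↔ E i s ∧ Leading N (slotWeight N E ω) (i * N ^ 2 + s))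
    (σ : Equiv.Perm (Fin (N ^ 2))) (hσ : ∀ τ, τ ≠ σ →
      ∑ i, slotWeight N E ω (τ i) i < ∑ i, slotWeight N E ω (σ i) i) :
    ¬ Defective (N ^ 2) E X := by
  classical
  have h5 : 0 < N ^ 5 := pow_pos (by omega) 5
  have : Nonempty (Fin (N ^ 2)) := ⟨⟨0, pow_pos (by omega) 2⟩⟩
  have hX' : ∀ i s : Fin (N ^ 2), X i s ↔ E i s ∧ σ s = i := fun i s => by
    rw [hX i i.2 s s.2, leading_iff hN (one_le_slotWeight N E ω) (fun i s => ?_) σ hσ]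
    exact weight_lt hN (by split_ifs <;> omega) (Nat.mod_lt _ h5)
  rintro (⟨x, hx, y, hy, z, hz, hne, h | h⟩ | ⟨i, hi, j, hj, s, hs, hfree, hreach, hE, hs'⟩)
  · have h1 := ((hX' ⟨x, hx⟩ ⟨z, hz⟩).1 h.1).2
    have h2 := ((hX' ⟨y, hy⟩ ⟨z, hz⟩).1 h.2).2
    exact hne (Fin.mk.inj_iff.1 (h1.symm.trans h2))
  · have h1 := ((hX' ⟨z, hz⟩ ⟨x, hx⟩).1 h.1).2
    have h2 := ((hX' ⟨z, hz⟩ ⟨y, hy⟩).1 h.2).2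
    exact hne (Fin.mk.inj_iff.1 (σ.injective (h1.trans h2.symm)))
  · set edge : Fin (N ^ 2) → Fin (N ^ 2) → Prop := fun i s => E i s with hedge
    -- An alternating path of the selection is an alternating path of σ; a row without a selected
    -- edge is one that σ does not place on an edge.
    have hk : ∀ j, Relation.ReflTransGen (AltStep (N ^ 2) E X) i j → ∀ hj : j < N ^ 2,
        ∃ k, rowReach edge σ k ⟨j, hj⟩ := by
      intro j hr
      induction hr with
      | refl =>
        intro hj
        refine ⟨0, fun he => ?_⟩
        exact hfree _ (σ.symm ⟨i, hj⟩).2 ((hX' ⟨i, hj⟩ _).2 ⟨he, σ.apply_symm_apply _⟩)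
      | @tail b c _ hbc ih =>
        intro hc
        obtain ⟨hb, -, s, hs, h1, h2⟩ := hbc
        obtain ⟨k, hk⟩ := ih hb
        obtain ⟨h3, h4⟩ := (hX' ⟨c, hc⟩ ⟨s, hs⟩).1 h2
        exact ⟨k + 1, .inr ⟨_, hk, ⟨s, hs⟩, h1, h4, h3⟩⟩
    obtain ⟨k, hk⟩ := hk j hreach hj
    obtain ⟨τ, hτ⟩ := exists_edgeCount_lt edge k σ _ ⟨s, hs⟩ hk hE fun he =>
      hs' _ (σ ⟨s, hs⟩).2 ((hX' _ ⟨s, hs⟩).2 ⟨he, rfl⟩)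
    refine absurd hτ (not_lt.2 ?_)
    -- The factor N^7 = N² · N^5 is the number of columns times the range of the random parts.
    refine edgeCount_le_of_heaviest edge (B := N ^ 7) (R := N ^ 5)
      (w := fun i s => slotWeight N E ω i s) (r := fun i s => ω (i * N ^ 2 + s) % N ^ 5)
      (fun i s => Nat.mod_lt _ h5) ?_ (fun i s => rfl) (fun τ => ?_) τ
    · rw [Fintype.card_fin, ← pow_add]
    · by_cases h : τ = σ
      · rw [h]
      · exact (hσ τ h).le

end PVER2HK

/-! ### Translation between the instance and its memory encoding. -/

namespace PVER2HK

open Finset in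
theorem card_filter_range (N : ℕ) (P : ℕ → Prop) [DecidablePred P] :
    #{s ∈ range N | P s} = {s : Fin N | P s}.ncard := by
  rw [← Set.ncard_image_of_injective _ Fin.val_injective, ← Set.ncard_coe_finset]
  congr 1
  ext s
  simp only [coe_filter, mem_range, Set.mem_ofPred_eq, Set.mem_image]
  constructor
  · rintro ⟨h1, h2⟩
    exact ⟨⟨s, h1⟩, h2, rfl⟩
  · rintro ⟨s, h, rfl⟩
    exact ⟨s.2, h⟩

namespace Inst

variable {M N : ℕ} (I : Inst M N) (d : I.Draw)

/-! ### The input -/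

theorem adj_list : ((List.finRange M).flatMap fun m =>
    (List.finRange N).map fun s => (I.adj m s).toNat) =
      List.ofFn fun x : Fin (M * N) => (I.adj x.divNat x.modNat).toNat := by
  rw [List.ofFn_mul, List.flatMap, List.ofFn_eq_map]
  congr 2
  funext m
  rw [List.ofFn_eq_map]
  refine List.map_congr_left fun s _ => ?_
  congr 2
  · refine Fin.ext ?_
    rw [Fin.coe_divNat]
    exact (mul_add_div_of_lt s.2).symm
  · refine Fin.ext ?_
    rw [Fin.coe_modNat]
    exact (mul_add_mod_of_lt s.2).symm

theorem getD_ofFn {n : ℕ} (f : Fin n → ℕ) (i : Fin n) : (List.ofFn f).getD i 0 = f i := by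
  simp [List.getD_eq_getElem?_getD]

theorem input_spec : I.input d 0 = N ∧ I.input d 1 = M ∧
    (∀ m : Fin M, I.input d (2 + m) = I.K m) ∧ (∀ m : Fin M, I.input d (2 + M + m) = I.Kt m) ∧
    (∀ (m : Fin M) (s : Fin N), I.input d (2 + 2 * M + (m * N + s)) = (I.adj m s).toNat) ∧
    (∀ s : Fin N, I.input d (2 + 2 * M + M * N + s) = d.order s) ∧
    ∀ a, 2 + 2 * M + M * N + N + 1 + I.Kmin ≤ a → I.input d a = 0 := by
  unfold input
  rw [adj_list]
  refine ⟨rfl, rfl, fun m => ?_, fun m => ?_, fun m s => ?_, fun s => ?_, fun a ha => ?_⟩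
  · have := m.2
    rw [List.getD_append, List.getD_append, List.getD_append, List.getD_append, List.getD_append,
      List.getD_append_right] <;> simp <;> omega
  · have := m.2
    rw [List.getD_append, List.getD_append, List.getD_append, List.getD_append,
      List.getD_append_right]
    · rw [show 2 + M + m - ([N, M] ++ List.ofFn I.K).length = (m : ℕ) by simp; omega, getD_ofFn]
    all_goals simp
    all_goals omega
  · have h : (m : ℕ) * N + s < M * N := by
      have h1 : ((m : ℕ) + 1) * N ≤ M * N := Nat.mul_le_mul_right _ m.2
      have h2 := s.2
      rw [add_mul, one_mul] at h1
      omega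
    rw [List.getD_append, List.getD_append, List.getD_append, List.getD_append_right]
    · rw [show 2 + 2 * M + (m * N + s) - ([N, M] ++ List.ofFn I.K ++ List.ofFn I.Kt).length =
        ((⟨m * N + s, h⟩ : Fin (M * N)) : ℕ) by simp; omega, getD_ofFn]
      congr 2
      · exact Fin.ext (mul_add_div_of_lt s.2)
      · exact Fin.ext (mul_add_mod_of_lt s.2)
    all_goals simp
    all_goals omega
  · have := s.2
    rw [List.getD_append, List.getD_append, List.getD_append_right]
    · rw [show 2 + 2 * M + M * N + s - ([N, M] ++ List.ofFn I.K ++ List.ofFn I.Kt ++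
        List.ofFn fun x : Fin (M * N) => (I.adj x.divNat x.modNat).toNat).length = (s : ℕ) by
          simp; omega, getD_ofFn]
    all_goals simp
    all_goals omega
  · refine List.getD_eq_default _ _ ?_
    simp
    omega

/-- The input is shorter than N^53, so it lies within array 0 and all other arrays start with zeros.
-/
theorem rep_input (hM : 2 ≤ M) :
    Rep N (I.input d) fun tag i => if tag = 0 then I.input d i else 0 := by
  have hMN := I.le_size
  have hN : 2 ≤ N := hM.trans hMN
  obtain ⟨h0, -, -, -, -, -, hz⟩ := I.input_spec d
  refine ⟨hN, by simpa using h0, fun tag _ i hi => ?_⟩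
  by_cases ht : tag = 0
  · simp [ht]
  · refine (hz _ ?_).trans (if_neg ht).symm
    have h1 : N ^ 53 ≤ tag * N ^ 53 := Nat.le_mul_of_pos_left _ (by omega)
    have h2 := (size_bound hN hMN (show N - 1 < N by omega) (show N - 1 < N by omega)).2.2
    have h3 : I.Kmin ≤ N := (I.Kmin_le ⟨0, by omega⟩).trans (I.K_le _)
    have h4 : N ^ 5 ≤ N ^ 53 := Nat.pow_le_pow_right (by omega) (by norm_num)
    have h5 : M * N ≤ N * N := Nat.mul_le_mul_right _ hMN
    have h6 : N * N * 8 ≤ N ^ 5 := by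
      calc N * N * 8 ≤ N * N * N ^ 3 := Nat.mul_le_mul_left _ (two_pow_le_pow hN 3)
        _ = N ^ 5 := by ring
    have h7 : 2 * N ≤ N * N := Nat.mul_le_mul_right _ hN
    generalize tag * N ^ 53 = u at *
    generalize N ^ 53 = r at *
    generalize N ^ 5 = r' at *
    generalize N * N = q at *
    generalize M * N = v at *
    omega

/-! ### The matching of the expanded graph -/

/-- The number of the copy at the position `x`. -/
noncomputable def slot (x : Fin (I.rotated d).length) : ℕ :=
  (I.position d x).1 * N + (I.position d x).2

variable {I d}

theorem slot_div (x : Fin (I.rotated d).length) : I.slot d x / N = I.user d x :=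
  mul_add_div_of_lt ((I.position d x).2.2.trans_le (I.K_le _))

theorem slot_mod (x : Fin (I.rotated d).length) : I.slot d x % N = (I.position d x).2 :=
  mul_add_mod_of_lt ((I.position d x).2.2.trans_le (I.K_le _))

theorem slot_lt (x : Fin (I.rotated d).length) : I.slot d x < N ^ 2 := by
  have h1 := (I.position d x).2.2.trans_le (I.K_le _)
  have h2 := (I.position d x).1.2.trans_le I.le_size
  have h3 : (((I.position d x).1 : ℕ) + 1) * N ≤ N * N := Nat.mul_le_mul_right _ h2
  rw [add_mul, one_mul] at h3
  rw [sq, slot]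
  omega

theorem slot_injective : Function.Injective (I.slot d) := by
  intro x y h
  have h1 := congrArg (· / N) h
  have h2 := congrArg (· % N) h
  simp only [slot_div, slot_mod] at h1 h2
  refine (I.position d).injective (Sigma.ext (Fin.ext h1) ?_)
  exact (Fin.heq_ext_iff (by rw [← user_eq, ← user_eq, Fin.ext h1])).2 h2

theorem slotEdge_slot {x : Fin (I.rotated d).length} {s : Fin N} :
    SlotEdge M N (I.input d) (I.slot d x) s ↔ I.ExpandedAdj d x s := by
  obtain ⟨-, -, hK, -, hadj, -⟩ := I.input_spec d
  rw [SlotEdge, slot_div, slot_mod, hK, hadj, ExpandedAdj, Adj]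
  have h1 := (I.user d x).2
  have h2 := (I.position d x).2.2
  constructor
  · rintro ⟨-, -, -, h⟩
    simpa using h
  · intro h
    exact ⟨h1, h2, s.2, by simp [h]⟩

theorem exists_slot {i s : ℕ} (h : SlotEdge M N (I.input d) i s) : s < N ∧ ∃ x, I.slot d x = i := by
  obtain ⟨-, -, hK, -⟩ := I.input_spec d
  obtain ⟨h1, h2, h3, -⟩ := h
  rw [hK ⟨i / N, h1⟩] at h2
  refine ⟨h3, (I.position d).symm ⟨⟨i / N, h1⟩, ⟨i % N, h2⟩⟩, ?_⟩
  rw [slot, Equiv.apply_symm_apply]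
  exact Nat.div_add_mod' i N

variable (I d) in
/-- The edges of the expanded graph in the selection `T`. -/
def selection (T : ℕ → ℕ → Prop) : Set (Fin (I.rotated d).length × Fin N) :=
  {e | T (I.slot d e.1) e.2}

section Selection

variable {T : ℕ → ℕ → Prop}
  (hT : ∀ i < N ^ 2, ∀ s < N ^ 2, T i s → SlotEdge M N (I.input d) i s)

include hT

theorem freeLeft_selection {x : Fin (I.rotated d).length} (h : FreeLeft (I.selection d T) x) :
    ∀ s < N ^ 2, ¬ T (I.slot d x) s := fun s hs hTs =>
  h ⟨s, (exists_slot (hT _ (slot_lt x) s hs hTs)).1⟩ hTs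

theorem freeRight_selection {s : Fin N} (hs : (s : ℕ) < N ^ 2)
    (h : FreeRight (I.selection d T) s) : ∀ i < N ^ 2, ¬ T i s := fun i hi hTs => by
  obtain ⟨x, rfl⟩ := (exists_slot (hT i hi s hs hTs)).2
  exact h x hTs

/-- Without a free edge, which would be an augmenting path of length 1, the matching is maximal and
arises in one phase. Without any augmenting path, the copies reachable from free rows form a closed
set without a free neighbour, and the loop stops. -/
theorem selection_spec (hdef : ¬ Defective (N ^ 2) (SlotEdge M N (I.input d)) T) {lmax : ℝ}
    (hl : 1 < lmax) : IsMatching (I.ExpandedAdj d) (I.selection d T) ∧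
      (∃ t, Loop (I.ExpandedAdj d) lmax (I.selection d T) t) ∧
      Stopped (I.ExpandedAdj d) lmax (I.selection d T) := by
  have hlt : ∀ s : Fin N, (s : ℕ) < N ^ 2 := fun s =>
    s.2.trans_le (Nat.le_self_pow (by norm_num) N)
  rw [Defective, not_or] at hdef
  obtain ⟨hconf, haug⟩ := hdef
  push Not at hconf haug
  have hX : IsMatching (I.ExpandedAdj d) (I.selection d T) := by
    refine ⟨fun e he => slotEdge_slot.1 (hT _ (slot_lt _) _ (hlt _) he), ?_⟩
    rintro ⟨x, s⟩ he ⟨y, s'⟩ he' h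
    change T (I.slot d x) s at he
    change T (I.slot d y) s' at he'
    by_contra hne
    rcases h with h | h
    · obtain rfl : x = y := h
      have hss : (s : ℕ) ≠ s' := fun hss => hne (by rw [Fin.ext hss])
      exact (hconf s (hlt s) s' (hlt s') _ (slot_lt x) hss).2 he he'
    · obtain rfl : s = s' := h
      have hxy : I.slot d x ≠ I.slot d y := fun hxy => hne (by rw [slot_injective hxy])
      exact (hconf _ (slot_lt x) _ (slot_lt y) s (hlt s) hxy).1 he he'
  refine ⟨hX, hX.loop hl fun x s hx hs hA => ?_, ?_⟩
  · obtain ⟨i', hi', h⟩ := haug _ (slot_lt x) _ (slot_lt x) s (hlt s) (freeLeft_selection hT hx) .refl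
      (slotEdge_slot.2 hA)
    exact freeRight_selection hT (hlt s) hs i' hi' h
  · refine stopped_of_closed {x | ∃ i < N ^ 2, (∀ s < N ^ 2, ¬ T i s) ∧ Relation.ReflTransGen
      (AltStep (N ^ 2) (SlotEdge M N (I.input d)) T) i (I.slot d x)} (fun x hx => ?_) ?_ ?_
    · exact ⟨_, slot_lt x, freeLeft_selection hT hx, .refl⟩
    · rintro x ⟨i, hi, h1, h2⟩ s hA y hy
      exact ⟨i, hi, h1, h2.tail ⟨slot_lt x, slot_lt y, s, hlt s, slotEdge_slot.2 hA, hy⟩⟩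
    · rintro x ⟨i, hi, h1, h2⟩ s hA hs
      obtain ⟨i', hi', h⟩ := haug i hi _ (slot_lt x) s (hlt s) h1 h2 (slotEdge_slot.2 hA)
      exact freeRight_selection hT (hlt s) hs i' hi' h

theorem mem_contract_selection {fo : ℕ → ℕ}
    (hfo : ∀ i < N ^ 2, ∀ s < N ^ 2, T i s → fo s = i / N + 1)
    (hfo' : ∀ s, (∀ i < N ^ 2, ¬ T i s) → fo s = 0) {m : Fin M} {s : Fin N} :
    (m, s) ∈ I.contract d (I.selection d T) ↔ fo s = m + 1 := by
  have hlt : (s : ℕ) < N ^ 2 := s.2.trans_le (Nat.le_self_pow (by norm_num) N)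
  rw [mem_contract]
  constructor
  · rintro ⟨x, hx, rfl⟩
    rw [hfo _ (slot_lt x) s hlt hx, slot_div]
  · intro h
    by_contra hn
    push Not at hn
    have hne : ∃ i < N ^ 2, T i s := by
      by_contra hn'
      push Not at hn'
      rw [hfo' s hn'] at h
      omega
    obtain ⟨i, hi, hTi⟩ := hne
    obtain ⟨x, rfl⟩ := (exists_slot (hT i hi s hlt hTi)).2
    rw [hfo _ hi s hlt hTi, slot_div] at h
    exact hn x hTi (Fin.ext (by omega))

end Selection

theorem isAllocation_allot (hM : 0 < M) {F : Set (Fin M × Fin N)} (hF : IsFMatching I.Adj I.K F)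
    {fo q ord : ℕ → ℕ} (hfoM : ∀ s < N, fo s ≤ M)
    (hfo : ∀ (m : Fin M) (s : Fin N), (m, s) ∈ F ↔ fo s = m + 1) (hq : ∀ m : Fin M, q m = I.Kt m)
    (hord : ∀ s : Fin N, ord s = d.order s) :
    ∃ owner : Fin N → Fin M, I.IsAllocation d F owner ∧
      ∀ s, (owner s : ℕ) = allot M N q fo ord s := by
  have hsum : ∑ m ∈ Finset.range M, q m = N := by
    rw [Finset.sum_range]
    simp only [hq, I.sum_Kt]
  have hle : ∀ m < M, ((Finset.range N).filter fun s => fo s = m + 1).card ≤ q m := by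
    intro m hm
    rw [card_filter_range, hq ⟨m, hm⟩]
    refine le_trans (le_of_eq ?_) ((hF.2.1 ⟨m, hm⟩).trans (I.le_Kt _))
    congr 1
    ext s
    exact (hfo ⟨m, hm⟩ s).symm
  have hinj : Set.InjOn ord (Finset.range N) := by
    intro s hs s' hs' h
    have hs := Finset.mem_range.1 (Finset.mem_coe.1 hs)
    have hs' := Finset.mem_range.1 (Finset.mem_coe.1 hs')
    rw [hord ⟨s, hs⟩, hord ⟨s', hs'⟩] at h
    exact Fin.mk.inj_iff.1 (d.order.injective (Fin.ext h))
  have hfree : ∀ s : Fin N, FreeRight F s → fo s = 0 := by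
    intro s hs
    by_contra hne
    have := hfoM s s.2
    exact hs ⟨fo s - 1, by omega⟩ ((hfo _ s).2 (by simp; omega))
  refine ⟨fun s => ⟨_, allot_lt hsum hle hfoM hinj hM s.2⟩, ⟨?_, ?_, ?_⟩, fun _ => rfl⟩
  · rintro ⟨m, s⟩ he
    refine Fin.ext ?_
    have := (hfo m s).1 he
    simp [allot, this]
  · intro m
    rw [← hq, ← card_allot_eq hsum hle hfoM hinj m.2, card_filter_range]
    congr 1
    ext s
    exact Fin.ext_iff
  · intro s s' hs hs' h
    refine allot_mono (hfree s hs) (hfree s' hs') ?_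
    rw [hord, hord]
    exact h.le

end Inst

end PVER2HK

/-! ### The complete program: correctness, halting probability and running time. -/

namespace PVER2HK

/-- If the guard is zero for all processors, then the loop never ends. -/
theorem Exec.loop_idle {W : ℕ} {ω : ℕ → ℕ} {b a v : Expr} {L : Prog} {mem mem' : ℕ → ℕ} {t : ℕ}
    (h : Exec W ω L mem mem' t) (hL : L = .loop b (.par (.const 0) a v)) :
    mem' = mem ∧ b.eval W ω mem 0 = 0 := by
  induction h with
  | par => cases hL
  | seq => cases hL
  | cond_true => cases hL
  | cond_false => cases hL
  | loop_false hb => cases hL; exact ⟨rfl, hb⟩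
  | @loop_true _ _ mem mem₁ _ _ _ hb h1 _ _ ih =>
    cases hL
    have hm : mem₁ = mem := by
      cases h1
      funext c
      rw [parWrite, dif_neg]
      rintro ⟨p, -, hp, -⟩
      exact hp (Nat.zero_mod W)
    exact absurd (hm ▸ (ih rfl).2) hb

/-- The program: search for a maximum matching, continue if it has been verified, and compute the
output. -/
def Prog.main : Prog :=
  .seq .search <| .seq (.loop (.ld 8 (.const 0)) (.par (.const 0) .pid .pid)) <|
  .seq .matched <| .seq .allocate .output

section Main

variable {M N : ℕ} (I : Inst M N) (d : I.Draw) (ω : ℕ → ℕ)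

/-- The rest of the program, after a successful verification. -/
theorem exec_finish (hM : 2 ≤ M) {J : ℕ} (hJ : N ^ 16 ≤ 2 ^ J) {η : ℝ}
    (hη : 0 < 2 * Real.log N ^ η) {σ : ℕ → ℕ → ℕ} {mem : ℕ → ℕ} (hr : Rep N mem σ) (h0 : σ 0 = I.input d) (h12 : ∀ x, σ 12 x = 0)
    (hT : ∀ i < N ^ 2, ∀ s < N ^ 2, σ 7 (i * N ^ 2 + s) ≠ 0 → SlotEdge M N (I.input d) i s)
    (hdef : ¬ Defective (N ^ 2) (SlotEdge M N (I.input d)) fun i s => σ 7 (i * N ^ 2 + s) ≠ 0) :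
    ∃ mem' t, Exec (N ^ 58) ω (.seq .matched (.seq .allocate .output)) mem mem' t ∧
      t ≤ (Prog.seq .matched (.seq .allocate .output)).time J ∧
      ∃ X t' F owner, I.Run d η X t' F owner ∧ Inst.IsOutput mem' F owner := by
  classical
  have hMN := I.le_size
  have hN : 2 ≤ N := hM.trans hMN
  have hNN : N ≤ N ^ 2 := Nat.le_self_pow (by norm_num) N
  obtain ⟨-, h1, -, hKt, -, hord, -⟩ := I.input_spec d
  set T : ℕ → ℕ → Prop := fun i s => σ 7 (i * N ^ 2 + s) ≠ 0 with hTdef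
  -- The selection has no conflicts, so the chosen row is the only one, and `U` is one more than the
  -- matched user.
  let U : ℕ → ℕ := fun s => if h : ∃ i < N ^ 2, T i s then h.choose / N + 1 else 0
  have hconf : ∀ i < N ^ 2, ∀ j < N ^ 2, ∀ s < N ^ 2, T i s → T j s → i = j := by
    intro i hi j hj s hs hTi hTj
    by_contra hne
    exact hdef (.inl ⟨i, hi, j, hj, s, hs, hne, .inl ⟨hTi, hTj⟩⟩)
  have hU : ∀ i < N ^ 2, ∀ s < N ^ 2, T i s → U s = i / N + 1 := by
    intro i hi s hs hTi
    have h : ∃ i < N ^ 2, T i s := ⟨i, hi, hTi⟩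
    simp only [U]
    rw [dif_pos h, hconf _ h.choose_spec.1 i hi s hs h.choose_spec.2 hTi]
  have hU' : ∀ s, (∀ i < N ^ 2, ¬ T i s) → U s = 0 := by
    intro s hs
    refine dif_neg ?_
    rintro ⟨i, hi, h⟩
    exact hs i hi h
  have hUM : ∀ s < N, U s ≤ M := by
    intro s hs
    by_cases h : ∃ i < N ^ 2, T i s
    · obtain ⟨i, hi, h⟩ := h
      rw [hU i hi s (hs.trans_le hNN) h]
      exact (hT i hi s (hs.trans_le hNN) h).1
    · push Not at h
      rw [hU' s h]
      exact Nat.zero_le _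
  have hUN : ∀ s < N, U s ≤ N := fun s hs => (hUM s hs).trans hMN
  obtain ⟨hX, ⟨t', hloop⟩, hstopped⟩ := Inst.selection_spec hT hdef
    (show 1 < 2 * Real.log N ^ η + 1 by linarith)
  have hF := Inst.isFMatching_contract hX
  obtain ⟨owner, hown, hown'⟩ := Inst.isAllocation_allot (d := d) (by omega) hF hUM
    (fun m s => Inst.mem_contract_selection hT hU hU') (q := fun m => I.input d (2 + M + m))
    (ord := fun s => I.input d (2 + 2 * M + M * N + s)) hKt hord
  have hsum : ∑ m ∈ Finset.range M, I.input d (2 + M + m) = N := by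
    rw [Finset.sum_range]
    simp only [hKt, I.sum_Kt]
  obtain ⟨mem₁, t₁, σ₁, e1, e2, e3, e4, e5⟩ := trans_matched (ω := ω) (J := J) hN h12 hU mem hr
  have hfo : ∀ s < N, σ₁ 12 s = U s := by
    intro s hs
    rw [e5 s (hs.trans_le hNN)]
    split_ifs with h
    · rfl
    · push Not at h
      exact (hU' s fun i hi => not_ne_iff.2 (h i hi)).symm
  have h0' : σ₁ 0 = I.input d := by rw [e4 0 (by norm_num), h0]
  obtain ⟨mem₂, t₂, σ₂, f1, f2, f3, f4, f5, f6⟩ := trans_allocate (ω := ω) hN hJ hMN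
    (by rw [h0', h1]) (q := fun m => I.input d (2 + M + m))
    (ord := fun s => I.input d (2 + 2 * M + M * N + s)) (fun m _ => by rw [h0']) hsum hfo
    (fun s _ => by rw [h0']) mem₁ e3
  obtain ⟨mem₃, t₃, g1, g2, g3⟩ := exec_output (ω := ω) (J := J) hN hMN
    (fun s hs => by rw [f4, hfo s hs]) hUN f6 f3
  refine ⟨mem₃, _, .seq e1 (.seq f1 g1), add_le_add e2 (add_le_add f2 g2), _, t', _, owner,
    ⟨hloop, hstopped, rfl, hown⟩, fun s => ⟨?_, ?_⟩⟩
  · rw [(g3 s s.2).1]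
    by_cases h : U s = 0
    · right
      refine ⟨fun m hm => ?_, h⟩
      rw [Inst.mem_contract_selection hT hU hU', h] at hm
      omega
    · left
      have := hUM s s.2
      refine ⟨⟨U s - 1, by omega⟩, ?_, ?_⟩
      · rw [Inst.mem_contract_selection hT hU hU']
        show U s = U s - 1 + 1
        omega
      · show U s = U s - 1 + 1
        omega
  · rw [(g3 s s.2).2, hown' s]

theorem exec_search (hM : 2 ≤ M) {J : ℕ} (hJ : N ^ 16 ≤ 2 ^ J) :
    ∃ mem t σ, Exec (N ^ 58) ω .search (I.input d) mem t ∧ t ≤ Prog.search.time J ∧ Rep N mem σ ∧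
      σ 0 = I.input d ∧ (∀ x, σ 12 x = 0) ∧
      (∀ i < N ^ 2, ∀ s < N ^ 2, σ 7 (i * N ^ 2 + s) ≠ 0 ↔ SlotEdge M N (I.input d) i s ∧
        Leading N (slotWeight N (SlotEdge M N (I.input d)) ω) (i * N ^ 2 + s)) ∧
      (σ 8 0 ≠ 0 ↔ Defective (N ^ 2) (SlotEdge M N (I.input d))
        fun i s => σ 7 (i * N ^ 2 + s) ≠ 0) :=
  trans_search (σ := fun tag i => if tag = 0 then I.input d i else 0) (hM.trans I.le_size) hJ
    I.le_size (I.input_spec d).2.1 (fun _ ht _ => if_neg ht) _ (I.rep_input d hM)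

theorem flag_eval {σ : ℕ → ℕ → ℕ} {mem : ℕ → ℕ} (hr : Rep N mem σ) :
    (Expr.ld 8 (.const 0)).eval (N ^ 58) ω mem 0 = σ 8 0 :=
  Ev.ld (by norm_num) (Ev.const 0 (by norm_num)) (pow_pos (by have := hr.1; omega) 53) mem hr

end Main

theorem two_log_rpow_pos {N : ℕ} (hN : 2 ≤ N) (η : ℝ) : 0 < 2 * Real.log N ^ η := by
  have : 0 < Real.log N := Real.log_pos (by exact_mod_cast hN)
  positivity

/-- A run that halts has left the idle loop, so the flag was zero and the selection was verified.
Here `J` may be as crude as N^16, because the running time plays no role. -/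
theorem implements_main (η : ℝ) : Implements .main 58 η := by
  intro M N hM I d ω mem t h
  have hJ : N ^ 16 ≤ 2 ^ (N ^ 16) := Nat.lt_two_pow_self.le
  have hη := two_log_rpow_pos (hM.trans I.le_size) η
  obtain ⟨mem₁, t₁, σ, e1, -, e3, e4, e5, e6, e7⟩ := exec_search I d (table ω) hM hJ
  unfold Prog.main at h
  cases h with
  | seq h1 h2 =>
    obtain ⟨rfl, -⟩ := h1.deterministic e1
    cases h2 with
    | seq h2 h3 =>
      obtain ⟨rfl, hb⟩ := h2.loop_idle rfl
      rw [flag_eval _ e3] at hb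
      obtain ⟨mem', t', f1, -, X, t'', F, owner, f2⟩ := exec_finish I d (table ω) hM hJ hη e3 e4 e5
        (fun i hi s hs h => ((e6 i hi s hs).1 h).1) fun hd => e7.2 hd hb
      obtain ⟨rfl, -⟩ := h3.deterministic f1
      exact ⟨X, t'', F, owner, f2⟩

/-- Random words that isolate a permutation make the program halt. -/
theorem halts_of_isolated {M N : ℕ} (hM : 2 ≤ M) (I : Inst M N) (d : I.Draw) (ω : ℕ → ℕ) {J : ℕ}
    (hJ : N ^ 16 ≤ 2 ^ J) (σ : Equiv.Perm (Fin (N ^ 2)))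
    (hσ : ∀ τ, τ ≠ σ → ∑ i, slotWeight N (SlotEdge M N (I.input d)) ω (τ i) i <
      ∑ i, slotWeight N (SlotEdge M N (I.input d)) ω (σ i) i) :
    ∃ mem t, Exec (N ^ 58) ω .main (I.input d) mem t ∧ t ≤ Prog.main.time J := by
  have hN := hM.trans I.le_size
  obtain ⟨mem₁, t₁, σ₁, e1, e2, e3, e4, e5, e6, e7⟩ := exec_search I d ω hM hJ
  have hd := not_defective hN e6 σ hσ
  -- Any exponent would do, as only the execution and its time are used.
  obtain ⟨mem', t', f1, f2, -⟩ := exec_finish I d ω hM hJ (two_log_rpow_pos hN 1) e3 e4 e5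
    (fun i hi s hs h => ((e6 i hi s hs).1 h).1) hd
  refine ⟨mem', _, .seq e1 (.seq (.loop_false ?_) f1), add_le_add e2 (add_le_add ?_ f2)⟩
  · rw [flag_eval _ e3]
    exact not_ne_iff.1 fun h => hd (e7.1 h)
  · rw [Prog.time, Prog.time]
    nlinarith

/-- At most one in `N` tables of random words isolates no permutation. -/
theorem card_not_isolated {N : ℕ} (hN : 2 ≤ N) (E : ℕ → ℕ → Prop) :
    Nat.card {ω : Fin (N ^ 58) → Fin (N ^ 58) // ¬ ∃ σ : Equiv.Perm (Fin (N ^ 2)), ∀ τ, τ ≠ σ →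
      ∑ i, slotWeight N E (table ω) (τ i) i < ∑ i, slotWeight N E (table ω) (σ i) i} * N ≤
      Nat.card (Fin (N ^ 58) → Fin (N ^ 58)) := by
  classical
  let mem : Equiv.Perm (Fin (N ^ 2)) → Finset (Fin (N ^ 2) × Fin (N ^ 2)) := fun σ =>
    Finset.univ.image fun i => (σ i, i)
  have hmem : Function.Injective mem := by
    intro σ τ h
    ext i : 1
    have h1 : (σ i, i) ∈ mem σ := Finset.mem_image.2 ⟨i, Finset.mem_univ i, rfl⟩
    rw [h] at h1
    obtain ⟨j, -, hj⟩ := Finset.mem_image.1 h1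
    obtain ⟨h2, rfl⟩ := Prod.mk.inj hj
    exact h2.symm
  have hlt : ∀ x : Fin (N ^ 2) × Fin (N ^ 2), (x.1 : ℕ) * N ^ 2 + x.2 < N ^ 58 := fun x =>
    lt_words hN (by norm_num) (mul_pow_add_lt (k := 2) (l := 2) x.1.2 x.2.2)
  let emb : Fin (N ^ 2) × Fin (N ^ 2) → Fin (N ^ 58) := fun x => ⟨_, hlt x⟩
  have hemb : Function.Injective emb := by
    intro x y h
    have h' := Fin.mk.inj_iff.1 h
    have h1 := congrArg (· / N ^ 2) h'
    have h2 := congrArg (· % N ^ 2) h'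
    simp only [mul_add_div_of_lt (Fin.isLt _), mul_add_mod_of_lt (Fin.isLt _)] at h1 h2
    exact Prod.ext (Fin.ext h1) (Fin.ext h2)
  have hsum : ∀ (ω : Fin (N ^ 58) → Fin (N ^ 58)) σ,
      ∑ y ∈ mem σ, randomWeight (fun x => 1 + N ^ 7 * (if E x.1 x.2 then 1 else 0)) emb (N ^ 5) ω y =
        ∑ i, slotWeight N E (table ω) (σ i) i := by
    intro ω σ
    rw [Finset.sum_image fun i _ j _ h => (Prod.mk.inj h).2]
    refine Finset.sum_congr rfl fun i _ => ?_
    rw [randomWeight, slotWeight, table, dif_pos (hlt (σ i, i))]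
  have h := isolation hmem (fun x => 1 + N ^ 7 * (if E x.1 x.2 then 1 else 0)) hemb
    (R := N ^ 5) (pow_pos (by omega) 5) (pow_dvd_pow N (by norm_num))
  simp only [hsum] at h
  -- There are N^4 entries and N^5 random values for each, so the failure probability is at most
  -- 1/N.
  rw [Fintype.card_prod, Fintype.card_fin, ← pow_add, pow_succ N 4, mul_comm (N ^ 4) N, ← mul_assoc,
    mul_comm (N ^ (2 + 2))] at h
  exact Nat.le_of_mul_le_mul_right h (pow_pos (by omega) 4)

/-- Time is quadratic in J, about 16 log₂ N. The ratio x of log N and log 2 is at least 1, unlike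
log N itself, so x² is at most x^(2η) for η ≥ 1. -/
theorem exists_time_le_log : ∃ κ : ℝ, 0 ≤ κ ∧ ∀ N : ℕ, 2 ≤ N → ∃ J, N ^ 16 ≤ 2 ^ J ∧
    ∀ η : ℝ, 1 ≤ η → (Prog.main.time J : ℝ) ≤ κ * (Real.log 2 ^ (2 * η))⁻¹ * Real.log N ^ (2 * η) := by
  obtain ⟨κ, hκ⟩ := Prog.main.exists_time_le
  have hdepth : Prog.main.depth = 2 := rfl
  rw [hdepth] at hκ
  refine ⟨κ * 18 ^ 2, by positivity, fun N hN => ⟨Nat.clog 2 (N ^ 16), Nat.le_pow_clog (by norm_num) _,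
    fun η hη => ?_⟩⟩
  have hl2 : 0 < Real.log 2 := Real.log_pos (by norm_num)
  have hlN : Real.log 2 ≤ Real.log N := Real.log_le_log (by norm_num) (by exact_mod_cast hN)
  set J := Nat.clog 2 (N ^ 16) with hJ
  have hJN : 2 ^ (J - 1) ≤ N ^ 16 := by
    have h16 : 1 < N ^ 16 := Nat.one_lt_pow (by norm_num) (by omega)
    exact (Nat.pow_pred_clog_lt_self (by norm_num) h16).le
  set x : ℝ := Real.log N / Real.log 2 with hx
  have hx1 : 1 ≤ x := (one_le_div hl2).2 hlN
  -- From 2 ^ (J - 1) ≤ N^16 follows J + 1 ≤ 16x + 2, and x ≥ 1 absorbs the 2.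
  have hJx : ((J : ℝ) + 1) ≤ 18 * x := by
    have h1 : ((J - 1 : ℕ) : ℝ) * Real.log 2 ≤ 16 * Real.log N := by
      rw [← Real.log_pow, show (16 : ℝ) * Real.log N = ((16 : ℕ) : ℝ) * Real.log N by norm_num,
        ← Real.log_pow]
      exact Real.log_le_log (by positivity) (by exact_mod_cast hJN)
    have h2 : ((J - 1 : ℕ) : ℝ) ≤ 16 * x := by
      rw [hx, ← mul_div_assoc, le_div_iff₀ hl2]
      exact h1
    have h3 : (J : ℝ) ≤ ((J - 1 : ℕ) : ℝ) + 1 := by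
      have : J ≤ J - 1 + 1 := by omega
      exact_mod_cast this
    linarith
  have hx2 : x ^ 2 ≤ x ^ (2 * η) := by
    rw [← Real.rpow_natCast]
    exact Real.rpow_le_rpow_of_exponent_le hx1 (by push_cast; linarith)
  have hxr : x ^ (2 * η) = (Real.log 2 ^ (2 * η))⁻¹ * Real.log N ^ (2 * η) := by
    rw [hx, Real.div_rpow (hl2.le.trans hlN) hl2.le, div_eq_inv_mul]
  calc (Prog.main.time J : ℝ) ≤ κ * ((J : ℝ) + 1) ^ 2 := by exact_mod_cast hκ J
    _ ≤ κ * (18 * x) ^ 2 := by gcongr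
    _ = κ * 18 ^ 2 * x ^ 2 := by ring
    _ ≤ κ * 18 ^ 2 * x ^ (2 * η) := by gcongr
    _ = _ := by rw [hxr, mul_assoc, mul_assoc, mul_assoc]

theorem runsWithin_main {T : ℕ → ℝ}
    (hT : ∀ N : ℕ, 2 ≤ N → ∃ J, N ^ 16 ≤ 2 ^ J ∧ (Prog.main.time J : ℝ) ≤ T N) :
    RunsWithin .main 58 T := by
  intro M N hM I d
  have hN := hM.trans I.le_size
  obtain ⟨J, hJ, hJT⟩ := hT N hN
  have hbad := card_not_isolated hN (SlotEdge M N (I.input d))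
  set iso : (Fin (N ^ 58) → Fin (N ^ 58)) → Prop := fun ω => ∃ σ : Equiv.Perm (Fin (N ^ 2)),
    ∀ τ, τ ≠ σ → ∑ i, slotWeight N (SlotEdge M N (I.input d)) (table ω) (τ i) i <
      ∑ i, slotWeight N (SlotEdge M N (I.input d)) (table ω) (σ i) i with hiso
  have hgood : Nat.card {ω // iso ω} ≤ Nat.card {ω : Fin (N ^ 58) → Fin (N ^ 58) //
      ∃ mem t, Exec (N ^ 58) (table ω) .main (I.input d) mem t ∧ (t : ℝ) ≤ T N} := by
    refine Nat.card_le_card_of_injective (Subtype.map id fun ω hω => ?_)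
      (Subtype.map_injective _ Function.injective_id)
    obtain ⟨σ, hσ⟩ := hω
    obtain ⟨mem, t, h1, h2⟩ := halts_of_isolated hM I d (table ω) hJ σ hσ
    exact ⟨mem, t, h1, (Nat.cast_le.2 h2).trans hJT⟩
  have htotal : Nat.card {ω // iso ω} + Nat.card {ω // ¬ iso ω} =
      Nat.card (Fin (N ^ 58) → Fin (N ^ 58)) := by
    classical
    rw [← Nat.card_sum, Nat.card_congr (Equiv.sumCompl iso)]
  have hNR : (0 : ℝ) < N := by exact_mod_cast (by omega : 0 < N)
  have h1 : (Nat.card {ω // ¬ iso ω} : ℝ) ≤ 1 / N * Nat.card (Fin (N ^ 58) → Fin (N ^ 58)) := by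
    rw [one_div, inv_mul_eq_div, le_div_iff₀ hNR]
    exact_mod_cast hbad
  have h2 : (Nat.card {ω // iso ω} : ℝ) + Nat.card {ω // ¬ iso ω} =
      Nat.card (Fin (N ^ 58) → Fin (N ^ 58)) := by exact_mod_cast htotal
  have h3 : (Nat.card {ω // iso ω} : ℝ) ≤ Nat.card {ω : Fin (N ^ 58) → Fin (N ^ 58) //
      ∃ mem t, Exec (N ^ 58) (table ω) .main (I.input d) mem t ∧ (t : ℝ) ≤ T N} := by
    exact_mod_cast hgood
  rw [sub_mul, one_mul]
  linarith

end PVER2HK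

theorem mainTheorem12 :
    ∃ η₀ : ℝ, 0 < η₀ ∧ ∀ η : ℝ, η₀ ≤ η → ∃ C : ℝ,
      (∀ (M N : ℕ), 2 ≤ M → ∀ (I : PVER2HK.Inst M N) (d : I.Draw)
        (X : Set (Fin (I.rotated d).length × Fin N)) (t : ℕ)
        (F : Set (Fin M × Fin N)) (owner : Fin N → Fin M), I.Run d η X t F owner →
          PVER2HK.Approximates (PVER2HK.IsMatching (I.ExpandedAdj d)) (Real.log N ^ (-η)) X ∧
          PVER2HK.Approximates (PVER2HK.IsFMatching I.Adj I.K) (Real.log N ^ (-η)) F ∧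
          (t : ℝ) ≤ C * Real.log N ^ (2 * η)) ∧
      ∃ (P : PVER2HK.Prog) (c : ℕ), PVER2HK.Implements P c η ∧
        PVER2HK.RunsWithin P c (fun N => C * Real.log N ^ (2 * η)) := by
  obtain ⟨κ, hκ0, hκ⟩ := PVER2HK.exists_time_le_log
  -- The program takes time of order log² N, which requires 2η ≥ 2.
  refine ⟨1, one_pos, fun η hη => ?_⟩
  have hpos : ∀ N : ℕ, 0 ≤ Real.log N ^ (2 * η) := fun N =>
    Real.rpow_nonneg (Real.log_natCast_nonneg N) _
  refine ⟨max ((2 + (Real.log 2 ^ η)⁻¹) ^ 2) (κ * (Real.log 2 ^ (2 * η))⁻¹), ?_, .main, 58,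
    PVER2HK.implements_main η, PVER2HK.runsWithin_main fun N hN => ?_⟩
  · intro M N hM I d X t F owner h
    obtain ⟨h1, h2⟩ := h.approximates hM
    exact ⟨h1, h2, (h.layers_le hM (by linarith)).trans
      (mul_le_mul_of_nonneg_right (le_max_left _ _) (hpos N))⟩
  · obtain ⟨J, hJ, hJT⟩ := hκ N hN
    exact ⟨J, hJ, (hJT η hη).trans (mul_le_mul_of_nonneg_right (le_max_right _ _) (hpos N))⟩
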